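/- **Type preservation for domain-aware session types.** *Syntax.* Fix infinite sets of names $x,y,z,u,v$, labels $l$, domain tags $w$ and domain variables $\alpha$; a domain $\omega$ is a tag or a domain variable. Processes are $$P ::= \mathbf 0 \mid P\,|\,Q \mid (\nu y)P \mid x\langle y\rangle.P \mid x(y).P \mid\, !x(y).P \mid [x\leftrightarrow y] \mid x\triangleright\{l_i:P_i\}_{i\in I} \mid x\triangleleft l;P \mid x\langle y@\omega\rangle.P \mid x(y@\omega).P \mid x\langle\omega\rangle.P \mid x(\alpha).P$$ ($I$ finite, labels distinct; $y$ is bound in $(\nu y)P$, $x(y).P$, $!x(y).P$, $x(y@\omega).P$, and $\alpha$ in $x(\alpha).P$); $\overline x\langle y\rangle.P$ is $(\nu y)x\langle y\rangle.P$ and $\overline x\langle y@\omega\rangle.P$ is $(\nu y)x\langle y@\omega\rangle.P$. Types are $$A ::= \mathbf 1 \mid A\multimap B \mid A\otimes B \mid \&\{l_i:A_i\}_{i\in I} \mid \oplus\{l_i:A_i\}_{i\in I} \mid\, !A \mid @_\omega A \mid \forall\alpha.A \mid \exists\alpha.A \mid\, \downarrow\!\alpha.A .$$ Processes and types are identified up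 to renaming of bound names and variables. Structural congruence $\equiv$ is the least congruence with $P|\mathbf 0\equiv P$, $P|Q\equiv Q|P$, $P|(Q|R)\equiv(P|Q)|R$, $(\nu x)\mathbf 0\equiv\mathbf 0$, $[x\leftrightarrow y]\equiv[y\leftrightarrow x]$, $(\nu x)(\nu y)P\equiv(\nu y)(\nu x)P$, and $P|(\nu x)Q\equiv(\nu x)(P|Q)$ if $x$ is not free in $P$. *Reduction* $P\to Q$ is the least relation closed under $\equiv$, under $R\,|\,\cdot$ and under $(\nu y)\,\cdot$, with - $x\langle y\rangle.Q\,|\,x(z).P\to Q\,|\,P\{y/z\}$; $\;x\langle y\rangle.Q\,|\,!x(z).P\to Q\,|\,P\{y/z\}\,|\,!x(z).P$; - $x\langle y@\omega\rangle.P\,|\,x(z@\omega').Q\to P\,|\,Q\{y/z\}$; $\;x\langle\omega\rangle.P\,|\,x(\alpha).Q\to P\,|\,Q\{\omega/\alpha\}$; - $x\triangleleft l_j;P\,|\,x\triangleright\{l_i:Q_i\}_{i\in I}\to P\,|\,Q_j$ for $j\in I$; $\;(\nu x)([x\leftrightarrow y]\,|\,P)\to P\{y/x\}$ for $y\ne x$.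 *Accessibility.* $\Omega$ is a finite collection of hypotheses $\omega_1\prec\omega_2$. The framework has as parameter an arbitrary set $\mathcal R$ of Horn rules "from $a_1\prec b_1,\dots,a_n\prec b_n$ infer $a\prec b$" ($n\ge0$; the $a_i,b_i,a,b$ are domains; domain variables in a rule are schematic). $\Omega\vdash\omega_1\prec\omega_2$ is the least relation that contains $\Omega$ and is closed under all instances of the rules in $\mathcal R$; $\prec^*$ is its reflexive transitive closure, and $\Omega\vdash\omega\prec^*\Delta$ means $\Omega\vdash\omega\prec^*\omega'$ for each $x{:}A[\omega']$ in $\Delta$. *Typing.* In $\Omega;\Gamma;\Delta\vdash P::z{:}A[\omega]$ the environments $\Gamma$ (unrestricted) and $\Delta$ (linear) assign located types $A[\omega]$ to names; the names in $\Gamma$, those in $\Delta$ and $z$ are pairwise distinct. Typing is closed under $\equiv$ and under the following rules ("$\Leftarrow$" separates conclusion and premises; $\Omega$ and $\Gamma$ are those of the conclusion where not shown; newly introduced names and domain variables are fresh). - id: $x{:}A[\omega]\vdash[x\leftrightarrow z]::z{:}A[\omega]$. - cut: $\Delta_1,\Delta_2\vdash(\nu x)(P|Q)::z{:}C[\omega_1]\Leftarrow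 \Omega\vdash\omega_1\prec^*\omega_2$, $\Omega\vdash\omega_2\prec^*\Delta_1$, $\Delta_1\vdash P::x{:}A[\omega_2]$, $\Delta_2,x{:}A[\omega_2]\vdash Q::z{:}C[\omega_1]$. - cut$^!$: $\Gamma;\Delta\vdash(\nu u)(!u(x).P\,|\,Q)::z{:}C[\omega_2]\Leftarrow \Gamma;\cdot\vdash P::x{:}A[\omega_1]$, $\Gamma,u{:}A[\omega_1];\Delta\vdash Q::z{:}C[\omega_2]$. - copy: $\Gamma,u{:}A[\omega_2];\Delta\vdash\overline u\langle y\rangle.P::z{:}C[\omega_1]\Leftarrow\Omega\vdash\omega_1\prec^*\omega_2$, $\Gamma,u{:}A[\omega_2];\Delta,y{:}A[\omega_2]\vdash P::z{:}C[\omega_1]$. - $\mathbf 1$: $\cdot\vdash\mathbf 0::z{:}\mathbf 1[\omega]$; $\;\Delta,x{:}\mathbf 1[\omega_2]\vdash P::z{:}C[\omega_1]\Leftarrow\Delta\vdash P::z{:}C[\omega_1]$. - $\multimap$: $\Delta\vdash z(y).P::z{:}A\multimap B[\omega]\Leftarrow\Delta,y{:}A[\omega]\vdash P::z{:}B[\omega]$;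 $\;\Delta_1,\Delta_2,x{:}A\multimap B[\omega_2]\vdash\overline x\langle y\rangle.(P|Q)::z{:}C[\omega_1]\Leftarrow\Omega\vdash\omega_2\prec^*\Delta_1$, $\Delta_1\vdash P::y{:}A[\omega_2]$, $\Delta_2,x{:}B[\omega_2]\vdash Q::z{:}C[\omega_1]$. - $\otimes$: $\Delta_1,\Delta_2\vdash\overline z\langle y\rangle.(P|Q)::z{:}A\otimes B[\omega]\Leftarrow\Delta_1\vdash P::y{:}A[\omega]$, $\Delta_2\vdash Q::z{:}B[\omega]$; $\;\Delta,x{:}A\otimes B[\omega_2]\vdash x(y).P::z{:}C[\omega_1]\Leftarrow\Delta,y{:}A[\omega_2],x{:}B[\omega_2]\vdash P::z{:}C[\omega_1]$. - $!$: $\cdot\vdash\overline z\langle u\rangle.!u(y).Q::z{:}!A[\omega]\Leftarrow\cdot\vdash Q::y{:}A[\omega]$; $\;\Gamma;\Delta,x{:}!A[\omega_2]\vdash x(u).P::z{:}C[\omega_1]\Leftarrow\Gamma,u{:}A[\omega_2];\Delta\vdash P::z{:}C[\omega_1]$. - $\&$: $\Delta\vdash z\triangleright\{l_i:P_i\}_{i\in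 I}::z{:}\&\{l_i:A_i\}_{i\in I}[\omega]\Leftarrow\Delta\vdash P_i::z{:}A_i[\omega]$ for all $i\in I$; $\;\Delta,x{:}\&\{l:A\}[\omega_2]\vdash x\triangleleft l;P::z{:}C[\omega_1]\Leftarrow\Delta,x{:}A[\omega_2]\vdash P::z{:}C[\omega_1]$. - $\oplus$: $\Delta\vdash z\triangleleft l;P::z{:}\oplus\{l:A\}[\omega]\Leftarrow\Delta\vdash P::z{:}A[\omega]$; $\;\Delta,x{:}\oplus\{l_i:A_i\}_{i\in I}[\omega_2]\vdash x\triangleright\{l_i:Q_i\}_{i\in I}::z{:}C[\omega_1]\Leftarrow\Delta,x{:}A_i[\omega_2]\vdash Q_i::z{:}C[\omega_1]$ for all $i\in I$. - Width subtyping: for $k\notin I$, write $\&_I=\&\{l_i:A_i\}_{i\in I}$, $\&_{I,k}=\&\{l_i:A_i\}_{i\in I\cup\{k\}}$, and likewise $\oplus_I$, $\oplus_{I,k}$. Then $\Delta,x{:}\&_{I,k}[\omega_2]\vdash P::z{:}C[\omega_1]\Leftarrow\Delta,x{:}\&_I[\omega_2]\vdash P::z{:}C[\omega_1]$; $\;\Delta\vdash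 P::z{:}\oplus_{I,k}[\omega]\Leftarrow\Delta\vdash P::z{:}\oplus_I[\omega]$; $\;\Delta\vdash P::z{:}\&_I[\omega]\Leftarrow\Delta\vdash P::z{:}\&_{I,k}[\omega]$; $\;\Delta,x{:}\oplus_I[\omega_2]\vdash P::z{:}C[\omega_1]\Leftarrow\Delta,x{:}\oplus_{I,k}[\omega_2]\vdash P::z{:}C[\omega_1]$. - $@$: $\Delta\vdash\overline z\langle y@\omega_2\rangle.P::z{:}@_{\omega_2}A[\omega_1]\Leftarrow\Omega\vdash\omega_1\prec\omega_2$, $\Omega\vdash\omega_2\prec^*\Delta$, $\Delta\vdash P::y{:}A[\omega_2]$; $\;\Omega;\Gamma;\Delta,x{:}@_{\omega_3}A[\omega_2]\vdash x(y@\omega_3).P::z{:}C[\omega_1]\Leftarrow\Omega,\omega_2\prec\omega_3;\Gamma;\Delta,y{:}A[\omega_3]\vdash P::z{:}C[\omega_1]$. - $\forall$: $\Omega;\Gamma;\Delta\vdash z(\alpha).P::z{:}\forall\alpha.A[\omega_1]\Leftarrow\Omega,\omega_1\prec\alpha;\Gamma;\Delta\vdash P::z{:}A[\omega_1]$; $\;\Delta,x{:}\forall\alpha.A[\omega_2]\vdash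 x\langle\omega_3\rangle.Q::z{:}C[\omega_1]\Leftarrow\Omega\vdash\omega_2\prec\omega_3$, $\Delta,x{:}A\{\omega_3/\alpha\}[\omega_2]\vdash Q::z{:}C[\omega_1]$. - $\exists$: $\Delta\vdash z\langle\omega_2\rangle.P::z{:}\exists\alpha.A[\omega_1]\Leftarrow\Omega\vdash\omega_1\prec\omega_2$, $\Delta\vdash P::z{:}A\{\omega_2/\alpha\}[\omega_1]$; $\;\Omega;\Gamma;\Delta,x{:}\exists\alpha.A[\omega_2]\vdash x(\alpha).Q::z{:}C[\omega_1]\Leftarrow\Omega,\omega_2\prec\alpha;\Gamma;\Delta,x{:}A[\omega_2]\vdash Q::z{:}C[\omega_1]$. - $\downarrow$: $\Delta\vdash P::z{:}\downarrow\!\alpha.A[\omega]\Leftarrow\Delta\vdash P::z{:}A\{\omega/\alpha\}[\omega]$; $\;\Delta,x{:}\downarrow\!\alpha.A[\omega]\vdash P::z{:}C[\omega_1]\Leftarrow\Delta,x{:}A\{\omega/\alpha\}[\omega]\vdash P::z{:}C[\omega_1]$. **Theorem.** For every rule set $\mathcal R$: if $\Omega;\Gamma;\Delta\vdash P::z{:}A[\omega]$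 and $P\to Q$, then $\Omega;\Gamma;\Delta\vdash Q::z{:}A[\omega]$. -/

import Mathlib

/-!
Domain-aware session types: processes, structural congruence, reduction, accessibility, typing.

Names, labels, domain tags and domain variables range over countably infinite sets, represented by
four copies of `ℕ`.  Binding (of names and of domain variables) is represented by de Bruijn
indices, so that processes and types are identified up to renaming of bound names and variables:
inside the scope of a binder the bound name (or variable) is `0`, and the name (or variable) that
is called `n` outside is called `n + 1`.
-/

namespace DomainSession

/-- Domains `ω`: concrete domains `w` and domain variables `α`. -/
inductive Dom : Type
  | tag (w : ℕ)
  | var (α : ℕ)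

/-- Simultaneous substitution of domains for domain variables. -/
def Dom.subst (σ : ℕ → Dom) : Dom → Dom
  | .tag w => .tag w
  | .var α => σ α

/-- The substitution that weakens by one new domain variable `0`. -/
def Dom.wk : ℕ → Dom := fun n => .var (n + 1)

/-- The substitution `{ω/0}`, which eliminates the variable `0`. -/
def Dom.single (ω : Dom) : ℕ → Dom
  | 0 => ω
  | n + 1 => .var n

/-- The substitution `σ`, pushed under a binder of a domain variable. -/
def Dom.up (σ : ℕ → Dom) : ℕ → Dom
  | 0 => .var 0
  | n + 1 => (σ n).subst Dom.wk

/-- Types.  In `amp I A` and `plus I A` (labelled `&` and `⊕`), `I` is the finite set of labels and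
`A l` is the type of the branch labelled `l`; `all`, `ex` and `here` bind a domain variable. -/
inductive Ty : Type
  | one : Ty
  | lolli (A B : Ty) : Ty
  | tensor (A B : Ty) : Ty
  | amp (I : Finset ℕ) (A : {l // l ∈ I} → Ty) : Ty
  | plus (I : Finset ℕ) (A : {l // l ∈ I} → Ty) : Ty
  | bang (A : Ty) : Ty
  | atDom (ω : Dom) (A : Ty) : Ty
  | all (A : Ty) : Ty
  | ex (A : Ty) : Ty
  | here (A : Ty) : Ty

/-- Capture-avoiding simultaneous substitution of domains for domain variables in a type. -/
def Ty.subst (σ : ℕ → Dom) : Ty → Ty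
  | .one => .one
  | .lolli A B => .lolli (A.subst σ) (B.subst σ)
  | .tensor A B => .tensor (A.subst σ) (B.subst σ)
  | .amp I A => .amp I fun l => (A l).subst σ
  | .plus I A => .plus I fun l => (A l).subst σ
  | .bang A => .bang (A.subst σ)
  | .atDom ω A => .atDom (ω.subst σ) (A.subst σ)
  | .all A => .all (A.subst (Dom.up σ))
  | .ex A => .ex (A.subst (Dom.up σ))
  | .here A => .here (A.subst (Dom.up σ))

/-- The processes of the calculus. -/
inductive Proc : Type
  /-- inaction `0` -/
  | zero : Proc
  /-- parallel composition `P | Q` -/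
  | par (P Q : Proc) : Proc
  /-- restriction `(ν y) P`; binds a name -/
  | nu (P : Proc) : Proc
  /-- (free) output `x⟨y⟩.P` -/
  | out (x y : ℕ) (P : Proc) : Proc
  /-- input `x(y).P`; binds a name -/
  | inp (x : ℕ) (P : Proc) : Proc
  /-- replicated input `!x(y).P`; binds a name -/
  | rep (x : ℕ) (P : Proc) : Proc
  /-- forwarder `[x ↔ y]` -/
  | fwd (x y : ℕ) : Proc
  /-- branching on `x`: the branch labelled `l ∈ I` is `P l` -/
  | branch (x : ℕ) (I : Finset ℕ) (P : {l // l ∈ I} → Proc) : Proc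
  /-- selection of the label `l` on `x` -/
  | sel (x l : ℕ) (P : Proc) : Proc
  /-- `x⟨y @ ω⟩.P` -/
  | moveOut (x y : ℕ) (ω : Dom) (P : Proc) : Proc
  /-- `x(y @ ω).P`; binds a name -/
  | moveIn (x : ℕ) (ω : Dom) (P : Proc) : Proc
  /-- domain output `x⟨ω⟩.P` -/
  | domOut (x : ℕ) (ω : Dom) (P : Proc) : Proc
  /-- domain input `x(α).P`; binds a domain variable -/
  | domIn (x : ℕ) (P : Proc) : Proc

/-- The renaming `ρ`, pushed under a binder of a name. -/
def lift (ρ : ℕ → ℕ) : ℕ → ℕ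
  | 0 => 0
  | n + 1 => ρ n + 1

/-- Capture-avoiding simultaneous renaming of free names. -/
def Proc.rename (ρ : ℕ → ℕ) : Proc → Proc
  | .zero => .zero
  | .par P Q => .par (P.rename ρ) (Q.rename ρ)
  | .nu P => .nu (P.rename (lift ρ))
  | .out x y P => .out (ρ x) (ρ y) (P.rename ρ)
  | .inp x P => .inp (ρ x) (P.rename (lift ρ))
  | .rep x P => .rep (ρ x) (P.rename (lift ρ))
  | .fwd x y => .fwd (ρ x) (ρ y)
  | .branch x I P => .branch (ρ x) I fun l => (P l).rename ρ
  | .sel x l P => .sel (ρ x) l (P.rename ρ)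
  | .moveOut x y ω P => .moveOut (ρ x) (ρ y) ω (P.rename ρ)
  | .moveIn x ω P => .moveIn (ρ x) ω (P.rename (lift ρ))
  | .domOut x ω P => .domOut (ρ x) ω (P.rename ρ)
  | .domIn x P => .domIn (ρ x) (P.rename ρ)

/-- Capture-avoiding simultaneous substitution of domains for domain variables in a process. -/
def Proc.dsubst (σ : ℕ → Dom) : Proc → Proc
  | .zero => .zero
  | .par P Q => .par (P.dsubst σ) (Q.dsubst σ)
  | .nu P => .nu (P.dsubst σ)
  | .out x y P => .out x y (P.dsubst σ)
  | .inp x P => .inp x (P.dsubst σ)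
  | .rep x P => .rep x (P.dsubst σ)
  | .fwd x y => .fwd x y
  | .branch x I P => .branch x I fun l => (P l).dsubst σ
  | .sel x l P => .sel x l (P.dsubst σ)
  | .moveOut x y ω P => .moveOut x y (ω.subst σ) (P.dsubst σ)
  | .moveIn x ω P => .moveIn x (ω.subst σ) (P.dsubst σ)
  | .domOut x ω P => .domOut x (ω.subst σ) (P.dsubst σ)
  | .domIn x P => .domIn x (P.dsubst (Dom.up σ))

/-- `P.wk` is `P`, seen in the scope of one more (outermost) name `0`, which does not occur in it. -/
def Proc.wk (P : Proc) : Proc := P.rename Nat.succ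

/-- As `Proc.wk`, but for a `P` in the scope of a bound name: that name stays `0`, and the new name,
which does not occur, is `1`. -/
def Proc.wk₁ (P : Proc) : Proc := P.rename (lift Nat.succ)

/-- The renaming `{y/0}`, which eliminates the name `0`. -/
def instName (y : ℕ) : ℕ → ℕ
  | 0 => y
  | n + 1 => n

/-- `P{y/z}`, where `z` is the outermost bound name `0` of `P`. -/
def Proc.inst (P : Proc) (y : ℕ) : Proc := P.rename (instName y)

/-- `P{ω/α}`, where `α` is the outermost bound domain variable `0` of `P`. -/
def Proc.dinst (P : Proc) (ω : Dom) : Proc := P.dsubst (Dom.single ω)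

/-- The exchange of the two innermost bound names. -/
def swapName : ℕ → ℕ
  | 0 => 1
  | 1 => 0
  | n + 2 => n + 2

/-- Structural congruence `P ≡ Q`. -/
inductive Cong : Proc → Proc → Prop
  | refl (P) : Cong P P
  | symm {P Q} : Cong P Q → Cong Q P
  | trans {P Q R} : Cong P Q → Cong Q R → Cong P R
  -- compatibility with all process constructors
  | par {P P' Q Q'} : Cong P P' → Cong Q Q' → Cong (.par P Q) (.par P' Q')
  | nu {P P'} : Cong P P' → Cong (.nu P) (.nu P')
  | out {x y P P'} : Cong P P' → Cong (.out x y P) (.out x y P')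
  | inp {x P P'} : Cong P P' → Cong (.inp x P) (.inp x P')
  | rep {x P P'} : Cong P P' → Cong (.rep x P) (.rep x P')
  | branch {x I} {P P' : {l // l ∈ I} → Proc} :
      (∀ l, Cong (P l) (P' l)) → Cong (.branch x I P) (.branch x I P')
  | sel {x l P P'} : Cong P P' → Cong (.sel x l P) (.sel x l P')
  | moveOut {x y ω P P'} : Cong P P' → Cong (.moveOut x y ω P) (.moveOut x y ω P')
  | moveIn {x ω P P'} : Cong P P' → Cong (.moveIn x ω P) (.moveIn x ω P')
  | domOut {x ω P P'} : Cong P P' → Cong (.domOut x ω P) (.domOut x ω P')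
  | domIn {x P P'} : Cong P P' → Cong (.domIn x P) (.domIn x P')
  -- the axioms
  | par_zero (P) : Cong (.par P .zero) P
  | par_comm (P Q) : Cong (.par P Q) (.par Q P)
  | par_assoc (P Q R) : Cong (.par P (.par Q R)) (.par (.par P Q) R)
  | nu_zero : Cong (.nu .zero) .zero
  | fwd_comm (x y) : Cong (.fwd x y) (.fwd y x)
  | extrude (P Q) : Cong (.par P (.nu Q)) (.nu (.par P.wk Q))
  | nu_comm (P) : Cong (.nu (.nu P)) (.nu (.nu (P.rename swapName)))

/-- Reduction `P → Q`. -/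
inductive Red : Proc → Proc → Prop
  | comm (x y P Q) : Red (.par (.out x y Q) (.inp x P)) (.par Q (P.inst y))
  | rep (x y P Q) :
      Red (.par (.out x y Q) (.rep x P)) (.par Q (.par (P.inst y) (.rep x P)))
  | move (x y ω ω' P Q) :
      Red (.par (.moveOut x y ω P) (.moveIn x ω' Q)) (.par P (Q.inst y))
  | dom (x ω P Q) : Red (.par (.domOut x ω P) (.domIn x Q)) (.par P (Q.dinst ω))
  /-- `(ν x)([x ↔ y] | P) → P{y/x}` -/
  | fwd (y P) : Red (.nu (.par (.fwd 0 (y + 1)) P)) (P.inst y)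
  | choice (x I) (j : {l // l ∈ I}) (P) (Q : {l // l ∈ I} → Proc) :
      Red (.par (.sel x j P) (.branch x I Q)) (.par P (Q j))
  | par {P Q Q'} : Red Q Q' → Red (.par P Q) (.par P Q')
  | nu {P Q} : Red P Q → Red (.nu P) (.nu Q)
  | cong {P P' Q' Q} : Cong P P' → Red P' Q' → Cong Q' Q → Red P Q

/-- A schematic Horn rule for direct accessibility: from `a ≺ b` for all `(a, b)` in `prem`, infer
`concl.1 ≺ concl.2`.  The domain variables in a rule are its schematic variables. -/
structure AccRule where
  prem : List (Dom × Dom)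
  concl : Dom × Dom

/-- Accessibility hypotheses `Ω`; the pair `(ω₁, ω₂)` stands for `ω₁ ≺ ω₂`. -/
abbrev AccCtx := List (Dom × Dom)

/-- The judgment `Ω ⊢ ω₁ ≺ ω₂`.  It has the hypothesis rule and, as the parameter of the framework,
all instances of an arbitrary set `𝓡` of further rules (`𝓡 = ∅` is the simplest accessibility
relation; reflexivity, symmetry and transitivity make it an equivalence relation). -/
inductive Acc (𝓡 : Set AccRule) (Ω : AccCtx) : Dom → Dom → Prop
  | whyp {ω₁ ω₂} : (ω₁, ω₂) ∈ Ω → Acc 𝓡 Ω ω₁ ω₂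
  | rule (r : AccRule) (hr : r ∈ 𝓡) (σ : ℕ → Dom) :
      (∀ p ∈ r.prem, Acc 𝓡 Ω (p.1.subst σ) (p.2.subst σ)) →
      Acc 𝓡 Ω (r.concl.1.subst σ) (r.concl.2.subst σ)

/-- `Ω ⊢ ω₁ ≺* ω₂`. -/
def AccStar (𝓡 : Set AccRule) (Ω : AccCtx) : Dom → Dom → Prop :=
  Relation.ReflTransGen (Acc 𝓡 Ω)

/-- Type environments: `Δ x = some (A, ω)` means that `x:A[ω]` is in `Δ`. -/
abbrev Ctx := ℕ → Option (Ty × Dom)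

/-- The empty environment. -/
def Ctx.empty : Ctx := fun _ => none

/-- The environment, seen in the scope of a new name `0`, with the given entry for this name. -/
def Ctx.push (e : Option (Ty × Dom)) (Δ : Ctx) : Ctx
  | 0 => e
  | n + 1 => Δ n

/-- The environment with the entry for `x` replaced by `e` (removed, if `e = none`). -/
def Ctx.set (Δ : Ctx) (x : ℕ) (e : Option (Ty × Dom)) : Ctx := Function.update Δ x e

/-- The environment, seen in the scope of a new domain variable, which does not occur in it. -/
def Ctx.dwk (Δ : Ctx) : Ctx :=
  fun x => (Δ x).map fun e => (e.1.subst Dom.wk, e.2.subst Dom.wk)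

/-- `Δ = Δ₁, Δ₂`, where `Δ₁` and `Δ₂` have no name in common. -/
def Ctx.Split (Δ Δ₁ Δ₂ : Ctx) : Prop :=
  ∀ x, (Δ x = Δ₁ x ∧ Δ₂ x = none) ∨ (Δ x = Δ₂ x ∧ Δ₁ x = none)

/-- The hypotheses, seen in the scope of a new domain variable, which does not occur in them. -/
def AccCtx.dwk (Ω : AccCtx) : AccCtx :=
  Ω.map fun p => (p.1.subst Dom.wk, p.2.subst Dom.wk)

/-- `Ω ⊢ ω ≺* Δ`: all domains of the sessions in `Δ` are accessible from `ω`. -/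
def AccAll (𝓡 : Set AccRule) (Ω : AccCtx) (ω : Dom) (Δ : Ctx) : Prop :=
  ∀ x B ω', Δ x = some (B, ω') → AccStar 𝓡 Ω ω ω'

/-- The convention on sequents: the names declared in `Γ`, those declared in `Δ`, and the offered
name `z` are pairwise different. -/
def Distinct (Γ Δ : Ctx) (z : ℕ) : Prop :=
  Γ z = none ∧ Δ z = none ∧ ∀ x, Γ x = none ∨ Δ x = none

/-- The typing judgment `Ω ; Γ ; Δ ⊢ P :: z:A[ω]`, written `Typed 𝓡 Ω Γ Δ P z A ω`. -/
inductive Typed (𝓡 : Set AccRule) :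
    AccCtx → Ctx → Ctx → Proc → ℕ → Ty → Dom → Prop
  /-- Processes are considered modulo structural congruence. -/
  | cong {Ω Γ Δ P Q z A ω} :
      Typed 𝓡 Ω Γ Δ P z A ω → Cong P Q → Typed 𝓡 Ω Γ Δ Q z A ω
  | id {Ω Γ x z A ω} (hd : Distinct Γ (Ctx.empty.set x (some (A, ω))) z) :
      Typed 𝓡 Ω Γ (Ctx.empty.set x (some (A, ω))) (.fwd x z) z A ω
  | oneR {Ω Γ z ω} (hd : Distinct Γ Ctx.empty z) :
      Typed 𝓡 Ω Γ Ctx.empty .zero z .one ω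
  | oneL {Ω Γ Δ P z C ω₁ x ω₂} (hd : Distinct Γ Δ z) :
      Δ x = some (.one, ω₂) →
      Typed 𝓡 Ω Γ (Δ.set x none) P z C ω₁ →
      Typed 𝓡 Ω Γ Δ P z C ω₁
  | lolliR {Ω Γ Δ P z A B ω} (hd : Distinct Γ Δ z) :
      Typed 𝓡 Ω (Γ.push none) (Δ.push (some (A, ω))) P (z + 1) B ω →
      Typed 𝓡 Ω Γ Δ (.inp z P) z (.lolli A B) ω
  | lolliL {Ω Γ Δ Δ₁ Δ₂ P Q z C ω₁ x A B ω₂} (hd : Distinct Γ Δ z) :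
      Δ x = some (.lolli A B, ω₂) →
      (Δ.set x none).Split Δ₁ Δ₂ →
      AccAll 𝓡 Ω ω₂ Δ₁ →
      Typed 𝓡 Ω (Γ.push none) (Δ₁.push none) P 0 A ω₂ →
      Typed 𝓡 Ω Γ (Δ₂.set x (some (B, ω₂))) Q z C ω₁ →
      Typed 𝓡 Ω Γ Δ (.nu (.out (x + 1) 0 (.par P Q.wk))) z C ω₁
  | tensorR {Ω Γ Δ Δ₁ Δ₂ P Q z A B ω} (hd : Distinct Γ Δ z) :
      Δ.Split Δ₁ Δ₂ →
      Typed 𝓡 Ω (Γ.push none) (Δ₁.push none) P 0 A ω →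
      Typed 𝓡 Ω Γ Δ₂ Q z B ω →
      Typed 𝓡 Ω Γ Δ (.nu (.out (z + 1) 0 (.par P Q.wk))) z (.tensor A B) ω
  | tensorL {Ω Γ Δ P z C ω₁ x A B ω₂} (hd : Distinct Γ Δ z) :
      Δ x = some (.tensor A B, ω₂) →
      Typed 𝓡 Ω (Γ.push none) ((Δ.set x (some (B, ω₂))).push (some (A, ω₂))) P (z + 1) C ω₁ →
      Typed 𝓡 Ω Γ Δ (.inp x P) z C ω₁
  | ampR {Ω Γ Δ z I} {A : {l // l ∈ I} → Ty} {P : {l // l ∈ I} → Proc} {ω}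
      (hd : Distinct Γ Δ z) :
      (∀ l, Typed 𝓡 Ω Γ Δ (P l) z (A l) ω) →
      Typed 𝓡 Ω Γ Δ (.branch z I P) z (.amp I A) ω
  /-- Width subtyping for offered branchings, the counterpart of `ampL₂`. -/
  | ampR₂ {Ω Γ Δ P z} {I : Finset ℕ} {k : ℕ} {A : {l // l ∈ insert k I} → Ty} {ω}
      (hd : Distinct Γ Δ z) (hk : k ∉ I) :
      Typed 𝓡 Ω Γ Δ P z (.amp (insert k I) A) ω →
      Typed 𝓡 Ω Γ Δ P z (.amp I (fun l => A ⟨l, Finset.mem_insert_of_mem l.2⟩)) ω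
  | ampL₁ {Ω Γ Δ P z C ω₁ x l A ω₂} (hd : Distinct Γ Δ z) :
      Δ x = some (.amp {l} (fun _ => A), ω₂) →
      Typed 𝓡 Ω Γ (Δ.set x (some (A, ω₂))) P z C ω₁ →
      Typed 𝓡 Ω Γ Δ (.sel x l P) z C ω₁
  | ampL₂ {Ω Γ Δ P z C ω₁ x} {I : Finset ℕ} {k : ℕ} {A : {l // l ∈ insert k I} → Ty} {ω₂}
      (hd : Distinct Γ Δ z) (hk : k ∉ I) :
      Δ x = some (.amp (insert k I) A, ω₂) →
      Typed 𝓡 Ω Γ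
        (Δ.set x (some (.amp I (fun l => A ⟨l, Finset.mem_insert_of_mem l.2⟩), ω₂))) P z C ω₁ →
      Typed 𝓡 Ω Γ Δ P z C ω₁
  | plusR₁ {Ω Γ Δ P z l A ω} (hd : Distinct Γ Δ z) :
      Typed 𝓡 Ω Γ Δ P z A ω →
      Typed 𝓡 Ω Γ Δ (.sel z l P) z (.plus {l} (fun _ => A)) ω
  | plusR₂ {Ω Γ Δ P z} {I : Finset ℕ} {k : ℕ} {A : {l // l ∈ insert k I} → Ty} {ω}
      (hd : Distinct Γ Δ z) (hk : k ∉ I) :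
      Typed 𝓡 Ω Γ Δ P z (.plus I (fun l => A ⟨l, Finset.mem_insert_of_mem l.2⟩)) ω →
      Typed 𝓡 Ω Γ Δ P z (.plus (insert k I) A) ω
  | plusL {Ω Γ Δ z C ω₁ x I} {A : {l // l ∈ I} → Ty} {Q : {l // l ∈ I} → Proc} {ω₂}
      (hd : Distinct Γ Δ z) :
      Δ x = some (.plus I A, ω₂) →
      (∀ l, Typed 𝓡 Ω Γ (Δ.set x (some (A l, ω₂))) (Q l) z C ω₁) →
      Typed 𝓡 Ω Γ Δ (.branch x I Q) z C ω₁
  /-- Width subtyping for used selections, the counterpart of `plusR₂`. -/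
  | plusL₂ {Ω Γ Δ P z C ω₁ x} {I : Finset ℕ} {k : ℕ} {A : {l // l ∈ insert k I} → Ty} {ω₂}
      (hd : Distinct Γ Δ z) (hk : k ∉ I) :
      Δ x = some (.plus I (fun l => A ⟨l, Finset.mem_insert_of_mem l.2⟩), ω₂) →
      Typed 𝓡 Ω Γ (Δ.set x (some (.plus (insert k I) A, ω₂))) P z C ω₁ →
      Typed 𝓡 Ω Γ Δ P z C ω₁
  | bangR {Ω Γ Q z A ω} (hd : Distinct Γ Ctx.empty z) :
      Typed 𝓡 Ω (Γ.push none) Ctx.empty Q 0 A ω →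
      Typed 𝓡 Ω Γ Ctx.empty (.nu (.out (z + 1) 0 (.rep 0 Q.wk₁))) z (.bang A) ω
  | bangL {Ω Γ Δ P z C ω₁ x A ω₂} (hd : Distinct Γ Δ z) :
      Δ x = some (.bang A, ω₂) →
      Typed 𝓡 Ω (Γ.push (some (A, ω₂))) ((Δ.set x none).push none) P (z + 1) C ω₁ →
      Typed 𝓡 Ω Γ Δ (.inp x P) z C ω₁
  | atR {Ω Γ Δ P z A ω₁ ω₂} (hd : Distinct Γ Δ z) :
      Acc 𝓡 Ω ω₁ ω₂ →
      AccAll 𝓡 Ω ω₂ Δ →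
      Typed 𝓡 Ω (Γ.push none) (Δ.push none) P 0 A ω₂ →
      Typed 𝓡 Ω Γ Δ (.nu (.moveOut (z + 1) 0 ω₂ P)) z (.atDom ω₂ A) ω₁
  | atL {Ω Γ Δ P z C ω₁ x A ω₂ ω₃} (hd : Distinct Γ Δ z) :
      Δ x = some (.atDom ω₃ A, ω₂) →
      Typed 𝓡 ((ω₂, ω₃) :: Ω) (Γ.push none) ((Δ.set x none).push (some (A, ω₃)))
        P (z + 1) C ω₁ →
      Typed 𝓡 Ω Γ Δ (.moveIn x ω₃ P) z C ω₁
  | allR {Ω : AccCtx} {Γ Δ P z A ω₁} (hd : Distinct Γ Δ z) :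
      Typed 𝓡 ((ω₁.subst Dom.wk, .var 0) :: Ω.dwk) Γ.dwk Δ.dwk P z A (ω₁.subst Dom.wk) →
      Typed 𝓡 Ω Γ Δ (.domIn z P) z (.all A) ω₁
  | allL {Ω Γ Δ Q z C ω₁ x A ω₂ ω₃} (hd : Distinct Γ Δ z) :
      Δ x = some (.all A, ω₂) →
      Acc 𝓡 Ω ω₂ ω₃ →
      Typed 𝓡 Ω Γ (Δ.set x (some (A.subst (Dom.single ω₃), ω₂))) Q z C ω₁ →
      Typed 𝓡 Ω Γ Δ (.domOut x ω₃ Q) z C ω₁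
  | exR {Ω Γ Δ P z A ω₁ ω₂} (hd : Distinct Γ Δ z) :
      Acc 𝓡 Ω ω₁ ω₂ →
      Typed 𝓡 Ω Γ Δ P z (A.subst (Dom.single ω₂)) ω₁ →
      Typed 𝓡 Ω Γ Δ (.domOut z ω₂ P) z (.ex A) ω₁
  | exL {Ω : AccCtx} {Γ Δ Q z C ω₁ x A ω₂} (hd : Distinct Γ Δ z) :
      Δ x = some (.ex A, ω₂) →
      Typed 𝓡 ((ω₂.subst Dom.wk, .var 0) :: Ω.dwk) Γ.dwk
        (Δ.dwk.set x (some (A, ω₂.subst Dom.wk))) Q z (C.subst Dom.wk) (ω₁.subst Dom.wk) →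
      Typed 𝓡 Ω Γ Δ (.domIn x Q) z C ω₁
  | hereR {Ω Γ Δ P z A ω} (hd : Distinct Γ Δ z) :
      Typed 𝓡 Ω Γ Δ P z (A.subst (Dom.single ω)) ω →
      Typed 𝓡 Ω Γ Δ P z (.here A) ω
  | hereL {Ω Γ Δ P z C ω₁ x A ω} (hd : Distinct Γ Δ z) :
      Δ x = some (.here A, ω) →
      Typed 𝓡 Ω Γ (Δ.set x (some (A.subst (Dom.single ω), ω))) P z C ω₁ →
      Typed 𝓡 Ω Γ Δ P z C ω₁
  | copy {Ω Γ Δ P z C ω₁ u A ω₂} (hd : Distinct Γ Δ z) :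
      Γ u = some (A, ω₂) →
      AccStar 𝓡 Ω ω₁ ω₂ →
      Typed 𝓡 Ω (Γ.push none) (Δ.push (some (A, ω₂))) P (z + 1) C ω₁ →
      Typed 𝓡 Ω Γ Δ (.nu (.out (u + 1) 0 P)) z C ω₁
  | cut {Ω Γ Δ Δ₁ Δ₂ P Q z C ω₁ A ω₂} (hd : Distinct Γ Δ z) :
      Δ.Split Δ₁ Δ₂ →
      AccStar 𝓡 Ω ω₁ ω₂ →
      AccAll 𝓡 Ω ω₂ Δ₁ →
      Typed 𝓡 Ω (Γ.push none) (Δ₁.push none) P 0 A ω₂ →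
      Typed 𝓡 Ω (Γ.push none) (Δ₂.push (some (A, ω₂))) Q (z + 1) C ω₁ →
      Typed 𝓡 Ω Γ Δ (.nu (.par P Q)) z C ω₁
  | cutBang {Ω Γ Δ P Q z C ω₂ A ω₁} (hd : Distinct Γ Δ z) :
      Typed 𝓡 Ω (Γ.push none) Ctx.empty P 0 A ω₁ →
      Typed 𝓡 Ω (Γ.push (some (A, ω₁))) (Δ.push none) Q (z + 1) C ω₂ →
      Typed 𝓡 Ω Γ Δ (.nu (.par (.rep 0 P.wk₁) Q)) z C ω₂

end DomainSession

/-! Typing is closed under structural congruence, so a derivation for a redex says little about the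
shape of the process, and plain inversion is stopped by the congruence rule. The proof therefore
moves to objects on which `≡` acts almost trivially. Give the top-level restrictions of a process
pairwise different names in one global name space; the process then becomes a finite multiset of
threads (prefixed processes and forwarders). This is the relation `Flat`. Congruent processes have
the same multisets, up to names for idle restrictions (`Cong.flatLE`). Conversely, the multiset and
its bound names determine the process up to `≡`, because every process is congruent to a block of
restrictions in front of a parallel composition of threads (`Flat.cong_normal`, `cong_of_flat`).

Typing is carried over to multisets. In `OT` a cut is a union of multisets, the prefix rules occur
only at the leaves (`Blk`), and there is no congruence rule. `Typed.real` flattens a typing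
derivation, and `OT.exists_typed` reads one back. Up to `≡`, a reduction contracts two threads, or a
forwarder for a restricted name, under restrictions and beside a passive process (`Red.standard`).
Preservation thus becomes a statement about `OT`: two interacting threads can be exchanged for the
threads of their contractum (`OT.contracts`), and a forwarder for a bound name can be erased while
that name is identified with its partner (`OT.forward`).

For an interaction, consider the inference at which the two threads part. It may be the `cut!` that
owns a replicated input; then the output is typed by `copy` (`OT.contracts_rep`). Otherwise it is a
linear cut. Its premises share no linear and no bound name except the cut name, and the subject of
the interaction is not unrestricted there, so the cut is on the subject (`OT.contracts_cut`). The
leaf of each thread is isolated, and the derivation around it is kept as a context that can be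
refilled (`OT.userHole`, `OT.provHole`). The two leaves are cut against each other directly, which
is a principal reduction of cut elimination in intuitionistic linear logic (`CutCond.principal`).
The result fills the context of the provider, which then offers what the user's leaf offered, and
this in turn fills the context of the user.

The rearranged cuts have to satisfy the side conditions `ω₁ ≺* ω₂` and `ω₂ ≺* Δ₁`. They follow by
transitivity: the root domain changes only on entering a left premise, and there the second
condition keeps every session in use accessible from the new root. The accessibility hypotheses
added by `∀R`, `∃L` and `@L` are discharged by substituting a domain and replacing hypotheses by
derivations (`Typed.dsubst`, `Typed.of_hyps`). Both work for any set of schematic Horn rules.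

The rules for `↓` and width subtyping leave no trace in the process; `Le` collects them. Since `↓`
is invertible on both sides (`Typed.unfold`), only width subtyping remains between two types whose
heads are not `↓` (`Le.width`), so the principal types of two interacting leaves match. -/

namespace DomainSession

/-! ### Renaming of names -/

@[simp] theorem lift_zero (ρ : ℕ → ℕ) : lift ρ 0 = 0 := rfl
@[simp] theorem lift_succ (ρ : ℕ → ℕ) (n : ℕ) : lift ρ (n + 1) = ρ n + 1 := rfl
@[simp] theorem instName_zero (y : ℕ) : instName y 0 = y := rfl
@[simp] theorem instName_succ (y n : ℕ) : instName y (n + 1) = n := rfl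

/-- The renaming `ρ`, extended to a new name `0`, which is mapped to `b`. -/
def consName (b : ℕ) (ρ : ℕ → ℕ) : ℕ → ℕ
  | 0 => b
  | n + 1 => ρ n

@[simp] theorem consName_zero (b : ℕ) (ρ : ℕ → ℕ) : consName b ρ 0 = b := rfl
@[simp] theorem consName_succ (b : ℕ) (ρ : ℕ → ℕ) (n : ℕ) : consName b ρ (n + 1) = ρ n := rfl

theorem lift_comp (ρ σ : ℕ → ℕ) : lift σ ∘ lift ρ = lift (σ ∘ ρ) := by
  funext n; cases n <;> rfl

theorem lift_id : lift id = id := by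
  funext n; cases n <;> rfl

theorem Proc.rename_rename (P : Proc) : ∀ ρ σ : ℕ → ℕ,
    (P.rename ρ).rename σ = P.rename (σ ∘ ρ) := by
  induction P <;> intro ρ σ <;> simp_all [Proc.rename, lift_comp]

theorem Proc.rename_id (P : Proc) : P.rename id = P := by
  induction P <;> simp_all [Proc.rename, lift_id]

/-- The free names of a process. -/
def Proc.fn : Proc → Set ℕ
  | .zero => ∅
  | .par P Q => P.fn ∪ Q.fn
  | .nu P => {n | n + 1 ∈ P.fn}
  | .out x y P => {x, y} ∪ P.fn
  | .inp x P => {x} ∪ {n | n + 1 ∈ P.fn}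
  | .rep x P => {x} ∪ {n | n + 1 ∈ P.fn}
  | .fwd x y => {x, y}
  | .branch x _ P => {x} ∪ ⋃ l, (P l).fn
  | .sel x _ P => {x} ∪ P.fn
  | .moveOut x y _ P => {x, y} ∪ P.fn
  | .moveIn x _ P => {x} ∪ {n | n + 1 ∈ P.fn}
  | .domOut x _ P => {x} ∪ P.fn
  | .domIn x P => {x} ∪ P.fn

theorem lift_eqOn {ρ σ : ℕ → ℕ} {s : Set ℕ} (h : ∀ n, n + 1 ∈ s → ρ n = σ n) :
    ∀ n ∈ s, lift ρ n = lift σ n := by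
  rintro (_ | n) hn
  · rfl
  · simp [h n hn]

theorem Proc.rename_congr (P : Proc) : ∀ {ρ σ : ℕ → ℕ}, (∀ n ∈ P.fn, ρ n = σ n) →
    P.rename ρ = P.rename σ := by
  induction P with
  | zero => intros; rfl
  | par P Q ihP ihQ =>
    intro ρ σ h
    simp only [Proc.rename]
    rw [ihP fun n hn => h n (Or.inl hn), ihQ fun n hn => h n (Or.inr hn)]
  | nu P ih =>
    intro ρ σ h
    simp only [Proc.rename]
    rw [ih (lift_eqOn h)]
  | out x y P ih | moveOut x y ω P ih =>
    intro ρ σ h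
    simp only [Proc.rename]
    rw [ih fun n hn => h n (Or.inr hn), h x (by simp [fn]), h y (by simp [fn])]
  | inp x P ih | rep x P ih | moveIn x ω P ih =>
    intro ρ σ h
    simp only [Proc.rename]
    rw [ih (lift_eqOn fun n hn => h n (Or.inr hn)), h x (by simp [fn])]
  | fwd x y =>
    intro ρ σ h
    simp only [Proc.rename]
    rw [h x (by simp [fn]), h y (by simp [fn])]
  | branch x I P ih =>
    intro ρ σ h
    simp only [Proc.rename]
    rw [h x (by simp [fn])]
    congr 1
    funext l
    exact ih l fun n hn => h n (Or.inr (Set.mem_iUnion.2 ⟨l, hn⟩))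
  | sel x l P ih | domOut x ω P ih | domIn x P ih =>
    intro ρ σ h
    simp only [Proc.rename]
    rw [ih fun n hn => h n (Or.inr hn), h x (by simp [fn])]

theorem exists_lift_iff {ρ : ℕ → ℕ} {s : Set ℕ} {m : ℕ} :
    (∃ n ∈ s, lift ρ n = m + 1) ↔ ∃ n, n + 1 ∈ s ∧ ρ n = m := by
  constructor
  · rintro ⟨_ | n, hn, h⟩
    · simp at h
    · exact ⟨n, hn, by simpa using h⟩
  · rintro ⟨n, hn, rfl⟩
    exact ⟨n + 1, hn, rfl⟩

theorem Proc.mem_fn_rename (P : Proc) : ∀ {ρ : ℕ → ℕ} {m : ℕ},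
    m ∈ (P.rename ρ).fn ↔ ∃ n ∈ P.fn, ρ n = m := by
  induction P with
  | zero => simp [Proc.rename, fn]
  | par P Q ihP ihQ => simp [Proc.rename, fn, ihP, ihQ, or_and_right, exists_or]
  | nu P ih => intro ρ m; simp [Proc.rename, fn, ih, exists_lift_iff]
  | out x y P ih | moveOut x y ω P ih =>
    intro ρ m
    simp [Proc.rename, fn, ih, or_and_right, exists_or, eq_comm, or_assoc]
  | inp x P ih | rep x P ih | moveIn x ω P ih =>
    intro ρ m
    simp only [Proc.rename, fn, Set.mem_union, Set.mem_singleton_iff, Set.mem_ofPred_eq, ih,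
      exists_lift_iff]
    simp [or_and_right, exists_or, eq_comm]
  | fwd x y => intro ρ m; simp [Proc.rename, fn, or_and_right, exists_or, eq_comm]
  | branch x I P ih =>
    intro ρ m
    simp only [Proc.rename, fn, Set.mem_union, Set.mem_singleton_iff, Set.mem_iUnion, ih]
    constructor
    · rintro (rfl | ⟨l, n, hn, rfl⟩)
      · exact ⟨x, Or.inl rfl, rfl⟩
      · exact ⟨n, Or.inr ⟨l, hn⟩, rfl⟩
    · rintro ⟨n, rfl | ⟨l, hn⟩, rfl⟩
      · exact Or.inl rfl
      · exact Or.inr ⟨l, n, hn, rfl⟩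
  | sel x l P ih | domOut x ω P ih | domIn x P ih =>
    intro ρ m
    simp [Proc.rename, fn, ih, or_and_right, exists_or, eq_comm]

theorem Proc.rename_wk (P : Proc) (ρ : ℕ → ℕ) : P.wk.rename (lift ρ) = (P.rename ρ).wk := by
  simp only [wk, Proc.rename_rename]; rfl

theorem Proc.wk_rename_consName (P : Proc) (b : ℕ) (ρ : ℕ → ℕ) :
    P.wk.rename (consName b ρ) = P.rename ρ := by
  simp only [wk, Proc.rename_rename]; rfl

theorem Proc.rename_wk₁ (P : Proc) (ρ : ℕ → ℕ) :
    P.wk₁.rename (lift (lift ρ)) = (P.rename (lift ρ)).wk₁ := by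
  simp only [wk₁, Proc.rename_rename, lift_comp]; rfl

theorem Proc.wk₁_rename_consName (P : Proc) (b : ℕ) (ρ : ℕ → ℕ) :
    P.wk₁.rename (lift (consName b ρ)) = P.rename (lift ρ) := by
  simp only [wk₁, Proc.rename_rename, lift_comp]; rfl

theorem Proc.rename_inst (P : Proc) (y : ℕ) (ρ : ℕ → ℕ) :
    (P.inst y).rename ρ = (P.rename (lift ρ)).inst (ρ y) := by
  simp only [inst, Proc.rename_rename]
  congr 1; funext n; cases n <;> rfl

theorem Cong.rename {P Q : Proc} (h : Cong P Q) :
    ∀ ρ : ℕ → ℕ, Cong (P.rename ρ) (Q.rename ρ) := by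
  induction h with
  | refl P => intro ρ; exact .refl _
  | symm _ ih => intro ρ; exact (ih ρ).symm
  | trans _ _ ih₁ ih₂ => intro ρ; exact (ih₁ ρ).trans (ih₂ ρ)
  | par _ _ ih₁ ih₂ => intro ρ; exact .par (ih₁ ρ) (ih₂ ρ)
  | nu _ ih => intro ρ; exact .nu (ih _)
  | out _ ih => intro ρ; exact .out (ih _)
  | inp _ ih => intro ρ; exact .inp (ih _)
  | rep _ ih => intro ρ; exact .rep (ih _)
  | branch _ ih => intro ρ; exact .branch fun l => ih l _
  | sel _ ih => intro ρ; exact .sel (ih _)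
  | moveOut _ ih => intro ρ; exact .moveOut (ih _)
  | moveIn _ ih => intro ρ; exact .moveIn (ih _)
  | domOut _ ih => intro ρ; exact .domOut (ih _)
  | domIn _ ih => intro ρ; exact .domIn (ih _)
  | par_zero P => intro ρ; exact .par_zero _
  | par_comm P Q => intro ρ; exact .par_comm _ _
  | par_assoc P Q R => intro ρ; exact .par_assoc _ _ _
  | nu_zero => intro ρ; exact .nu_zero
  | fwd_comm x y => intro ρ; exact .fwd_comm _ _
  | extrude P Q =>
    intro ρ
    have := Cong.extrude (P.rename ρ) (Q.rename (lift ρ))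
    simpa only [Proc.rename, Proc.rename_wk] using this
  | nu_comm P =>
    intro ρ
    have := Cong.nu_comm (P.rename (lift (lift ρ)))
    have e : swapName ∘ lift (lift ρ) = lift (lift ρ) ∘ swapName := by
      funext n
      rcases n with _ | _ | n <;> rfl
    simpa only [Proc.rename, Proc.rename_rename, e] using this

theorem Cong.fn_eq {P Q : Proc} (h : Cong P Q) : P.fn = Q.fn := by
  induction h with
  | refl P => rfl
  | symm _ ih => exact ih.symm
  | trans _ _ ih₁ ih₂ => exact ih₁.trans ih₂
  | par_zero P => simp [Proc.fn]
  | par_comm P Q => simp [Proc.fn, Set.union_comm]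
  | par_assoc P Q R => simp [Proc.fn, Set.union_assoc]
  | nu_zero => simp [Proc.fn]
  | fwd_comm x y => simp [Proc.fn, Set.pair_comm]
  | extrude P Q =>
    ext n
    simp [Proc.fn, Proc.wk, Proc.mem_fn_rename]
  | nu_comm P =>
    ext n
    simp only [Proc.fn, Set.mem_ofPred_eq, Proc.mem_fn_rename]
    constructor
    · intro h
      exact ⟨_, h, rfl⟩
    · rintro ⟨_ | _ | m, hm, h⟩
      · simp [swapName] at h
      · simp [swapName] at h
      · simp only [swapName] at h
        rwa [← h]
  | _ => simp_all [Proc.fn]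

/-! ### Substitution of domains -/

theorem Dom.subst_subst (ω : Dom) (σ τ : ℕ → Dom) :
    (ω.subst σ).subst τ = ω.subst fun n => (σ n).subst τ := by
  cases ω <;> rfl

theorem Dom.subst_var (ω : Dom) : ω.subst Dom.var = ω := by cases ω <;> rfl

theorem Dom.up_var : Dom.up Dom.var = Dom.var := by
  funext n; cases n <;> rfl

theorem Dom.up_comp (σ τ : ℕ → Dom) :
    (fun n => (Dom.up σ n).subst (Dom.up τ)) = Dom.up fun n => (σ n).subst τ := by
  funext n
  cases n with
  | zero => rfl
  | succ n => simp only [Dom.up, Dom.subst_subst]; rfl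

theorem Ty.subst_subst (A : Ty) : ∀ σ τ : ℕ → Dom,
    (A.subst σ).subst τ = A.subst fun n => (σ n).subst τ := by
  induction A <;> intro σ τ <;> simp_all [Ty.subst, Dom.subst_subst, Dom.up_comp]

theorem Ty.subst_var (A : Ty) : A.subst Dom.var = A := by
  induction A <;> simp_all [Ty.subst, Dom.subst_var, Dom.up_var]

theorem Dom.wk_subst_up (ω : Dom) (σ : ℕ → Dom) :
    (ω.subst Dom.wk).subst (Dom.up σ) = (ω.subst σ).subst Dom.wk := by
  simp only [Dom.subst_subst]; rfl

theorem Ty.wk_subst_up (A : Ty) (σ : ℕ → Dom) :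
    (A.subst Dom.wk).subst (Dom.up σ) = (A.subst σ).subst Dom.wk := by
  simp only [Ty.subst_subst]; rfl

theorem Dom.wk_subst_single (ω ω' : Dom) : (ω.subst Dom.wk).subst (Dom.single ω') = ω := by
  rw [Dom.subst_subst]; exact Dom.subst_var ω

theorem Ty.wk_subst_single (A : Ty) (ω : Dom) : (A.subst Dom.wk).subst (Dom.single ω) = A := by
  rw [Ty.subst_subst]; exact Ty.subst_var A

theorem Ty.single_subst (A : Ty) (ω : Dom) (σ : ℕ → Dom) :
    (A.subst (Dom.single ω)).subst σ = (A.subst (Dom.up σ)).subst (Dom.single (ω.subst σ)) := by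
  simp only [Ty.subst_subst]
  congr 1
  funext n
  cases n with
  | zero => rfl
  | succ n => exact (Dom.wk_subst_single (σ n) _).symm

theorem Proc.dsubst_rename (P : Proc) : ∀ (ρ : ℕ → ℕ) (σ : ℕ → Dom),
    (P.rename ρ).dsubst σ = (P.dsubst σ).rename ρ := by
  induction P <;> intro ρ σ <;> simp_all [Proc.rename, Proc.dsubst]

theorem Cong.dsubst {P Q : Proc} (h : Cong P Q) :
    ∀ σ : ℕ → Dom, Cong (P.dsubst σ) (Q.dsubst σ) := by
  induction h with
  | refl P => intro ρ; exact .refl _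
  | symm _ ih => intro ρ; exact (ih ρ).symm
  | trans _ _ ih₁ ih₂ => intro ρ; exact (ih₁ ρ).trans (ih₂ ρ)
  | par _ _ ih₁ ih₂ => intro ρ; exact .par (ih₁ ρ) (ih₂ ρ)
  | nu _ ih => intro ρ; exact .nu (ih _)
  | out _ ih => intro ρ; exact .out (ih _)
  | inp _ ih => intro ρ; exact .inp (ih _)
  | rep _ ih => intro ρ; exact .rep (ih _)
  | branch _ ih => intro ρ; exact .branch fun l => ih l _
  | sel _ ih => intro ρ; exact .sel (ih _)
  | moveOut _ ih => intro ρ; exact .moveOut (ih _)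
  | moveIn _ ih => intro ρ; exact .moveIn (ih _)
  | domOut _ ih => intro ρ; exact .domOut (ih _)
  | domIn _ ih => intro ρ; exact .domIn (ih _)
  | par_zero P => intro ρ; exact .par_zero _
  | par_comm P Q => intro ρ; exact .par_comm _ _
  | par_assoc P Q R => intro ρ; exact .par_assoc _ _ _
  | nu_zero => intro ρ; exact .nu_zero
  | fwd_comm x y => intro ρ; exact .fwd_comm _ _
  | extrude P Q =>
    intro σ
    have := Cong.extrude (P.dsubst σ) (Q.dsubst σ)
    simpa only [Proc.dsubst, Proc.wk, Proc.dsubst_rename] using this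
  | nu_comm P =>
    intro σ
    have := Cong.nu_comm (P.dsubst σ)
    simpa only [Proc.dsubst, Proc.dsubst_rename] using this

theorem Proc.rename_dsubst (P : Proc) (ρ : ℕ → ℕ) (ω : Dom) :
    (P.dinst ω).rename ρ = (P.rename ρ).dinst ω := (P.dsubst_rename ρ _).symm

/-! ### Environments -/

section Contexts

variable {Γ Γ' Δ Δ' Δ₁ Δ₂ : Ctx} {ρ : ℕ → ℕ} {x z n : ℕ} {e : Option (Ty × Dom)}

theorem Ctx.set_apply (Δ : Ctx) (x : ℕ) (e : Option (Ty × Dom)) (n : ℕ) :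
    Δ.set x e n = if n = x then e else Δ n := by
  simp [Ctx.set, Function.update_apply]

@[simp] theorem Ctx.push_zero : Ctx.push e Δ 0 = e := rfl
@[simp] theorem Ctx.push_succ : Ctx.push e Δ (n + 1) = Δ n := rfl
@[simp] theorem Ctx.empty_apply : Ctx.empty n = none := rfl

theorem Ctx.dwk_apply (Δ : Ctx) (n : ℕ) :
    Δ.dwk n = (Δ n).map fun e => (e.1.subst Dom.wk, e.2.subst Dom.wk) := rfl

theorem Ctx.dwk_eq_none : Δ.dwk n = none ↔ Δ n = none := by
  simp [Ctx.dwk_apply]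

/-- The declarations of `Γ` are, up to the renaming `ρ`, among those of `Γ'`. -/
def GMap (ρ : ℕ → ℕ) (Γ Γ' : Ctx) : Prop := ∀ n e, Γ n = some e → Γ' (ρ n) = some e

/-- `Δ'` is the image of `Δ` under the renaming `ρ`, which is injective on `Δ`. -/
structure LMap (ρ : ℕ → ℕ) (Δ Δ' : Ctx) : Prop where
  map : ∀ n e, Δ n = some e → Δ' (ρ n) = some e
  surj : ∀ m e, Δ' m = some e → ∃ n, Δ n = some e ∧ ρ n = m
  inj : ∀ n n', Δ n ≠ none → Δ n' ≠ none → ρ n = ρ n' → n = n'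

theorem GMap.id (Γ : Ctx) : GMap id Γ Γ := fun _ _ h => h

theorem GMap.lift (h : GMap ρ Γ Γ') (e : Option (Ty × Dom)) :
    GMap (lift ρ) (Γ.push e) (Γ'.push e) := by
  rintro (_ | n) e' h'
  · exact h'
  · exact h n e' h'

theorem GMap.consName (h : GMap ρ Γ Γ') (b : ℕ) : GMap (consName b ρ) (Γ.push none) Γ' := by
  rintro (_ | n) e' h'
  · simp at h'
  · exact h n e' h'

theorem GMap.dwk (h : GMap ρ Γ Γ') : GMap ρ Γ.dwk Γ'.dwk := by
  intro n e he
  simp only [Ctx.dwk_apply, Option.map_eq_some_iff] at he ⊢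
  obtain ⟨a, ha, rfl⟩ := he
  exact ⟨a, h n a ha, rfl⟩

theorem LMap.id (Δ : Ctx) : LMap id Δ Δ :=
  ⟨fun _ _ h => h, fun m _ h => ⟨m, h, rfl⟩, fun _ _ _ _ h => h⟩

theorem LMap.apply_none (h : LMap ρ Δ Δ') (hn : ∀ m, ρ m = n → Δ m = none) : Δ' n = none := by
  rcases h' : Δ' n with _ | e
  · rfl
  · obtain ⟨m, hm, hm'⟩ := h.surj _ _ h'
    simp [hn m hm'] at hm

theorem LMap.empty (ρ : ℕ → ℕ) : LMap ρ Ctx.empty Ctx.empty :=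
  ⟨fun _ _ h => by simp at h, fun _ _ h => by simp at h, fun _ _ h => by simp at h⟩

theorem LMap.eq_empty (h : LMap ρ Ctx.empty Δ') : Δ' = Ctx.empty :=
  funext fun _ => h.apply_none fun _ _ => rfl

theorem LMap.lift (h : LMap ρ Δ Δ') (e : Option (Ty × Dom)) :
    LMap (lift ρ) (Δ.push e) (Δ'.push e) := by
  refine ⟨?_, ?_, ?_⟩
  · rintro (_ | n) e' h'
    · exact h'
    · exact h.map n e' h'
  · rintro (_ | n) e' h'
    · exact ⟨0, h', rfl⟩
    · obtain ⟨m, hm, rfl⟩ := h.surj n e' h'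
      exact ⟨m + 1, hm, rfl⟩
  · rintro (_ | n) (_ | m) h₁ h₂ h₃
    · rfl
    · simp at h₃
    · simp at h₃
    · rw [h.inj n m h₁ h₂ (by simpa using h₃)]

theorem LMap.set (h : LMap ρ Δ Δ') (hx : ∀ n, Δ n ≠ none → ρ n = ρ x → n = x) :
    LMap ρ (Δ.set x e) (Δ'.set (ρ x) e) := by
  obtain ⟨h₁, h₂, h₃⟩ := h
  refine ⟨?_, ?_, ?_⟩
  · intro n e'
    have := hx n
    have := h₁ n
    simp only [Ctx.set_apply]
    grind
  · intro m e'
    simp only [Ctx.set_apply]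
    grind
  · intro n n'
    have := hx n
    have := hx n'
    have := h₃ n n'
    simp only [Ctx.set_apply]
    grind

theorem LMap.set_of_mem (h : LMap ρ Δ Δ') (hx : Δ x ≠ none) :
    LMap ρ (Δ.set x e) (Δ'.set (ρ x) e) :=
  h.set fun n hn hn' => h.inj n x hn hx hn'

theorem LMap.set_of_none (h : LMap ρ Δ Δ') (hx : Δ' (ρ x) = none) :
    LMap ρ (Δ.set x e) (Δ'.set (ρ x) e) := by
  refine h.set fun n hn hn' => ?_
  obtain ⟨a, ha⟩ := Option.ne_none_iff_exists'.1 hn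
  have := h.map n a ha
  simp_all

theorem LMap.consName_none (h : LMap ρ Δ Δ') (b : ℕ) :
    LMap (consName b ρ) (Δ.push none) Δ' := by
  refine ⟨?_, ?_, ?_⟩
  · rintro (_ | n) e' h'
    · simp at h'
    · exact h.map n e' h'
  · intro m e' h'
    obtain ⟨n, hn, rfl⟩ := h.surj m e' h'
    exact ⟨n + 1, hn, rfl⟩
  · rintro (_ | n) (_ | m) h₁ h₂ h₃
    · rfl
    · simp at h₁
    · simp at h₂
    · rw [h.inj n m h₁ h₂ h₃]

theorem LMap.consName (h : LMap ρ Δ Δ') {b : ℕ} (hb : Δ' b = none) (e : Option (Ty × Dom)) :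
    LMap (consName b ρ) (Δ.push e) (Δ'.set b e) := by
  have : Δ.push e = (Δ.push none).set 0 e := by
    funext n; cases n <;> simp [Ctx.set_apply]
  rw [this]
  exact (h.consName_none b).set_of_none hb

theorem LMap.dwk (h : LMap ρ Δ Δ') : LMap ρ Δ.dwk Δ'.dwk := by
  refine ⟨?_, ?_, ?_⟩
  · intro n e he
    simp only [Ctx.dwk_apply, Option.map_eq_some_iff] at he ⊢
    obtain ⟨a, ha, rfl⟩ := he
    exact ⟨a, h.map n a ha, rfl⟩
  · intro n e he
    simp only [Ctx.dwk_apply, Option.map_eq_some_iff] at he ⊢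
    obtain ⟨a, ha, rfl⟩ := he
    obtain ⟨m, hm, rfl⟩ := h.surj n a ha
    exact ⟨m, ⟨a, hm, rfl⟩, rfl⟩
  · intro n n' hn hn'
    exact h.inj n n' (mt Ctx.dwk_eq_none.2 hn) (mt Ctx.dwk_eq_none.2 hn')

/-- `Δ'` is divided according to whether a name is the image of a name in `Δ₁`. Since `ρ` is
injective on `Δ`, the images of the two parts do not meet. -/
theorem LMap.split (h : LMap ρ Δ Δ') (hs : Δ.Split Δ₁ Δ₂) :
    ∃ Δ₁' Δ₂', Δ'.Split Δ₁' Δ₂' ∧ LMap ρ Δ₁ Δ₁' ∧ LMap ρ Δ₂ Δ₂' := by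
  classical
  obtain ⟨h₁, h₂, h₃⟩ := h
  refine ⟨fun m => if ∃ n, Δ₁ n ≠ none ∧ ρ n = m then Δ' m else none,
    fun m => if ∃ n, Δ₁ n ≠ none ∧ ρ n = m then none else Δ' m, ?_, ⟨?_, ?_, ?_⟩, ⟨?_, ?_, ?_⟩⟩
  · intro m
    by_cases h : ∃ n, Δ₁ n ≠ none ∧ ρ n = m <;> simp [h]
  · intro n e hn
    have : ∃ n', Δ₁ n' ≠ none ∧ ρ n' = ρ n := ⟨n, by simp [hn], rfl⟩
    have := hs n
    have := h₁ n e
    grind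
  · intro m e hm
    have hm' : ∃ n, Δ₁ n ≠ none ∧ ρ n = m := by
      by_contra hc
      simp [hc] at hm
    simp only [hm', if_true] at hm
    obtain ⟨n, hn, rfl⟩ := hm'
    refine ⟨n, ?_, rfl⟩
    obtain ⟨n', hn', he⟩ := h₂ _ _ hm
    have := hs n
    have := h₃ n' n
    grind
  · intro n n' hn hn'
    have := hs n
    have := hs n'
    have := h₃ n n'
    grind
  · intro n e hn
    have hc : ¬ ∃ n', Δ₁ n' ≠ none ∧ ρ n' = ρ n := by
      rintro ⟨n', hn', he⟩
      have := hs n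
      have := hs n'
      have := h₃ n n'
      grind
    have := hs n
    have := h₁ n e
    grind
  · intro m e hm
    have hm' : ¬ ∃ n, Δ₁ n ≠ none ∧ ρ n = m := by
      intro hc
      simp [hc] at hm
    simp only [hm', if_false] at hm
    obtain ⟨n, hn, rfl⟩ := h₂ _ _ hm
    refine ⟨n, ?_, rfl⟩
    have : Δ₁ n = none := by
      by_contra hc
      exact hm' ⟨n, hc, rfl⟩
    have := hs n
    grind
  · intro n n' hn hn'
    have := hs n
    have := hs n'
    have := h₃ n n'
    grind

theorem LMap.eq_single {a : Ty × Dom} (h : LMap ρ (Ctx.empty.set x (some a)) Δ') :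
    Δ' = Ctx.empty.set (ρ x) (some a) := by
  funext m
  rcases hm : Δ' m with _ | e
  · rcases eq_or_ne m (ρ x) with rfl | hne
    · have := h.map x a (by simp [Ctx.set_apply])
      simp_all
    · simp [Ctx.set_apply, hne]
  · obtain ⟨n, hn, rfl⟩ := h.surj m e hm
    rw [Ctx.set_apply] at hn
    split_ifs at hn with hx
    · subst hx
      simp [Ctx.set_apply, ← hn]
    · simp at hn

theorem Distinct.set_of_mem (h : Distinct Γ Δ z) (hx : Δ x ≠ none) :
    Distinct Γ (Δ.set x e) z := by
  obtain ⟨h₁, h₂, h₃⟩ := h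
  refine ⟨h₁, ?_, fun n => ?_⟩
  · rw [Ctx.set_apply]; grind
  · have := h₃ n
    rw [Ctx.set_apply]; grind

theorem Distinct.set_none (h : Distinct Γ Δ z) : Distinct Γ (Δ.set x none) z := by
  obtain ⟨h₁, h₂, h₃⟩ := h
  refine ⟨h₁, ?_, fun n => ?_⟩
  · rw [Ctx.set_apply]; grind
  · have := h₃ n
    rw [Ctx.set_apply]; grind

theorem Distinct.set_of_fresh (h : Distinct Γ Δ z) (hx : Γ x = none) (hz : x ≠ z) :
    Distinct Γ (Δ.set x e) z := by
  obtain ⟨h₁, h₂, h₃⟩ := h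
  refine ⟨h₁, ?_, fun n => ?_⟩
  · rw [Ctx.set_apply]; grind
  · have := h₃ n
    rw [Ctx.set_apply]; grind

theorem Distinct.push (h : Distinct Γ Δ z) (e : Option (Ty × Dom)) :
    Distinct (Γ.push none) (Δ.push e) (z + 1) := by
  obtain ⟨h₁, h₂, h₃⟩ := h
  refine ⟨h₁, h₂, ?_⟩
  rintro (_ | n)
  · exact Or.inl rfl
  · exact h₃ n

theorem Distinct.push_unr (h : Distinct Γ Δ z) (e : Option (Ty × Dom)) :
    Distinct (Γ.push e) (Δ.push none) (z + 1) := by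
  obtain ⟨h₁, h₂, h₃⟩ := h
  refine ⟨h₁, h₂, ?_⟩
  rintro (_ | n)
  · exact Or.inr rfl
  · exact h₃ n

theorem Distinct.push_zero (h : Distinct Γ Δ z) :
    Distinct (Γ.push none) (Δ.push none) 0 := by
  refine ⟨rfl, rfl, ?_⟩
  rintro (_ | n)
  · exact Or.inl rfl
  · exact h.2.2 n

theorem Distinct.mono (h : Distinct Γ Δ z) (hΔ : ∀ n, Δ n = none → Δ' n = none) :
    Distinct Γ Δ' z :=
  ⟨h.1, hΔ z h.2.1, fun n => (h.2.2 n).imp_right (hΔ n)⟩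

theorem Distinct.dwk (h : Distinct Γ Δ z) : Distinct Γ.dwk Δ.dwk z := by
  simpa only [Distinct, Ctx.dwk_eq_none] using h

theorem Ctx.Split.left_none (h : Δ.Split Δ₁ Δ₂) (hn : Δ n = none) : Δ₁ n = none := by
  have := h n; grind

theorem Ctx.Split.right_none (h : Δ.Split Δ₁ Δ₂) (hn : Δ n = none) : Δ₂ n = none := by
  have := h n; grind

theorem Ctx.Split.symm (h : Δ.Split Δ₁ Δ₂) : Δ.Split Δ₂ Δ₁ := fun n => (h n).symm

theorem Ctx.set_none_none (hn : Δ n = none) : Δ.set x none n = none := by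
  rw [Ctx.set_apply]; grind

theorem AccAll.lmap {𝓡 : Set AccRule} {Ω : AccCtx} {ω : Dom} (h : AccAll 𝓡 Ω ω Δ)
    (hm : LMap ρ Δ Δ') : AccAll 𝓡 Ω ω Δ' := by
  intro x B ω' hx
  obtain ⟨n, hn, -⟩ := hm.surj _ _ hx
  exact h n B ω' hn

end Contexts

/-! ### Renaming and free names of typed processes -/

theorem Typed.distinct {𝓡 : Set AccRule} {Ω Γ Δ P z A ω} (h : Typed 𝓡 Ω Γ Δ P z A ω) :
    Distinct Γ Δ z := by
  induction h with
  | cong _ _ ih => exact ih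
  | _ => assumption

/-- The two environments are treated differently because linear sessions are consumed exactly once,
so `Δ'` has to be an exact, injective image of `Δ`, while unrestricted names may be weakened or
identified. As `ρ` itself need not be injective, the instantiation of a bound name by a fresh one
and the weakening of `Γ` are both special cases. -/
theorem Typed.rename {𝓡 : Set AccRule} {Ω Γ Δ P z A ω} (h : Typed 𝓡 Ω Γ Δ P z A ω) :
    ∀ {ρ : ℕ → ℕ} {Γ' Δ' : Ctx}, GMap ρ Γ Γ' → LMap ρ Δ Δ' → Distinct Γ' Δ' (ρ z) →
      Typed 𝓡 Ω Γ' Δ' (P.rename ρ) (ρ z) A ω := by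
  induction h with
  | cong _ hc ih => intro ρ Γ' Δ' hΓ hΔ hd'; exact .cong (ih hΓ hΔ hd') (hc.rename ρ)
  | id hd =>
    intro ρ Γ' Δ' hΓ hΔ hd'
    obtain rfl := hΔ.eq_single
    exact .id hd'
  | oneR hd =>
    intro ρ Γ' Δ' hΓ hΔ hd'
    obtain rfl := hΔ.eq_empty
    exact .oneR hd'
  | oneL hd hx _ ih =>
    intro ρ Γ' Δ' hΓ hΔ hd'
    exact .oneL hd' (hΔ.map _ _ hx) (ih hΓ (hΔ.set_of_mem (by simp [hx])) hd'.set_none)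
  | lolliR hd _ ih =>
    intro ρ Γ' Δ' hΓ hΔ hd'
    exact .lolliR hd' (ih (hΓ.lift _) (hΔ.lift _) (hd'.push _))
  | @lolliL _ _ _ _ _ _ _ _ _ _ x _ _ _ hd hx hs ha _ _ ih₁ ih₂ =>
    intro ρ Γ' Δ' hΓ hΔ hd'
    obtain ⟨Δ₁', Δ₂', hs', h₁, h₂⟩ :=
      (hΔ.set_of_mem (x := x) (e := none) (by simp [hx])).split hs
    have d := hd'.set_none (x := ρ x)
    have hn : (Δ'.set (ρ x) none) (ρ x) = none := by simp [Ctx.set_apply]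
    have := Typed.lolliL hd' (hΔ.map _ _ hx) hs' (ha.lmap h₁)
      (ih₁ (hΓ.lift _) (h₁.lift _) (d.mono fun _ => hs'.left_none).push_zero)
      (ih₂ hΓ (h₂.set_of_none (hs'.right_none hn))
        ((d.mono fun _ => hs'.right_none).set_of_fresh
          (by have := hd'.2.2 (ρ x); have := hΔ.map _ _ hx; grind)
          (by have := hd'.2.1; have := hΔ.map _ _ hx; grind)))
    simpa only [Proc.rename, Proc.rename_wk, lift_zero, lift_succ] using this
  | tensorR hd hs _ _ ih₁ ih₂ =>
    intro ρ Γ' Δ' hΓ hΔ hd'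
    obtain ⟨Δ₁', Δ₂', hs', h₁, h₂⟩ := hΔ.split hs
    have := Typed.tensorR hd' hs'
      (ih₁ (hΓ.lift _) (h₁.lift _) (hd'.mono fun _ => hs'.left_none).push_zero)
      (ih₂ hΓ h₂ (hd'.mono fun _ => hs'.right_none))
    simpa only [Proc.rename, Proc.rename_wk, lift_zero, lift_succ] using this
  | tensorL hd hx _ ih =>
    intro ρ Γ' Δ' hΓ hΔ hd'
    have hx' := hΔ.map _ _ hx
    exact .tensorL hd' hx' (ih (hΓ.lift _) ((hΔ.set_of_mem (by simp [hx])).lift _)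
      ((hd'.set_of_mem (by simp [hx'])).push _))
  | ampR hd _ ih =>
    intro ρ Γ' Δ' hΓ hΔ hd'
    exact .ampR hd' fun l => ih l hΓ hΔ hd'
  | ampR₂ hd hk _ ih =>
    intro ρ Γ' Δ' hΓ hΔ hd'
    exact .ampR₂ hd' hk (ih hΓ hΔ hd')
  | ampL₁ hd hx _ ih =>
    intro ρ Γ' Δ' hΓ hΔ hd'
    have hx' := hΔ.map _ _ hx
    exact .ampL₁ hd' hx' (ih hΓ (hΔ.set_of_mem (by simp [hx])) (hd'.set_of_mem (by simp [hx'])))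
  | ampL₂ hd hk hx _ ih =>
    intro ρ Γ' Δ' hΓ hΔ hd'
    have hx' := hΔ.map _ _ hx
    exact .ampL₂ hd' hk hx'
      (ih hΓ (hΔ.set_of_mem (by simp [hx])) (hd'.set_of_mem (by simp [hx'])))
  | plusR₁ hd _ ih =>
    intro ρ Γ' Δ' hΓ hΔ hd'
    exact .plusR₁ hd' (ih hΓ hΔ hd')
  | plusR₂ hd hk _ ih =>
    intro ρ Γ' Δ' hΓ hΔ hd'
    exact .plusR₂ hd' hk (ih hΓ hΔ hd')
  | plusL hd hx _ ih =>
    intro ρ Γ' Δ' hΓ hΔ hd'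
    have hx' := hΔ.map _ _ hx
    exact .plusL hd' hx' fun l =>
      ih l hΓ (hΔ.set_of_mem (by simp [hx])) (hd'.set_of_mem (by simp [hx']))
  | plusL₂ hd hk hx _ ih =>
    intro ρ Γ' Δ' hΓ hΔ hd'
    have hx' := hΔ.map _ _ hx
    exact .plusL₂ hd' hk hx'
      (ih hΓ (hΔ.set_of_mem (by simp [hx])) (hd'.set_of_mem (by simp [hx'])))
  | bangR hd _ ih =>
    intro ρ Γ' Δ' hΓ hΔ hd'
    obtain rfl := hΔ.eq_empty
    have := Typed.bangR hd' (ih (hΓ.lift _) (LMap.empty _)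
      ⟨rfl, rfl, fun _ => Or.inr rfl⟩)
    simpa only [Proc.rename, Proc.rename_wk₁, lift_zero, lift_succ] using this
  | bangL hd hx _ ih =>
    intro ρ Γ' Δ' hΓ hΔ hd'
    exact .bangL hd' (hΔ.map _ _ hx) (ih (hΓ.lift _) ((hΔ.set_of_mem (by simp [hx])).lift _)
      (hd'.set_none.push_unr _))
  | atR hd ha haa _ ih =>
    intro ρ Γ' Δ' hΓ hΔ hd'
    exact .atR hd' ha (haa.lmap hΔ) (ih (hΓ.lift _) (hΔ.lift _) hd'.push_zero)
  | atL hd hx _ ih =>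
    intro ρ Γ' Δ' hΓ hΔ hd'
    exact .atL hd' (hΔ.map _ _ hx) (ih (hΓ.lift _) ((hΔ.set_of_mem (by simp [hx])).lift _)
      (hd'.set_none.push _))
  | allR hd _ ih =>
    intro ρ Γ' Δ' hΓ hΔ hd'
    exact .allR hd' (ih hΓ.dwk hΔ.dwk hd'.dwk)
  | allL hd hx ha _ ih =>
    intro ρ Γ' Δ' hΓ hΔ hd'
    have hx' := hΔ.map _ _ hx
    exact .allL hd' hx' ha
      (ih hΓ (hΔ.set_of_mem (by simp [hx])) (hd'.set_of_mem (by simp [hx'])))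
  | exR hd ha _ ih =>
    intro ρ Γ' Δ' hΓ hΔ hd'
    exact .exR hd' ha (ih hΓ hΔ hd')
  | exL hd hx _ ih =>
    intro ρ Γ' Δ' hΓ hΔ hd'
    have hx' := hΔ.map _ _ hx
    exact .exL hd' hx' (ih hΓ.dwk (hΔ.dwk.set_of_mem (by simp [Ctx.dwk_apply, hx]))
      (hd'.dwk.set_of_mem (by simp [Ctx.dwk_apply, hx'])))
  | hereR hd _ ih =>
    intro ρ Γ' Δ' hΓ hΔ hd'
    exact .hereR hd' (ih hΓ hΔ hd')
  | hereL hd hx _ ih =>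
    intro ρ Γ' Δ' hΓ hΔ hd'
    have hx' := hΔ.map _ _ hx
    exact .hereL hd' hx'
      (ih hΓ (hΔ.set_of_mem (by simp [hx])) (hd'.set_of_mem (by simp [hx'])))
  | copy hd hu ha _ ih =>
    intro ρ Γ' Δ' hΓ hΔ hd'
    exact .copy hd' (hΓ _ _ hu) ha (ih (hΓ.lift _) (hΔ.lift _) (hd'.push _))
  | cut hd hs ha haa _ _ ih₁ ih₂ =>
    intro ρ Γ' Δ' hΓ hΔ hd'
    obtain ⟨Δ₁', Δ₂', hs', h₁, h₂⟩ := hΔ.split hs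
    exact .cut hd' hs' ha (haa.lmap h₁)
      (ih₁ (hΓ.lift _) (h₁.lift _) (hd'.mono fun _ => hs'.left_none).push_zero)
      (ih₂ (hΓ.lift _) (h₂.lift _) ((hd'.mono fun _ => hs'.right_none).push _))
  | cutBang hd _ _ ih₁ ih₂ =>
    intro ρ Γ' Δ' hΓ hΔ hd'
    have := Typed.cutBang hd'
      (ih₁ (hΓ.lift _) (LMap.empty _) ⟨rfl, rfl, fun _ => Or.inr rfl⟩)
      (ih₂ (hΓ.lift _) (hΔ.lift _) (hd'.push_unr _))
    simpa only [Proc.rename, Proc.rename_wk₁, lift_zero, lift_succ] using this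

/-- This is the source of all freshness facts: a name that the sequent does not declare cannot
occur. Hence abstracting it is mere weakening, and threads on the two sides of a cut can share only
the names that both sequents know. -/
theorem Typed.mem_fn {𝓡 : Set AccRule} {Ω Γ Δ P z A ω} (h : Typed 𝓡 Ω Γ Δ P z A ω) :
    ∀ n ∈ P.fn, Γ n ≠ none ∨ Δ n ≠ none ∨ n = z := by
  induction h with
  | cong _ hc ih => rwa [← hc.fn_eq]
  | id hd =>
    rintro n (rfl | rfl) <;> simp [Ctx.set_apply]
  | oneR hd => simp [Proc.fn]
  | oneL hd hx _ ih | ampL₂ hd hk hx _ ih | plusL₂ hd hk hx _ ih | hereL hd hx _ ih =>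
    intro n hn
    have := ih n hn
    simp only [Ctx.set_apply] at this
    grind
  | ampR₂ hd hk _ ih | plusR₂ hd hk _ ih | hereR hd _ ih => exact ih
  | lolliR hd _ ih =>
    rintro n (rfl | hn)
    · simp
    · simpa using ih _ hn
  | lolliL hd hx hs ha _ _ ih₁ ih₂ =>
    intro n hn
    simp only [Proc.fn, Proc.wk, Set.mem_ofPred_eq, Set.mem_union, Set.mem_insert_iff,
      Set.mem_singleton_iff, Proc.mem_fn_rename] at hn
    have h₁ := ih₁ (n + 1)
    have h₂ := ih₂ n
    have := hs n
    simp only [Ctx.push_succ] at h₁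
    simp only [Ctx.set_apply] at h₂ this
    grind
  | tensorR hd hs _ _ ih₁ ih₂ =>
    intro n hn
    simp only [Proc.fn, Proc.wk, Set.mem_ofPred_eq, Set.mem_union, Set.mem_insert_iff,
      Set.mem_singleton_iff, Proc.mem_fn_rename] at hn
    have h₁ := ih₁ (n + 1)
    have h₂ := ih₂ n
    have := hs n
    simp only [Ctx.push_succ] at h₁
    grind
  | tensorL hd hx _ ih | bangL hd hx _ ih | atL hd hx _ ih =>
    rintro n (rfl | hn)
    · simp [hx]
    · have := ih _ hn
      simp only [Ctx.push_succ, Ctx.set_apply] at this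
      grind
  | ampR hd _ ih =>
    rintro n (rfl | hn)
    · simp
    · obtain ⟨l, hl⟩ := Set.mem_iUnion.1 hn
      exact ih l n hl
  | ampL₁ hd hx _ ih | allL hd hx _ _ ih =>
    rintro n (rfl | hn)
    · simp [hx]
    · have := ih _ hn
      simp only [Ctx.set_apply] at this
      grind
  | plusR₁ hd _ ih | exR hd _ _ ih =>
    rintro n (rfl | hn)
    · simp
    · exact ih n hn
  | plusL hd hx _ ih =>
    rintro n (rfl | hn)
    · simp [hx]
    · obtain ⟨l, hl⟩ := Set.mem_iUnion.1 hn
      have := ih l n hl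
      simp only [Ctx.set_apply] at this
      grind
  | bangR hd _ ih =>
    intro n hn
    simp only [Proc.fn, Proc.wk₁, Set.mem_ofPred_eq, Set.mem_union, Set.mem_insert_iff,
      Set.mem_singleton_iff, Proc.mem_fn_rename, exists_lift_iff] at hn
    have h₁ := ih (n + 1)
    simp only [Ctx.push_succ, Ctx.empty_apply] at h₁
    grind
  | atR hd ha haa _ ih =>
    intro n hn
    simp only [Proc.fn, Set.mem_ofPred_eq, Set.mem_union, Set.mem_insert_iff,
      Set.mem_singleton_iff] at hn
    have h₁ := ih (n + 1)
    simp only [Ctx.push_succ] at h₁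
    grind
  | allR hd _ ih =>
    rintro n (rfl | hn)
    · simp
    · simpa [Ctx.dwk_eq_none] using ih n hn
  | exL hd hx _ ih =>
    rintro n (rfl | hn)
    · simp [hx]
    · have := ih _ hn
      simp only [Ctx.set_apply, ne_eq, Ctx.dwk_eq_none] at this
      split_ifs at this with h
      · subst h; simp [hx]
      · simpa [Ctx.dwk_eq_none] using this
  | copy hd hu ha _ ih =>
    intro n hn
    simp only [Proc.fn, Set.mem_ofPred_eq, Set.mem_union, Set.mem_insert_iff,
      Set.mem_singleton_iff] at hn
    have h₁ := ih (n + 1)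
    simp only [Ctx.push_succ] at h₁
    grind
  | cut hd hs ha haa _ _ ih₁ ih₂ =>
    intro n hn
    simp only [Proc.fn, Set.mem_ofPred_eq, Set.mem_union] at hn
    have h₁ := ih₁ (n + 1)
    have h₂ := ih₂ (n + 1)
    have := hs n
    simp only [Ctx.push_succ] at h₁ h₂
    grind
  | cutBang hd _ _ ih₁ ih₂ =>
    intro n hn
    simp only [Proc.fn, Proc.wk₁, Set.mem_ofPred_eq, Set.mem_union, Set.mem_singleton_iff,
      Proc.mem_fn_rename, exists_lift_iff] at hn
    have h₁ := ih₁ (n + 1)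
    have h₂ := ih₂ (n + 1)
    simp only [Ctx.push_succ, Ctx.empty_apply] at h₁ h₂
    grind

/-! ### Accessibility hypotheses and substitution of domains -/

/-- Substitution of domains in an environment. -/
def Ctx.dsubst (σ : ℕ → Dom) (Δ : Ctx) : Ctx :=
  fun x => (Δ x).map fun e => (e.1.subst σ, e.2.subst σ)

/-- Substitution of domains in accessibility hypotheses. -/
def AccCtx.dsubst (σ : ℕ → Dom) (Ω : AccCtx) : AccCtx :=
  Ω.map fun p => (p.1.subst σ, p.2.subst σ)

section

variable {𝓡 : Set AccRule} {Ω Ω' : AccCtx} {Γ Δ Δ₁ Δ₂ : Ctx} {σ : ℕ → Dom} {ω ω₁ ω₂ : Dom}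

/-- The domain variables of a rule are schematic, so an instance followed by `σ` is again an
instance. Nothing else about `𝓡` is needed. -/
theorem Acc.subst (h : Acc 𝓡 Ω ω₁ ω₂) (σ : ℕ → Dom) :
    Acc 𝓡 (Ω.dsubst σ) (ω₁.subst σ) (ω₂.subst σ) := by
  induction h with
  | whyp h => exact .whyp (List.mem_map_of_mem (f := fun p => (p.1.subst σ, p.2.subst σ)) h)
  | rule r hr τ _ ih =>
    rw [Dom.subst_subst, Dom.subst_subst]
    refine .rule r hr _ fun p hp => ?_
    have := ih p hp
    rwa [Dom.subst_subst, Dom.subst_subst] at this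

theorem Acc.of_hyps (h : Acc 𝓡 Ω ω₁ ω₂) (hΩ : ∀ p ∈ Ω, Acc 𝓡 Ω' p.1 p.2) :
    Acc 𝓡 Ω' ω₁ ω₂ := by
  induction h with
  | whyp h => exact hΩ _ h
  | rule r hr τ _ ih => exact .rule r hr τ ih

theorem AccStar.subst (h : AccStar 𝓡 Ω ω₁ ω₂) (σ : ℕ → Dom) :
    AccStar 𝓡 (Ω.dsubst σ) (ω₁.subst σ) (ω₂.subst σ) := by
  induction h with
  | refl => exact .refl
  | tail _ h ih => exact ih.tail (h.subst σ)

theorem AccStar.of_hyps (h : AccStar 𝓡 Ω ω₁ ω₂) (hΩ : ∀ p ∈ Ω, Acc 𝓡 Ω' p.1 p.2) :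
    AccStar 𝓡 Ω' ω₁ ω₂ := by
  induction h with
  | refl => exact .refl
  | tail _ h ih => exact ih.tail (h.of_hyps hΩ)

theorem AccAll.of_hyps (h : AccAll 𝓡 Ω ω Δ) (hΩ : ∀ p ∈ Ω, Acc 𝓡 Ω' p.1 p.2) :
    AccAll 𝓡 Ω' ω Δ :=
  fun x B ω' hx => (h x B ω' hx).of_hyps hΩ

theorem AccAll.subst (h : AccAll 𝓡 Ω ω Δ) (σ : ℕ → Dom) :
    AccAll 𝓡 (Ω.dsubst σ) (ω.subst σ) (Δ.dsubst σ) := by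
  intro x B ω' hx
  obtain ⟨⟨B, ω'⟩, he, h'⟩ := Option.map_eq_some_iff.1 hx
  obtain ⟨rfl, rfl⟩ := Prod.mk.inj h'
  exact (h x B ω' he).subst σ

theorem hyps_cons (p : Dom × Dom) (hΩ : ∀ q ∈ Ω, Acc 𝓡 Ω' q.1 q.2) :
    ∀ q ∈ p :: Ω, Acc 𝓡 (p :: Ω') q.1 q.2 := by
  intro q hq
  rcases List.mem_cons.1 hq with rfl | hq
  · exact .whyp (List.mem_cons_self ..)
  · exact (hΩ q hq).of_hyps fun r hr => .whyp (List.mem_cons_of_mem _ hr)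

theorem hyps_dwk (hΩ : ∀ q ∈ Ω, Acc 𝓡 Ω' q.1 q.2) :
    ∀ q ∈ Ω.dwk, Acc 𝓡 Ω'.dwk q.1 q.2 := by
  intro q hq
  obtain ⟨r, hr, rfl⟩ := List.mem_map.1 hq
  exact (hΩ r hr).subst Dom.wk

/-- A cut rule for accessibility hypotheses. Weakening of `Ω` is one use; the other is to discharge
the hypothesis that a premise of `∀R`, `∃L` or `@L` adds, once the matching rule on the other side
of a cut supplies a proof of it. -/
theorem Typed.of_hyps {P z A} (h : Typed 𝓡 Ω Γ Δ P z A ω) :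
    ∀ {Ω' : AccCtx}, (∀ q ∈ Ω, Acc 𝓡 Ω' q.1 q.2) → Typed 𝓡 Ω' Γ Δ P z A ω := by
  induction h with
  | cong _ hc ih => intro Ω' hΩ; exact .cong (ih hΩ) hc
  | id hd => intro Ω' hΩ; exact .id hd
  | oneR hd => intro Ω' hΩ; exact .oneR hd
  | oneL hd hx _ ih => intro Ω' hΩ; exact .oneL hd hx (ih hΩ)
  | lolliR hd _ ih => intro Ω' hΩ; exact .lolliR hd (ih hΩ)
  | lolliL hd hx hs ha _ _ ih₁ ih₂ =>
    intro Ω' hΩ; exact .lolliL hd hx hs (ha.of_hyps hΩ) (ih₁ hΩ) (ih₂ hΩ)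
  | tensorR hd hs _ _ ih₁ ih₂ => intro Ω' hΩ; exact .tensorR hd hs (ih₁ hΩ) (ih₂ hΩ)
  | tensorL hd hx _ ih => intro Ω' hΩ; exact .tensorL hd hx (ih hΩ)
  | ampR hd _ ih => intro Ω' hΩ; exact .ampR hd fun l => ih l hΩ
  | ampR₂ hd hk _ ih => intro Ω' hΩ; exact .ampR₂ hd hk (ih hΩ)
  | ampL₁ hd hx _ ih => intro Ω' hΩ; exact .ampL₁ hd hx (ih hΩ)
  | ampL₂ hd hk hx _ ih => intro Ω' hΩ; exact .ampL₂ hd hk hx (ih hΩ)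
  | plusR₁ hd _ ih => intro Ω' hΩ; exact .plusR₁ hd (ih hΩ)
  | plusR₂ hd hk _ ih => intro Ω' hΩ; exact .plusR₂ hd hk (ih hΩ)
  | plusL hd hx _ ih => intro Ω' hΩ; exact .plusL hd hx fun l => ih l hΩ
  | plusL₂ hd hk hx _ ih => intro Ω' hΩ; exact .plusL₂ hd hk hx (ih hΩ)
  | bangR hd _ ih => intro Ω' hΩ; exact .bangR hd (ih hΩ)
  | bangL hd hx _ ih => intro Ω' hΩ; exact .bangL hd hx (ih hΩ)
  | atR hd ha haa _ ih =>
    intro Ω' hΩ; exact .atR hd (ha.of_hyps hΩ) (haa.of_hyps hΩ) (ih hΩ)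
  | atL hd hx _ ih => intro Ω' hΩ; exact .atL hd hx (ih (hyps_cons _ hΩ))
  | allR hd _ ih => intro Ω' hΩ; exact .allR hd (ih (hyps_cons _ (hyps_dwk hΩ)))
  | allL hd hx ha _ ih => intro Ω' hΩ; exact .allL hd hx (ha.of_hyps hΩ) (ih hΩ)
  | exR hd ha _ ih => intro Ω' hΩ; exact .exR hd (ha.of_hyps hΩ) (ih hΩ)
  | exL hd hx _ ih => intro Ω' hΩ; exact .exL hd hx (ih (hyps_cons _ (hyps_dwk hΩ)))
  | hereR hd _ ih => intro Ω' hΩ; exact .hereR hd (ih hΩ)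
  | hereL hd hx _ ih => intro Ω' hΩ; exact .hereL hd hx (ih hΩ)
  | copy hd hu ha _ ih => intro Ω' hΩ; exact .copy hd hu (ha.of_hyps hΩ) (ih hΩ)
  | cut hd hs ha haa _ _ ih₁ ih₂ =>
    intro Ω' hΩ; exact .cut hd hs (ha.of_hyps hΩ) (haa.of_hyps hΩ) (ih₁ hΩ) (ih₂ hΩ)
  | cutBang hd _ _ ih₁ ih₂ => intro Ω' hΩ; exact .cutBang hd (ih₁ hΩ) (ih₂ hΩ)

theorem Ctx.dsubst_eq_none {n : ℕ} : Δ.dsubst σ n = none ↔ Δ n = none := by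
  simp [Ctx.dsubst]

theorem Ctx.dsubst_some {n : ℕ} {A : Ty} (h : Δ n = some (A, ω)) :
    Δ.dsubst σ n = some (A.subst σ, ω.subst σ) := by
  simp [Ctx.dsubst, h]

theorem Ctx.dsubst_empty : Ctx.empty.dsubst σ = Ctx.empty := rfl

theorem Ctx.dsubst_set_none {x : ℕ} : (Δ.set x none).dsubst σ = (Δ.dsubst σ).set x none := by
  funext n
  simp only [Ctx.dsubst, Ctx.set_apply]
  split_ifs <;> rfl

theorem Ctx.dsubst_set_some {x : ℕ} {A : Ty} : (Δ.set x (some (A, ω))).dsubst σ =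
    (Δ.dsubst σ).set x (some (A.subst σ, ω.subst σ)) := by
  funext n
  simp only [Ctx.dsubst, Ctx.set_apply]
  split_ifs <;> rfl

theorem Ctx.dsubst_push_none : (Ctx.push none Δ).dsubst σ = (Δ.dsubst σ).push none := by
  funext n; cases n <;> rfl

theorem Ctx.dsubst_push_some {A : Ty} : (Ctx.push (some (A, ω)) Δ).dsubst σ =
    (Δ.dsubst σ).push (some (A.subst σ, ω.subst σ)) := by
  funext n; cases n <;> rfl

theorem Ctx.dwk_dsubst : Δ.dwk.dsubst (Dom.up σ) = (Δ.dsubst σ).dwk := by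
  funext n
  simp only [Ctx.dsubst, Ctx.dwk, Option.map_map]
  congr 1
  funext e
  simp [Ty.wk_subst_up, Dom.wk_subst_up]

theorem AccCtx.dwk_dsubst : Ω.dwk.dsubst (Dom.up σ) = (Ω.dsubst σ).dwk := by
  simp only [AccCtx.dsubst, AccCtx.dwk, List.map_map]
  congr 1
  funext e
  simp [Dom.wk_subst_up]

theorem Ctx.dwk_dsubst_single : Δ.dwk.dsubst (Dom.single ω) = Δ := by
  funext n
  simp only [Ctx.dsubst, Ctx.dwk, Option.map_map]
  rcases Δ n with _ | e <;> simp [Ty.wk_subst_single, Dom.wk_subst_single]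

theorem AccCtx.dwk_dsubst_single : Ω.dwk.dsubst (Dom.single ω) = Ω := by
  simp only [AccCtx.dsubst, AccCtx.dwk, List.map_map]
  convert List.map_id Ω using 2
  funext e
  simp [Dom.wk_subst_single]

theorem Ctx.Split.dsubst (h : Δ.Split Δ₁ Δ₂) (σ : ℕ → Dom) :
    (Δ.dsubst σ).Split (Δ₁.dsubst σ) (Δ₂.dsubst σ) := by
  intro n
  simp only [Ctx.dsubst_eq_none]
  exact (h n).imp (fun h => ⟨by simp only [Ctx.dsubst, h.1], h.2⟩)
    (fun h => ⟨by simp only [Ctx.dsubst, h.1], h.2⟩)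

theorem Distinct.dsubst {z : ℕ} (h : Distinct Γ Δ z) (σ : ℕ → Dom) :
    Distinct (Γ.dsubst σ) (Δ.dsubst σ) z := by
  simpa only [Distinct, Ctx.dsubst_eq_none] using h

theorem AccCtx.dsubst_cons {p : Dom × Dom} :
    AccCtx.dsubst σ (p :: Ω) = (p.1.subst σ, p.2.subst σ) :: Ω.dsubst σ := rfl

/-- Under `∀R` and `∃L` the induction uses `Dom.up σ`, which commutes with weakening by the new
variable. The substitutions in the rules for `∀`, `∃` and `↓` commute with `σ` by `Ty.single_subst`.
-/
theorem Typed.dsubst {P z A} (h : Typed 𝓡 Ω Γ Δ P z A ω) :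
    ∀ σ : ℕ → Dom, Typed 𝓡 (Ω.dsubst σ) (Γ.dsubst σ) (Δ.dsubst σ) (P.dsubst σ) z
      (A.subst σ) (ω.subst σ) := by
  induction h with
  | cong _ hc ih => intro σ; exact .cong (ih σ) (hc.dsubst σ)
  | id hd =>
    intro σ
    have := hd.dsubst σ
    rw [Ctx.dsubst_set_some] at this ⊢
    exact .id this
  | oneR hd => intro σ; exact .oneR (hd.dsubst σ)
  | oneL hd hx _ ih =>
    intro σ
    have := ih σ
    rw [Ctx.dsubst_set_none] at this
    exact .oneL (hd.dsubst σ) (Ctx.dsubst_some hx) this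
  | lolliR hd _ ih =>
    intro σ
    have := ih σ
    rw [Ctx.dsubst_push_none, Ctx.dsubst_push_some] at this
    exact .lolliR (hd.dsubst σ) this
  | lolliL hd hx hs ha _ _ ih₁ ih₂ =>
    intro σ
    have h₁ := ih₁ σ
    have h₂ := ih₂ σ
    have h₃ := hs.dsubst σ
    rw [Ctx.dsubst_set_none] at h₃
    rw [Ctx.dsubst_push_none, Ctx.dsubst_push_none] at h₁
    rw [Ctx.dsubst_set_some] at h₂
    have := Typed.lolliL (hd.dsubst σ) (Ctx.dsubst_some hx) h₃ (ha.subst σ) h₁ h₂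
    simpa only [Proc.dsubst, Proc.wk, Proc.dsubst_rename] using this
  | tensorR hd hs _ _ ih₁ ih₂ =>
    intro σ
    have h₁ := ih₁ σ
    rw [Ctx.dsubst_push_none, Ctx.dsubst_push_none] at h₁
    have := Typed.tensorR (hd.dsubst σ) (hs.dsubst σ) h₁ (ih₂ σ)
    simpa only [Ty.subst, Proc.dsubst, Proc.wk, Proc.dsubst_rename] using this
  | tensorL hd hx _ ih =>
    intro σ
    have := ih σ
    rw [Ctx.dsubst_push_none, Ctx.dsubst_push_some, Ctx.dsubst_set_some] at this
    exact .tensorL (hd.dsubst σ) (Ctx.dsubst_some hx) this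
  | ampR hd _ ih => intro σ; exact .ampR (hd.dsubst σ) fun l => ih l σ
  | ampR₂ hd hk _ ih => intro σ; exact .ampR₂ (A := fun l => Ty.subst σ _) (hd.dsubst σ) hk (ih σ)
  | ampL₁ hd hx _ ih =>
    intro σ
    have := ih σ
    rw [Ctx.dsubst_set_some] at this
    exact .ampL₁ (hd.dsubst σ) (Ctx.dsubst_some hx) this
  | ampL₂ hd hk hx _ ih =>
    intro σ
    have := ih σ
    rw [Ctx.dsubst_set_some] at this
    exact .ampL₂ (A := fun l => Ty.subst σ _) (hd.dsubst σ) hk (Ctx.dsubst_some hx) this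
  | plusR₁ hd _ ih => intro σ; exact .plusR₁ (hd.dsubst σ) (ih σ)
  | plusR₂ hd hk _ ih =>
    intro σ; exact .plusR₂ (A := fun l => Ty.subst σ _) (hd.dsubst σ) hk (ih σ)
  | plusL hd hx _ ih =>
    intro σ
    refine .plusL (A := fun l => Ty.subst σ _) (hd.dsubst σ) (Ctx.dsubst_some hx) fun l => ?_
    have := ih l σ
    rwa [Ctx.dsubst_set_some] at this
  | plusL₂ hd hk hx _ ih =>
    intro σ
    have := ih σ
    rw [Ctx.dsubst_set_some] at this
    exact .plusL₂ (A := fun l => Ty.subst σ _) (hd.dsubst σ) hk (Ctx.dsubst_some hx) this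
  | bangR hd _ ih =>
    intro σ
    have := ih σ
    rw [Ctx.dsubst_push_none, Ctx.dsubst_empty] at this
    have := Typed.bangR (hd.dsubst σ) this
    simpa only [Ty.subst, Ctx.dsubst_empty, Proc.dsubst, Proc.wk₁, Proc.dsubst_rename] using this
  | bangL hd hx _ ih =>
    intro σ
    have := ih σ
    rw [Ctx.dsubst_push_some, Ctx.dsubst_push_none, Ctx.dsubst_set_none] at this
    exact .bangL (hd.dsubst σ) (Ctx.dsubst_some hx) this
  | atR hd ha haa _ ih =>
    intro σ
    have := ih σ
    rw [Ctx.dsubst_push_none, Ctx.dsubst_push_none] at this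
    exact .atR (hd.dsubst σ) (ha.subst σ) (haa.subst σ) this
  | atL hd hx _ ih =>
    intro σ
    have := ih σ
    rw [Ctx.dsubst_push_none, Ctx.dsubst_push_some, Ctx.dsubst_set_none] at this
    exact .atL (hd.dsubst σ) (Ctx.dsubst_some hx) this
  | allR hd _ ih =>
    intro σ
    have := ih (Dom.up σ)
    rw [Ctx.dwk_dsubst, Ctx.dwk_dsubst, AccCtx.dsubst_cons, AccCtx.dwk_dsubst,
      Dom.wk_subst_up] at this
    exact .allR (hd.dsubst σ) this
  | allL hd hx ha _ ih =>
    intro σ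
    have := ih σ
    rw [Ctx.dsubst_set_some, Ty.single_subst] at this
    exact .allL (hd.dsubst σ) (Ctx.dsubst_some hx) (ha.subst σ) this
  | exR hd ha _ ih =>
    intro σ
    have := ih σ
    rw [Ty.single_subst] at this
    exact .exR (hd.dsubst σ) (ha.subst σ) this
  | exL hd hx _ ih =>
    intro σ
    have := ih (Dom.up σ)
    rw [Ctx.dsubst_set_some, Ctx.dwk_dsubst, Ctx.dwk_dsubst, AccCtx.dsubst_cons,
      AccCtx.dwk_dsubst, Dom.wk_subst_up, Dom.wk_subst_up, Ty.wk_subst_up] at this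
    exact .exL (hd.dsubst σ) (Ctx.dsubst_some hx) this
  | hereR hd _ ih =>
    intro σ
    have := ih σ
    rw [Ty.single_subst] at this
    exact .hereR (hd.dsubst σ) this
  | hereL hd hx _ ih =>
    intro σ
    have := ih σ
    rw [Ctx.dsubst_set_some, Ty.single_subst] at this
    exact .hereL (hd.dsubst σ) (Ctx.dsubst_some hx) this
  | copy hd hu ha _ ih =>
    intro σ
    have := ih σ
    rw [Ctx.dsubst_push_none, Ctx.dsubst_push_some] at this
    exact .copy (hd.dsubst σ) (Ctx.dsubst_some hu) (ha.subst σ) this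
  | cut hd hs ha haa _ _ ih₁ ih₂ =>
    intro σ
    have h₁ := ih₁ σ
    have h₂ := ih₂ σ
    rw [Ctx.dsubst_push_none, Ctx.dsubst_push_none] at h₁
    rw [Ctx.dsubst_push_none, Ctx.dsubst_push_some] at h₂
    exact .cut (hd.dsubst σ) (hs.dsubst σ) (ha.subst σ) (haa.subst σ) h₁ h₂
  | cutBang hd _ _ ih₁ ih₂ =>
    intro σ
    have h₁ := ih₁ σ
    have h₂ := ih₂ σ
    rw [Ctx.dsubst_push_none, Ctx.dsubst_empty] at h₁
    rw [Ctx.dsubst_push_none, Ctx.dsubst_push_some] at h₂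
    have := Typed.cutBang (hd.dsubst σ) h₁ h₂
    simpa only [Proc.dsubst, Proc.wk₁, Proc.dsubst_rename] using this

end

/-! ### Flattening processes into multisets of threads -/

/-- Equality of threads: the same prefix, and structurally congruent continuations. -/
inductive TEq : Proc → Proc → Prop
  | out {x y P P'} : Cong P P' → TEq (.out x y P) (.out x y P')
  | inp {x P P'} : Cong P P' → TEq (.inp x P) (.inp x P')
  | rep {x P P'} : Cong P P' → TEq (.rep x P) (.rep x P')
  | fwd {x y} : TEq (.fwd x y) (.fwd x y)
  | fwd_comm {x y} : TEq (.fwd x y) (.fwd y x)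
  | branch {x I} {P P' : {l // l ∈ I} → Proc} :
      (∀ l, Cong (P l) (P' l)) → TEq (.branch x I P) (.branch x I P')
  | sel {x l P P'} : Cong P P' → TEq (.sel x l P) (.sel x l P')
  | moveOut {x y ω P P'} : Cong P P' → TEq (.moveOut x y ω P) (.moveOut x y ω P')
  | moveIn {x ω P P'} : Cong P P' → TEq (.moveIn x ω P) (.moveIn x ω P')
  | domOut {x ω P P'} : Cong P P' → TEq (.domOut x ω P) (.domOut x ω P')
  | domIn {x P P'} : Cong P P' → TEq (.domIn x P) (.domIn x P')

theorem TEq.symm {P Q : Proc} (h : TEq P Q) : TEq Q P := by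
  cases h
  case fwd => exact .fwd
  case fwd_comm => exact .fwd_comm
  case branch h => exact .branch fun l => (h l).symm
  all_goals constructor; exact Cong.symm ‹_›

theorem TEq.trans {P Q R : Proc} (h : TEq P Q) (h' : TEq Q R) : TEq P R := by
  cases h
  case fwd => exact h'
  case fwd_comm => cases h' <;> constructor
  case branch h => cases h' with | branch h' => exact .branch fun l => (h l).trans (h' l)
  all_goals cases h'; constructor; exact Cong.trans ‹_› ‹_›

theorem TEq.cong {P Q : Proc} (h : TEq P Q) : Cong P Q := by
  cases h
  case fwd => exact .refl _
  case fwd_comm => exact .fwd_comm _ _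
  case branch h => exact .branch h
  case out h => exact .out h
  case inp h => exact .inp h
  case rep h => exact .rep h
  case sel h => exact .sel h
  case moveOut h => exact .moveOut h
  case moveIn h => exact .moveIn h
  case domOut h => exact .domOut h
  case domIn h => exact .domIn h

theorem TEq.rename {P Q : Proc} (h : TEq P Q) (ρ : ℕ → ℕ) :
    TEq (P.rename ρ) (Q.rename ρ) := by
  cases h
  case fwd => exact .fwd
  case fwd_comm => exact .fwd_comm
  case branch h => exact .branch fun l => (h l).rename ρ
  all_goals constructor; exact Cong.rename ‹_› _

/-- Threads: all processes except inaction, parallel compositions and restrictions. -/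
def Proc.IsThread : Proc → Prop
  | .zero => False
  | .par _ _ => False
  | .nu _ => False
  | _ => True

theorem Proc.IsThread.rename {P : Proc} (h : P.IsThread) (ρ : ℕ → ℕ) :
    (P.rename ρ).IsThread := by
  cases P <;> exact h

theorem Proc.IsThread.refl {P : Proc} (h : P.IsThread) : TEq P P := by
  cases P
  case zero => exact h.elim
  case par => exact h.elim
  case nu => exact h.elim
  case fwd => exact .fwd
  case branch => exact .branch fun _ => .refl _
  all_goals constructor; exact .refl _

/-- `Flat P ρ B M`: when the free names of `P` are renamed by `ρ` and its top-level restrictions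
are given the pairwise different names in `B`, then `M` consists of the threads of `P`. -/
def Flat : Proc → (ℕ → ℕ) → Finset ℕ → Multiset Proc → Prop
  | .zero, _, B, M => B = ∅ ∧ M = 0
  | .par P Q, ρ, B, M => ∃ B₁ B₂ M₁ M₂, B = B₁ ∪ B₂ ∧ M = M₁ + M₂ ∧ Disjoint B₁ B₂ ∧
      Flat P ρ B₁ M₁ ∧ Flat Q ρ B₂ M₂
  | .nu P, ρ, B, M => ∃ b B', b ∉ B' ∧ B = insert b B' ∧ Flat P (consName b ρ) B' M
  | P, ρ, B, M => B = ∅ ∧ ∃ S, TEq (P.rename ρ) S ∧ M = {S}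

theorem flat_thread {P : Proc} (hP : P.IsThread) {ρ : ℕ → ℕ} {B : Finset ℕ}
    {M : Multiset Proc} : Flat P ρ B M ↔ B = ∅ ∧ ∃ S, TEq (P.rename ρ) S ∧ M = {S} := by
  cases P <;> first | exact hP.elim | exact Iff.rfl

theorem flat_rename (P : Proc) : ∀ {r ρ : ℕ → ℕ} {B : Finset ℕ} {M : Multiset Proc},
    Flat (P.rename r) ρ B M ↔ Flat P (ρ ∘ r) B M := by
  induction P with
  | zero => intros; rfl
  | par P Q ihP ihQ => intros; simp only [Proc.rename, Flat, ihP, ihQ]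
  | nu P ih =>
    intro r ρ B M
    have e : ∀ b, consName b ρ ∘ lift r = consName b (ρ ∘ r) := fun b => by
      funext n; cases n <;> rfl
    simp only [Proc.rename, Flat, ih, e]
  | _ =>
    intros
    rw [flat_thread, flat_thread, Proc.rename_rename]
    all_goals trivial

/-- Serves the forwarder reduction, where a name is replaced in all threads at once. The names in
`B` have to be fixed by `σ`, as they stand for the restrictions. -/
theorem Flat.postcomp (P : Proc) : ∀ {ρ σ : ℕ → ℕ} {B : Finset ℕ} {M : Multiset Proc},
    Flat P ρ B M → (∀ b ∈ B, σ b = b) → Flat P (σ ∘ ρ) B (M.map (Proc.rename σ)) := by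
  induction P with
  | zero => rintro ρ σ B M ⟨rfl, rfl⟩ -; exact ⟨rfl, rfl⟩
  | par P Q ihP ihQ =>
    rintro ρ σ B M ⟨B₁, B₂, M₁, M₂, rfl, rfl, hd, h₁, h₂⟩ hσ
    exact ⟨B₁, B₂, _, _, rfl, Multiset.map_add _ _ _, hd,
      ihP h₁ fun b hb => hσ b (Finset.mem_union_left _ hb),
      ihQ h₂ fun b hb => hσ b (Finset.mem_union_right _ hb)⟩
  | nu P ih =>
    rintro ρ σ B M ⟨b, B', hb, rfl, h⟩ hσ
    refine ⟨b, B', hb, rfl, ?_⟩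
    have e : consName b (σ ∘ ρ) = σ ∘ consName b ρ := by
      funext n
      cases n with
      | zero => exact (hσ b (Finset.mem_insert_self _ _)).symm
      | succ n => rfl
    rw [e]
    exact ih h fun b hb => hσ b (Finset.mem_insert_of_mem hb)
  | _ =>
    intro ρ σ B M h hσ
    replace h := (flat_thread (by trivial)).1 h
    refine (flat_thread (by trivial)).2 ?_
    obtain ⟨rfl, S, hS, rfl⟩ := h
    refine ⟨rfl, S.rename σ, ?_, by simp⟩
    have := hS.rename σ
    rwa [Proc.rename_rename] at this

theorem Flat.mem_fn (P : Proc) : ∀ {ρ : ℕ → ℕ} {B : Finset ℕ} {M : Multiset Proc},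
    Flat P ρ B M → ∀ S ∈ M, ∀ n ∈ S.fn, n ∈ B ∨ ∃ m ∈ P.fn, ρ m = n := by
  induction P with
  | zero => rintro ρ B M ⟨rfl, rfl⟩; simp
  | par P Q ihP ihQ =>
    rintro ρ B M ⟨B₁, B₂, M₁, M₂, rfl, rfl, hd, h₁, h₂⟩ S hS n hn
    rcases Multiset.mem_add.1 hS with hS | hS
    · rcases ihP h₁ S hS n hn with h | ⟨m, hm, h⟩
      · exact Or.inl (Finset.mem_union_left _ h)
      · exact Or.inr ⟨m, Or.inl hm, h⟩
    · rcases ihQ h₂ S hS n hn with h | ⟨m, hm, h⟩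
      · exact Or.inl (Finset.mem_union_right _ h)
      · exact Or.inr ⟨m, Or.inr hm, h⟩
  | nu P ih =>
    rintro ρ B M ⟨b, B', hb, rfl, h⟩ S hS n hn
    rcases ih h S hS n hn with h | ⟨_ | m, hm, h⟩
    · exact Or.inl (Finset.mem_insert_of_mem h)
    · exact Or.inl (by simp [← h])
    · exact Or.inr ⟨m, hm, h⟩
  | _ =>
    intro ρ B M h S hS n hn
    replace h := (flat_thread (by trivial)).1 h
    obtain ⟨rfl, S', hS', rfl⟩ := h
    obtain rfl := Multiset.mem_singleton.1 hS
    rw [← hS'.cong.fn_eq, Proc.mem_fn_rename] at hn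
    exact Or.inr hn

theorem infinite_sdiff_finset {N : Set ℕ} (hN : N.Infinite) (B : Finset ℕ) :
    (N \ (B : Set ℕ)).Infinite := hN.sdiff B.finite_toSet

/-- Every flattening of `P` is one of `Q`, except that restrictions of `Q` to names that do not
occur may get further names. -/
def FlatLE (P Q : Proc) : Prop :=
  ∀ (ρ : ℕ → ℕ) (N : Set ℕ) (B : Finset ℕ) (M : Multiset Proc), N.Infinite → Flat P ρ B M →
    ∃ B' : Finset ℕ, Flat Q ρ B' M ∧ (B' : Set ℕ) ⊆ B ∪ N

theorem FlatLE.of_eq {P Q : Proc} (h : ∀ {ρ B M}, Flat P ρ B M → Flat Q ρ B M) : FlatLE P Q :=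
  fun _ _ _ _ _ hP => ⟨_, h hP, Set.subset_union_left⟩

theorem FlatLE.trans {P Q R : Proc} (h : FlatLE P Q) (h' : FlatLE Q R) : FlatLE P R := by
  intro ρ N B M hN hP
  obtain ⟨B', hB', hs⟩ := h _ _ _ _ hN hP
  obtain ⟨B'', hB'', hs'⟩ := h' _ _ _ _ hN hB'
  exact ⟨B'', hB'', hs'.trans (Set.union_subset hs Set.subset_union_right)⟩

theorem FlatLE.par {P P' Q Q' : Proc} (h : FlatLE P P') (h' : FlatLE Q Q') :
    FlatLE (.par P Q) (.par P' Q') := by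
  rintro ρ N B M hN ⟨B₁, B₂, M₁, M₂, rfl, rfl, hd, h₁, h₂⟩
  -- The new names of the first component avoid `B₂`, and those of the second avoid `B₁'`, so the
  -- two sets stay disjoint.
  obtain ⟨B₁', hB₁, hs₁⟩ := h _ _ _ _ (infinite_sdiff_finset hN B₂) h₁
  obtain ⟨B₂', hB₂, hs₂⟩ := h' _ _ _ _ (infinite_sdiff_finset hN B₁') h₂
  refine ⟨B₁' ∪ B₂', ⟨B₁', B₂', M₁, M₂, rfl, rfl, ?_, hB₁, hB₂⟩, ?_⟩
  · rw [Finset.disjoint_left] at hd ⊢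
    intro b hb hb'
    have h₁ := hs₁ hb
    have h₂ := hs₂ hb'
    simp only [Set.mem_union, Finset.mem_coe, Set.mem_sdiff] at h₁ h₂
    have := @hd b
    grind
  · intro b hb
    simp only [Finset.coe_union, Set.mem_union, Finset.mem_coe] at hb ⊢
    have h₁ := @hs₁ b
    have h₂ := @hs₂ b
    simp only [Set.mem_union, Finset.mem_coe, Set.mem_sdiff] at h₁ h₂
    grind

theorem FlatLE.nu {P P' : Proc} (h : FlatLE P P') : FlatLE (.nu P) (.nu P') := by
  rintro ρ N B M hN ⟨b, B', hb, rfl, hP⟩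
  obtain ⟨B'', hB'', hs⟩ := h _ _ _ _ (infinite_sdiff_finset hN {b}) hP
  refine ⟨insert b B'', ⟨b, B'', fun hb' => ?_, rfl, hB''⟩, ?_⟩
  · have := hs hb'
    simp_all
  · intro a ha
    have := @hs a
    simp only [Finset.coe_insert, Set.mem_insert_iff, Finset.mem_coe, Set.mem_union,
      Set.mem_sdiff] at ha this ⊢
    grind

theorem FlatLE.of_teq {P Q : Proc} (hP : P.IsThread) (hQ : Q.IsThread) (h : TEq P Q) :
    FlatLE P Q := by
  refine FlatLE.of_eq fun {ρ B M} hf => ?_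
  rw [flat_thread hP] at hf
  rw [flat_thread hQ]
  obtain ⟨rfl, S, hS, rfl⟩ := hf
  exact ⟨rfl, S, (h.symm.rename ρ).trans hS, rfl⟩

/-- Every axiom merely regroups names and threads, except that `(ν x) 0 ≡ 0` creates or drops an
idle name; creating one is the only use of the supply `N`. Congruence below a prefix is absorbed by
`TEq`. -/
theorem Cong.flatLE {P Q : Proc} (h : Cong P Q) : FlatLE P Q ∧ FlatLE Q P := by
  induction h with
  | refl P => exact ⟨.of_eq id, .of_eq id⟩
  | symm _ ih => exact ih.symm
  | trans _ _ ih₁ ih₂ => exact ⟨ih₁.1.trans ih₂.1, ih₂.2.trans ih₁.2⟩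
  | par _ _ ih₁ ih₂ => exact ⟨ih₁.1.par ih₂.1, ih₁.2.par ih₂.2⟩
  | nu _ ih => exact ⟨ih.1.nu, ih.2.nu⟩
  | out h _ => exact ⟨.of_teq trivial trivial (.out h), .of_teq trivial trivial (.out h.symm)⟩
  | inp h _ => exact ⟨.of_teq trivial trivial (.inp h), .of_teq trivial trivial (.inp h.symm)⟩
  | rep h _ => exact ⟨.of_teq trivial trivial (.rep h), .of_teq trivial trivial (.rep h.symm)⟩
  | branch h _ =>
    exact ⟨.of_teq trivial trivial (.branch h),
      .of_teq trivial trivial (.branch fun l => (h l).symm)⟩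
  | sel h _ => exact ⟨.of_teq trivial trivial (.sel h), .of_teq trivial trivial (.sel h.symm)⟩
  | moveOut h _ =>
    exact ⟨.of_teq trivial trivial (.moveOut h), .of_teq trivial trivial (.moveOut h.symm)⟩
  | moveIn h _ =>
    exact ⟨.of_teq trivial trivial (.moveIn h), .of_teq trivial trivial (.moveIn h.symm)⟩
  | domOut h _ =>
    exact ⟨.of_teq trivial trivial (.domOut h), .of_teq trivial trivial (.domOut h.symm)⟩
  | domIn h _ =>
    exact ⟨.of_teq trivial trivial (.domIn h), .of_teq trivial trivial (.domIn h.symm)⟩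
  | par_zero P =>
    constructor
    · refine .of_eq ?_
      rintro ρ B M ⟨B₁, B₂, M₁, M₂, rfl, rfl, -, h, rfl, rfl⟩
      simpa using h
    · refine .of_eq fun {ρ B M} h => ⟨B, ∅, M, 0, by simp, by simp, by simp, h, rfl, rfl⟩
  | par_comm P Q =>
    have : ∀ P Q, FlatLE (.par P Q) (.par Q P) := by
      intro P Q
      refine .of_eq ?_
      rintro ρ B M ⟨B₁, B₂, M₁, M₂, rfl, rfl, hd, h₁, h₂⟩
      exact ⟨B₂, B₁, M₂, M₁, Finset.union_comm _ _, add_comm _ _, hd.symm, h₂, h₁⟩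
    exact ⟨this P Q, this Q P⟩
  | par_assoc P Q R =>
    constructor
    · refine .of_eq ?_
      rintro ρ B M ⟨B₁, _, M₁, _, rfl, rfl, hd, h₁, B₂, B₃, M₂, M₃, rfl, rfl, hd', h₂, h₃⟩
      rw [Finset.disjoint_union_right] at hd
      exact ⟨B₁ ∪ B₂, B₃, M₁ + M₂, M₃, by rw [Finset.union_assoc], by rw [add_assoc],
        Finset.disjoint_union_left.2 ⟨hd.2, hd'⟩, ⟨B₁, B₂, M₁, M₂, rfl, rfl, hd.1, h₁, h₂⟩, h₃⟩
    · refine .of_eq ?_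
      rintro ρ B M ⟨_, B₃, _, M₃, rfl, rfl, hd, ⟨B₁, B₂, M₁, M₂, rfl, rfl, hd', h₁, h₂⟩, h₃⟩
      rw [Finset.disjoint_union_left] at hd
      exact ⟨B₁, B₂ ∪ B₃, M₁, M₂ + M₃, by rw [Finset.union_assoc], by rw [add_assoc],
        Finset.disjoint_union_right.2 ⟨hd', hd.1⟩, h₁, B₂, B₃, M₂, M₃, rfl, rfl, hd.2, h₂, h₃⟩
  | nu_zero =>
    constructor
    · rintro ρ N B M hN ⟨b, B', hb, rfl, rfl, rfl⟩
      exact ⟨∅, ⟨rfl, rfl⟩, by simp⟩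
    · rintro ρ N B M hN ⟨rfl, rfl⟩
      obtain ⟨b, hb⟩ := hN.nonempty
      exact ⟨{b}, ⟨b, ∅, by simp, rfl, rfl, rfl⟩, by simpa using hb⟩
  | fwd_comm x y =>
    exact ⟨.of_teq trivial trivial .fwd_comm, .of_teq trivial trivial .fwd_comm⟩
  | extrude P Q =>
    have e : ∀ (b : ℕ) (ρ : ℕ → ℕ), consName b ρ ∘ Nat.succ = ρ := fun _ _ => rfl
    constructor
    · refine .of_eq ?_
      rintro ρ B M ⟨B₁, _, M₁, M₂, rfl, rfl, hd, h₁, b, B₂, hb, rfl, h₂⟩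
      rw [Finset.disjoint_insert_right] at hd
      refine ⟨b, B₁ ∪ B₂, by simp [hd.1, hb], by simp, B₁, B₂, M₁, M₂, rfl, rfl, hd.2, ?_, h₂⟩
      rwa [Proc.wk, flat_rename, e]
    · refine .of_eq ?_
      rintro ρ B M ⟨b, _, hb, rfl, B₁, B₂, M₁, M₂, rfl, rfl, hd, h₁, h₂⟩
      rw [Proc.wk, flat_rename, e] at h₁
      rw [Finset.mem_union, not_or] at hb
      exact ⟨B₁, insert b B₂, M₁, M₂, by simp, rfl,
        Finset.disjoint_insert_right.2 ⟨hb.1, hd⟩, h₁, b, B₂, hb.2, rfl, h₂⟩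
  | nu_comm P =>
    have key : ∀ P, FlatLE (.nu (.nu P)) (.nu (.nu (P.rename swapName))) := by
      intro P
      refine .of_eq ?_
      rintro ρ B M ⟨b, _, hb, rfl, c, B', hc, rfl, h⟩
      rw [Finset.mem_insert, not_or] at hb
      refine ⟨c, insert b B', by simp [hc, Ne.symm hb.1], Finset.insert_comm _ _ _, b, B', hb.2,
        rfl, ?_⟩
      rw [flat_rename]
      convert h using 1
      funext n
      rcases n with _ | _ | n <;> rfl
    refine ⟨key P, ?_⟩
    have e : swapName ∘ swapName = id := by
      funext n
      rcases n with _ | _ | n <;> rfl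
    have := key (P.rename swapName)
    rwa [Proc.rename_rename, e, Proc.rename_id] at this

/-! ### Normal forms -/

/-- The renaming which turns the free name `b` into the bound name `0`. -/
def absName (b n : ℕ) : ℕ := if n = b then 0 else n + 1

/-- The restriction of the free name `b`. -/
def nuAt (b : ℕ) (P : Proc) : Proc := .nu (P.rename (absName b))

/-- The restriction of the free names in the list `l`. -/
def nuList (l : List ℕ) (P : Proc) : Proc := l.foldr nuAt P

/-- The parallel composition of a list of processes. -/
def parList (L : List Proc) : Proc := L.foldr .par .zero

theorem consName_comp_absName (b : ℕ) : consName b id ∘ absName b = id := by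
  funext n
  by_cases h : n = b <;> simp [absName, h]

theorem mem_fn_nuAt {b n : ℕ} {P : Proc} : n ∈ (nuAt b P).fn ↔ n ∈ P.fn ∧ n ≠ b := by
  simp only [nuAt, Proc.fn, Set.mem_ofPred_eq, Proc.mem_fn_rename]
  constructor
  · rintro ⟨m, hm, h⟩
    unfold absName at h
    split_ifs at h with hb
    simp only [Nat.add_right_cancel_iff] at h
    subst h
    exact ⟨hm, hb⟩
  · rintro ⟨hn, hb⟩
    exact ⟨n, hn, by simp [absName, hb]⟩

theorem mem_fn_nuList {l : List ℕ} {n : ℕ} {P : Proc} :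
    n ∈ (nuList l P).fn ↔ n ∈ P.fn ∧ n ∉ l := by
  induction l with
  | nil => simp [nuList]
  | cons b l ih =>
    have : nuList (b :: l) P = nuAt b (nuList l P) := rfl
    rw [this, mem_fn_nuAt, ih]
    simp only [List.mem_cons, not_or]
    tauto

theorem mem_fn_parList {L : List Proc} {n : ℕ} : n ∈ (parList L).fn ↔ ∃ S ∈ L, n ∈ S.fn := by
  induction L with
  | nil => simp [parList, Proc.fn]
  | cons S L ih =>
    have : parList (S :: L) = .par S (parList L) := rfl
    simp [this, Proc.fn, ih]

theorem Cong.nuAt {b : ℕ} {P Q : Proc} (h : Cong P Q) : Cong (nuAt b P) (nuAt b Q) :=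
  .nu (h.rename _)

theorem Cong.nuList {l : List ℕ} {P Q : Proc} (h : Cong P Q) :
    Cong (nuList l P) (nuList l Q) := by
  induction l with
  | nil => exact h
  | cons b l ih => exact ih.nuAt

theorem nuAt_comm (a b : ℕ) (P : Proc) : Cong (nuAt a (nuAt b P)) (nuAt b (nuAt a P)) := by
  rcases eq_or_ne a b with rfl | hab
  · exact .refl _
  · have := Cong.nu_comm ((P.rename (absName b)).rename (lift (absName a)))
    simp only [DomainSession.nuAt, Proc.rename, Proc.rename_rename] at this ⊢
    convert this using 4
    funext n
    by_cases ha : n = a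
    · subst ha; simp [absName, hab, swapName]
    · by_cases hb : n = b
      · subst hb; simp [absName, ha, swapName]
      · simp [absName, ha, hb, swapName]

/-- `(ν b) P ≡ (ν b)(P | 0) ≡ P | (ν b) 0 ≡ P`. Garbage collection of restrictions is thus derivable
from scope extrusion and `(ν x) 0 ≡ 0`. -/
theorem nuAt_of_not_mem {b : ℕ} {P : Proc} (hb : b ∉ P.fn) : Cong (nuAt b P) P := by
  have e : P.rename (absName b) = P.wk :=
    P.rename_congr fun n hn => by
      have : n ≠ b := fun h => hb (h ▸ hn)
      simp [absName, this]
  rw [nuAt, e]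
  have h₁ : Cong (.nu P.wk) (.nu (.par P.wk .zero)) := .nu (Cong.symm (.par_zero _))
  exact h₁.trans ((Cong.extrude P .zero).symm.trans
    ((Cong.par (.refl _) .nu_zero).trans (.par_zero _)))

theorem par_nuAt {b : ℕ} {P Q : Proc} (hb : b ∉ P.fn) :
    Cong (.par P (nuAt b Q)) (nuAt b (.par P Q)) := by
  have e : P.rename (absName b) = P.wk :=
    P.rename_congr fun n hn => by
      have : n ≠ b := fun h => hb (h ▸ hn)
      simp [absName, this]
  have := Cong.extrude P (Q.rename (absName b))
  rwa [← e] at this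

theorem par_nuList {l : List ℕ} {P Q : Proc} (hl : ∀ b ∈ l, b ∉ P.fn) :
    Cong (.par P (nuList l Q)) (nuList l (.par P Q)) := by
  induction l with
  | nil => exact .refl _
  | cons b l ih =>
    exact (par_nuAt (hl b (List.mem_cons_self ..))).trans
      (ih fun c hc => hl c (List.mem_cons_of_mem _ hc)).nuAt

theorem nuList_perm {l l' : List ℕ} (h : l.Perm l') (P : Proc) :
    Cong (nuList l P) (nuList l' P) := by
  induction h with
  | nil => exact .refl _
  | cons b _ ih => exact ih.nuAt
  | swap a b l => exact nuAt_comm _ _ _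
  | trans _ _ ih₁ ih₂ => exact ih₁.trans ih₂

theorem parList_perm {L L' : List Proc} (h : L.Perm L') : Cong (parList L) (parList L') := by
  induction h with
  | nil => exact .refl _
  | cons S _ ih => exact .par (.refl _) ih
  | swap S T L =>
    exact (Cong.par_assoc _ _ _).trans ((Cong.par (.par_comm _ _) (.refl _)).trans
      (Cong.par_assoc _ _ _).symm)
  | trans _ _ ih₁ ih₂ => exact ih₁.trans ih₂

theorem parList_append (L L' : List Proc) :
    Cong (parList (L ++ L')) (.par (parList L) (parList L')) := by
  induction L with
  | nil => exact ((Cong.par_comm _ _).trans (.par_zero _)).symm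
  | cons S L ih => exact (Cong.par (.refl _) ih).trans (.par_assoc _ _ _)

open Classical in
-- Makes normal forms comparable whose lists of restrictions differ only in idle names.
theorem nuList_filter (l : List ℕ) (P : Proc) :
    Cong (nuList l P) (nuList (l.filter (· ∈ P.fn)) P) := by
  induction l with
  | nil => exact .refl _
  | cons b l ih =>
    by_cases hb : b ∈ P.fn
    · rw [List.filter_cons_of_pos (by simpa using hb)]
      exact ih.nuAt
    · rw [List.filter_cons_of_neg (by simpa using hb)]
      exact (nuAt_of_not_mem fun h => hb (mem_fn_nuList.1 h).1).trans ih

/-- Passes from a de Bruijn binder to the restriction of the global name `b`; the hypothesis says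
that no free name is captured. -/
theorem rename_nu {b : ℕ} {P : Proc} {ρ : ℕ → ℕ} (hb : ∀ m ∈ (Proc.nu P).fn, ρ m ≠ b) :
    (Proc.nu P).rename ρ = nuAt b (P.rename (consName b ρ)) := by
  simp only [Proc.rename, nuAt, Proc.rename_rename]
  congr 1
  refine P.rename_congr ?_
  rintro (_ | n) hn
  · simp [absName]
  · simp [absName, hb n hn]

/-- Scope extrusion brings all restrictions to the front. No free name of `P` is sent into `B` by
`ρ`, and the names of parallel components are disjoint, so nothing is captured. -/
theorem Flat.cong_normal (P : Proc) : ∀ {ρ : ℕ → ℕ} {B : Finset ℕ} {M : Multiset Proc},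
    Flat P ρ B M → (∀ m ∈ P.fn, ρ m ∉ B) →
    Cong (P.rename ρ) (nuList B.toList (parList M.toList)) := by
  induction P with
  | zero =>
    rintro ρ B M ⟨rfl, rfl⟩ -
    simp only [Finset.toList_empty, Multiset.toList_zero]
    exact .refl _
  | par P Q ihP ihQ =>
    rintro ρ B M ⟨B₁, B₂, M₁, M₂, rfl, rfl, hd, h₁, h₂⟩ hB
    have c₁ := ihP h₁ fun m hm hm' => hB m (Or.inl hm) (Finset.mem_union_left _ hm')
    have c₂ := ihQ h₂ fun m hm hm' => hB m (Or.inr hm) (Finset.mem_union_right _ hm')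
    have d₁ : ∀ b ∈ B₁.toList, b ∉ (nuList B₂.toList (parList M₂.toList)).fn := by
      intro b hb hb'
      rw [← c₂.fn_eq, Proc.mem_fn_rename] at hb'
      obtain ⟨m, hm, rfl⟩ := hb'
      exact hB m (Or.inr hm) (Finset.mem_union_left _ (Finset.mem_toList.1 hb))
    have d₂ : ∀ b ∈ B₂.toList, b ∉ (parList M₁.toList).fn := by
      intro b hb hb'
      rw [Finset.mem_toList] at hb
      obtain ⟨S, hS, hn⟩ := mem_fn_parList.1 hb'
      rcases h₁.mem_fn _ S (Multiset.mem_toList.1 hS) b hn with h | ⟨m, hm, rfl⟩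
      · exact Finset.disjoint_left.1 hd h hb
      · exact hB m (Or.inl hm) (Finset.mem_union_right _ hb)
    have e₁ : (B₁ ∪ B₂).toList.Perm (B₁.toList ++ B₂.toList) := by
      rw [List.perm_ext_iff_of_nodup (Finset.nodup_toList _)]
      · simp
      · rw [List.nodup_append']
        refine ⟨Finset.nodup_toList _, Finset.nodup_toList _, ?_⟩
        rw [List.disjoint_left]
        intro a ha ha'
        exact Finset.disjoint_left.1 hd (Finset.mem_toList.1 ha) (Finset.mem_toList.1 ha')
    have e₂ : (M₁ + M₂).toList.Perm (M₁.toList ++ M₂.toList) := by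
      rw [← Multiset.coe_eq_coe, ← Multiset.coe_add]
      simp
    have e₃ : nuList (B₁.toList ++ B₂.toList) (.par (parList M₁.toList) (parList M₂.toList)) =
        nuList B₁.toList (nuList B₂.toList (.par (parList M₁.toList) (parList M₂.toList))) := by
      simp [nuList]
    refine (Cong.par c₁ c₂).trans ?_
    refine Cong.trans ?_ ((((parList_perm e₂).trans (parList_append _ _)).nuList).trans
      (nuList_perm e₁ _)).symm
    rw [e₃]
    exact (Cong.par_comm _ _).trans ((par_nuList d₁).trans
      (((Cong.par_comm _ _).trans (par_nuList d₂)).nuList))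
  | nu P ih =>
    rintro ρ B M ⟨b, B', hb, rfl, h⟩ hB
    have c := ih h (by
      rintro (_ | m) hm
      · exact hb
      · exact fun h => hB m hm (Finset.mem_insert_of_mem h))
    rw [rename_nu (b := b) fun m hm h => hB m hm (by simp [h])]
    exact c.nuAt.trans (nuList_perm (Finset.toList_insert hb).symm _)
  | _ =>
    intro ρ B M h _
    replace h := (flat_thread (by trivial)).1 h
    obtain ⟨rfl, S, hS, rfl⟩ := h
    simp only [Finset.toList_empty, Multiset.toList_singleton]
    exact hS.cong.trans (Cong.par_zero _).symm

/-- Processes with a common flattening are structurally congruent. -/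
theorem cong_of_flat {P Q : Proc} {ρ σ : ℕ → ℕ} {B B' : Finset ℕ} {M : Multiset Proc}
    (hP : Flat P ρ B M) (hQ : Flat Q σ B' M) (hB : ∀ m ∈ P.fn, ρ m ∉ B)
    (hB' : ∀ m ∈ Q.fn, σ m ∉ B') (h : ∀ S ∈ M, ∀ n ∈ S.fn, n ∈ B ↔ n ∈ B') :
    Cong (P.rename ρ) (Q.rename σ) := by
  classical
  refine (hP.cong_normal _ hB).trans (Cong.trans ?_ (hQ.cong_normal _ hB').symm)
  -- After idle restrictions are removed on both sides, the same names remain, because `B` and `B'`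
  -- agree on the names that occur in `M`.
  refine (nuList_filter _ _).trans (Cong.trans (nuList_perm ?_ _) (nuList_filter _ _).symm)
  rw [List.perm_ext_iff_of_nodup ((Finset.nodup_toList _).filter _)
    ((Finset.nodup_toList _).filter _)]
  intro n
  simp only [List.mem_filter, Finset.mem_toList, decide_eq_true_eq]
  refine and_congr_left fun hn => ?_
  obtain ⟨S, hS, hn⟩ := mem_fn_parList.1 hn
  exact h S (Multiset.mem_toList.1 hS) n hn

/-! ### Standard form of reductions -/

/-- Interaction of two threads `S₁` and `S₂` with the subject `x`, with contractum `T`. -/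
inductive Inter : ℕ → Proc → Proc → Proc → Prop
  | comm (x y P Q) : Inter x (.out x y Q) (.inp x P) (.par Q (P.inst y))
  | rep (x y P Q) : Inter x (.out x y Q) (.rep x P) (.par Q (.par (P.inst y) (.rep x P)))
  | move (x y ω ω' P Q) : Inter x (.moveOut x y ω P) (.moveIn x ω' Q) (.par P (Q.inst y))
  | dom (x ω P Q) : Inter x (.domOut x ω P) (.domIn x Q) (.par P (Q.dinst ω))
  | choice (x I) (j : {l // l ∈ I}) (P) (Q : {l // l ∈ I} → Proc) :
      Inter x (.sel x j P) (.branch x I Q) (.par P (Q j))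

/-- Top-level reductions. -/
inductive Step : Proc → Proc → Prop
  | inter {x S₁ S₂ T} : Inter x S₁ S₂ T → Step (.par S₁ S₂) T
  | fwd (y P) : Step (.nu (.par (.fwd 0 (y + 1)) P)) (P.inst y)

/-- The restriction of the `n` innermost names. -/
def nuN : ℕ → Proc → Proc
  | 0, P => P
  | n + 1, P => .nu (nuN n P)

theorem Cong.nuN {P Q : Proc} (h : Cong P Q) (n : ℕ) : Cong (nuN n P) (nuN n Q) := by
  induction n with
  | zero => exact h
  | succ n ih => exact .nu ih

theorem par_nuN (n : ℕ) : ∀ P Q : Proc,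
    Cong (.par P (nuN n Q)) (nuN n (.par (P.rename (· + n)) Q)) := by
  induction n with
  | zero =>
    intro P Q
    have : P.rename (· + 0) = P := P.rename_id
    rw [this]
    exact .refl _
  | succ n ih =>
    intro P Q
    refine (Cong.extrude P _).trans (.nu ?_)
    have := ih P.wk Q
    have e : P.wk.rename (· + n) = P.rename (· + (n + 1)) := by
      rw [Proc.wk, Proc.rename_rename]
      congr 1
      funext m
      simp only [Function.comp_apply]
      omega
    rwa [e] at this

/-- Reduction contexts consist of parallel compositions and restrictions, and `par_nuN` moves the
restrictions outwards. The forwarder redex keeps its own restriction, since the step consumes it. -/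
theorem Red.standard {P Q : Proc} (h : Red P Q) :
    ∃ n R X T, Step X T ∧ Cong P (nuN n (.par R X)) ∧ Cong Q (nuN n (.par R T)) := by
  have zero_par : ∀ P, Cong P (nuN 0 (.par .zero P)) := fun P =>
    ((Cong.par_comm _ _).trans (.par_zero _)).symm
  induction h with
  | comm x y P Q => exact ⟨0, .zero, _, _, .inter (.comm x y P Q), zero_par _, zero_par _⟩
  | rep x y P Q => exact ⟨0, .zero, _, _, .inter (.rep x y P Q), zero_par _, zero_par _⟩
  | move x y ω ω' P Q =>
    exact ⟨0, .zero, _, _, .inter (.move x y ω ω' P Q), zero_par _, zero_par _⟩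
  | dom x ω P Q => exact ⟨0, .zero, _, _, .inter (.dom x ω P Q), zero_par _, zero_par _⟩
  | fwd y P => exact ⟨0, .zero, _, _, .fwd y P, zero_par _, zero_par _⟩
  | choice x I j P Q =>
    exact ⟨0, .zero, _, _, .inter (.choice x I j P Q), zero_par _, zero_par _⟩
  | @par P _ _ _ ih =>
    obtain ⟨n, R, X, T, hX, h₁, h₂⟩ := ih
    refine ⟨n, .par (P.rename (· + n)) R, X, T, hX, ?_, ?_⟩
    · exact (Cong.par (.refl _) h₁).trans ((par_nuN n _ _).trans ((Cong.par_assoc _ _ _).nuN n))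
    · exact (Cong.par (.refl _) h₂).trans ((par_nuN n _ _).trans ((Cong.par_assoc _ _ _).nuN n))
  | nu _ ih =>
    obtain ⟨n, R, X, T, hX, h₁, h₂⟩ := ih
    exact ⟨n + 1, R, X, T, hX, .nu h₁, .nu h₂⟩
  | cong h _ h' ih =>
    obtain ⟨n, R, X, T, hX, h₁, h₂⟩ := ih
    exact ⟨n, R, X, T, hX, h.trans h₁, h'.symm.trans h₂⟩

/-- Besides splitting off the names `B₀` of the outer restrictions, it records that the body can be
exchanged while `ρ'` and `B₀` are kept. This is how the process after the step is flattened
consistently with the one before it. -/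
theorem Flat.nuN_inv {X : Proc} (n : ℕ) : ∀ {ρ : ℕ → ℕ} {B : Finset ℕ} {M : Multiset Proc},
    Flat (nuN n X) ρ B M → ∃ (ρ' : ℕ → ℕ) (B₀ B₁ : Finset ℕ), Disjoint B₀ B₁ ∧ B = B₀ ∪ B₁ ∧
      Flat X ρ' B₁ M ∧ (∀ m, ρ' m ∈ B₀ ∨ ∃ m', ρ m' = ρ' m) ∧
      ∀ {X' B₁' M'}, Flat X' ρ' B₁' M' → Disjoint B₀ B₁' →
        Flat (nuN n X') ρ (B₀ ∪ B₁') M' := by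
  induction n with
  | zero =>
    intro ρ B M h
    refine ⟨ρ, ∅, B, by simp, by simp, h, fun m => Or.inr ⟨m, rfl⟩, ?_⟩
    intro X' B₁' M' h' _
    rwa [Finset.empty_union]
  | succ n ih =>
    rintro ρ B M ⟨b, B', hb, rfl, h⟩
    obtain ⟨ρ', B₀, B₁, hd, rfl, hX, hρ, hr⟩ := ih h
    rw [Finset.mem_union, not_or] at hb
    refine ⟨ρ', insert b B₀, B₁, Finset.disjoint_insert_left.2 ⟨hb.2, hd⟩, by simp, hX, ?_, ?_⟩
    · intro m
      rcases hρ m with h | ⟨_ | m', h⟩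
      · exact Or.inl (Finset.mem_insert_of_mem h)
      · exact Or.inl (by simp [← h])
      · exact Or.inr ⟨m', h⟩
    · intro X' B₁' M' h' hd'
      rw [Finset.disjoint_insert_left] at hd'
      exact ⟨b, B₀ ∪ B₁', by simp [hb.1, hd'.1], by simp, hr h' hd'.2⟩

/-! ### Inversion of the rules for `↓` -/

/-- The entries agree, or the second one instantiates an outermost `↓` of the first one. -/
inductive UnfEntry : Option (Ty × Dom) → Option (Ty × Dom) → Prop
  | refl (e) : UnfEntry e e
  | here (A ω) : UnfEntry (some (.here A, ω)) (some (A.subst (Dom.single ω), ω))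

/-- Some outermost `↓` in `Δ` are instantiated in `Δ'`. -/
def UnfMap (Δ Δ' : Ctx) : Prop := ∀ n, UnfEntry (Δ n) (Δ' n)

section

variable {𝓡 : Set AccRule} {Ω : AccCtx} {Γ Δ Δ' Δ₁ Δ₂ : Ctx} {P : Proc} {z x n : ℕ}
  {A A' : Ty} {ω ω' : Dom} {e e' : Option (Ty × Dom)}

theorem UnfEntry.eq_none_iff (h : UnfEntry e e') : e' = none ↔ e = none := by
  cases h <;> simp

theorem UnfMap.refl (Δ : Ctx) : UnfMap Δ Δ := fun _ => .refl _

theorem UnfMap.apply_none (h : UnfMap Δ Δ') (hn : Δ n = none) : Δ' n = none :=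
  (h n).eq_none_iff.2 hn

theorem UnfMap.eq_empty (h : UnfMap Ctx.empty Δ') : Δ' = Ctx.empty :=
  funext fun _ => h.apply_none rfl

theorem UnfMap.distinct (h : UnfMap Δ Δ') (hd : Distinct Γ Δ z) : Distinct Γ Δ' z :=
  hd.mono fun _ => h.apply_none

theorem UnfMap.set (h : UnfMap Δ Δ') (he : UnfEntry e e') : UnfMap (Δ.set x e) (Δ'.set x e') := by
  intro n
  rw [Ctx.set_apply, Ctx.set_apply]
  split_ifs
  · exact he
  · exact h n

theorem UnfMap.push (h : UnfMap Δ Δ') (e : Option (Ty × Dom)) : UnfMap (Δ.push e) (Δ'.push e) := by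
  rintro (_ | n)
  · exact .refl _
  · exact h n

theorem UnfMap.dwk (h : UnfMap Δ Δ') : UnfMap Δ.dwk Δ'.dwk := by
  intro n
  rw [Ctx.dwk_apply, Ctx.dwk_apply]
  have := h n
  generalize Δ n = e at *
  generalize Δ' n = e' at *
  cases this with
  | refl => exact .refl _
  | here A ω =>
    simp only [Option.map_some, Ty.single_subst]
    exact .here _ _

theorem UnfMap.split (h : UnfMap Δ Δ') (hs : Δ.Split Δ₁ Δ₂) :
    ∃ Δ₁' Δ₂', Δ'.Split Δ₁' Δ₂' ∧ UnfMap Δ₁ Δ₁' ∧ UnfMap Δ₂ Δ₂' := by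
  refine ⟨fun n => if Δ₁ n = none then none else Δ' n, fun n => if Δ₂ n = none then none else Δ' n,
    fun n => ?_, fun n => ?_, fun n => ?_⟩
  · have h₁ := hs n
    have h₂ := (h n).eq_none_iff
    simp only
    grind
  · have h₁ := hs n
    have h₂ := h n
    simp only
    split_ifs with hn
    · rw [hn]; exact .refl _
    · rwa [← (h₁.resolve_right fun h => hn h.2).1]
  · have h₁ := hs n
    have h₂ := h n
    simp only
    split_ifs with hn
    · rw [hn]; exact .refl _
    · rwa [← (h₁.resolve_left fun h => hn h.2).1]

theorem UnfMap.accAll (h : UnfMap Δ Δ') (ha : AccAll 𝓡 Ω ω Δ) : AccAll 𝓡 Ω ω Δ' := by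
  intro x B ω' hx
  have h₁ := h x
  rw [hx] at h₁
  generalize hy : Δ x = e at h₁
  cases h₁ with
  | refl => exact ha x _ _ hy
  | here A => exact ha x _ _ hy

theorem UnfMap.map (h : UnfMap Δ Δ') (hx : Δ x = some (A, ω)) (hA : ∀ B, A ≠ .here B) :
    Δ' x = some (A, ω) := by
  have h₁ := h x
  rw [hx] at h₁
  generalize hy : Δ' x = e at h₁
  cases h₁ with
  | refl => rfl
  | here B => exact absurd rfl (hA B)

theorem Ctx.empty_set_self (x : ℕ) (e : Option (Ty × Dom)) : Ctx.empty.set x e x = e := by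
  rw [Ctx.set_apply, if_pos rfl]

theorem UnfMap.eq_single (h : UnfMap (Ctx.empty.set x (some (A, ω))) Δ') :
    ∃ A', UnfEntry (some (A, ω)) (some (A', ω)) ∧ Δ' = Ctx.empty.set x (some (A', ω)) := by
  have h₁ := h x
  rw [Ctx.empty_set_self] at h₁
  have h₂ : ∀ e, Δ' x = e → Δ' = Ctx.empty.set x e := by
    rintro e rfl
    funext n
    rw [Ctx.set_apply]
    split_ifs with hn
    · rw [hn]
    · exact h.apply_none (by rw [Ctx.set_apply, if_neg hn]; rfl)
  generalize hy : Δ' x = e at h₁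
  cases h₁ with
  | refl => exact ⟨A, .refl _, h₂ _ hy⟩
  | here B => exact ⟨_, .here B ω, h₂ _ hy⟩

/-- A leading `↓` of a session that a rule acts on can come only from `hereR` or `hereL`, whose
premise is then what is wanted, or from the identity rule. There, a `↓` opened on one side only is
compensated by the `↓` rule for the other side. All other rules commute with the opening. -/
theorem Typed.unfold (h : Typed 𝓡 Ω Γ Δ P z A ω) : ∀ {Δ' : Ctx} {A' : Ty}, UnfMap Δ Δ' →
    UnfEntry (some (A, ω)) (some (A', ω)) → Typed 𝓡 Ω Γ Δ' P z A' ω := by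
  induction h with
  | cong _ hc ih => intro Δ' A' hΔ hA; exact .cong (ih hΔ hA) hc
  | @id Ω Γ x z A ω hd =>
    intro Δ' A' hΔ hA
    have hd' := hΔ.distinct hd
    obtain ⟨B, hB, rfl⟩ := hΔ.eq_single
    have hx := Ctx.empty_set_self x (some (B, ω))
    cases hA with
    | refl =>
      cases hB with
      | refl => exact .id hd'
      | here => exact .hereR hd' (.id hd')
    | here =>
      cases hB with
      | here => exact .id hd'
      | refl =>
        have hd'' := hd'.set_of_mem (x := x) (e := some (Ty.subst ω.single ‹Ty›, ω))
          (by rw [hx]; simp)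
        refine .hereL hd' hx ?_
        rw [Ctx.set, Ctx.set, Function.update_idem] at hd'' ⊢
        exact .id hd''
  | oneR hd =>
    intro Δ' A' hΔ hA
    cases hA
    obtain rfl := hΔ.eq_empty
    exact .oneR hd
  | oneL hd hx _ ih =>
    intro Δ' A' hΔ hA
    exact .oneL (hΔ.distinct hd) (hΔ.map hx (by simp)) (ih (hΔ.set (.refl _)) hA)
  | lolliR hd _ ih =>
    intro Δ' A' hΔ hA
    cases hA
    exact .lolliR (hΔ.distinct hd) (ih (hΔ.push _) (.refl _))
  | @lolliL _ _ _ _ _ _ _ _ _ _ x _ _ _ hd hx hs ha _ _ ih₁ ih₂ =>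
    intro Δ' A' hΔ hA
    obtain ⟨Δ₁', Δ₂', hs', h₁, h₂⟩ := (hΔ.set (x := x) (.refl none)).split hs
    exact .lolliL (hΔ.distinct hd) (hΔ.map hx (by simp)) hs' (h₁.accAll ha)
      (ih₁ (h₁.push _) (.refl _)) (ih₂ (h₂.set (.refl _)) hA)
  | tensorR hd hs _ _ ih₁ ih₂ =>
    intro Δ' A' hΔ hA
    cases hA
    obtain ⟨Δ₁', Δ₂', hs', h₁, h₂⟩ := hΔ.split hs
    exact .tensorR (hΔ.distinct hd) hs' (ih₁ (h₁.push _) (.refl _)) (ih₂ h₂ (.refl _))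
  | tensorL hd hx _ ih =>
    intro Δ' A' hΔ hA
    exact .tensorL (hΔ.distinct hd) (hΔ.map hx (by simp)) (ih ((hΔ.set (.refl _)).push _) hA)
  | ampR hd _ ih =>
    intro Δ' A' hΔ hA
    cases hA
    exact .ampR (hΔ.distinct hd) fun l => ih l hΔ (.refl _)
  | ampR₂ hd hk _ ih =>
    intro Δ' A' hΔ hA
    cases hA
    exact .ampR₂ (hΔ.distinct hd) hk (ih hΔ (.refl _))
  | ampL₁ hd hx _ ih =>
    intro Δ' A' hΔ hA
    exact .ampL₁ (hΔ.distinct hd) (hΔ.map hx (by simp)) (ih (hΔ.set (.refl _)) hA)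
  | ampL₂ hd hk hx _ ih =>
    intro Δ' A' hΔ hA
    exact .ampL₂ (hΔ.distinct hd) hk (hΔ.map hx (by simp)) (ih (hΔ.set (.refl _)) hA)
  | plusR₁ hd _ ih =>
    intro Δ' A' hΔ hA
    cases hA
    exact .plusR₁ (hΔ.distinct hd) (ih hΔ (.refl _))
  | plusR₂ hd hk _ ih =>
    intro Δ' A' hΔ hA
    cases hA
    exact .plusR₂ (hΔ.distinct hd) hk (ih hΔ (.refl _))
  | plusL hd hx _ ih =>
    intro Δ' A' hΔ hA
    exact .plusL (hΔ.distinct hd) (hΔ.map hx (by simp)) fun l => ih l (hΔ.set (.refl _)) hA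
  | plusL₂ hd hk hx _ ih =>
    intro Δ' A' hΔ hA
    exact .plusL₂ (hΔ.distinct hd) hk (hΔ.map hx (by simp)) (ih (hΔ.set (.refl _)) hA)
  | bangR hd h _ =>
    intro Δ' A' hΔ hA
    cases hA
    obtain rfl := hΔ.eq_empty
    exact .bangR hd h
  | bangL hd hx _ ih =>
    intro Δ' A' hΔ hA
    exact .bangL (hΔ.distinct hd) (hΔ.map hx (by simp)) (ih ((hΔ.set (.refl _)).push _) hA)
  | atR hd ha haa _ ih =>
    intro Δ' A' hΔ hA
    cases hA
    exact .atR (hΔ.distinct hd) ha (hΔ.accAll haa) (ih (hΔ.push _) (.refl _))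
  | atL hd hx _ ih =>
    intro Δ' A' hΔ hA
    exact .atL (hΔ.distinct hd) (hΔ.map hx (by simp)) (ih ((hΔ.set (.refl _)).push _) hA)
  | allR hd _ ih =>
    intro Δ' A' hΔ hA
    cases hA
    exact .allR (hΔ.distinct hd) (ih hΔ.dwk (.refl _))
  | allL hd hx ha _ ih =>
    intro Δ' A' hΔ hA
    exact .allL (hΔ.distinct hd) (hΔ.map hx (by simp)) ha (ih (hΔ.set (.refl _)) hA)
  | exR hd ha _ ih =>
    intro Δ' A' hΔ hA
    cases hA
    exact .exR (hΔ.distinct hd) ha (ih hΔ (.refl _))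
  | exL hd hx _ ih =>
    intro Δ' A' hΔ hA
    refine .exL (hΔ.distinct hd) (hΔ.map hx (by simp)) (ih (hΔ.dwk.set (.refl _)) ?_)
    cases hA with
    | refl => exact .refl _
    | here B =>
      rw [Ty.single_subst]
      exact .here _ _
  | hereR hd _ ih =>
    intro Δ' A' hΔ hA
    cases hA with
    | refl => exact .hereR (hΔ.distinct hd) (ih hΔ (.refl _))
    | here => exact ih hΔ (.refl _)
  | @hereL _ _ Δ _ _ _ _ x A ω hd hx _ ih =>
    intro Δ' A' hΔ hA
    have h₁ := hΔ x
    rw [hx] at h₁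
    generalize hy : Δ' x = e at h₁
    cases h₁ with
    | refl => exact .hereL (hΔ.distinct hd) hy (ih (hΔ.set (.refl _)) hA)
    | here =>
      -- The entry of `x` in `Δ'` is already the instantiated one, so the update in the premise
      -- changes nothing and the `↓` rule is dropped.
      have := ih (hΔ.set (x := x) (.refl _)) hA
      rwa [Ctx.set, ← hy, Function.update_eq_self] at this
  | copy hd hu ha _ ih =>
    intro Δ' A' hΔ hA
    exact .copy (hΔ.distinct hd) hu ha (ih (hΔ.push _) hA)
  | cut hd hs ha haa _ _ ih₁ ih₂ =>
    intro Δ' A' hΔ hA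
    obtain ⟨Δ₁', Δ₂', hs', h₁, h₂⟩ := hΔ.split hs
    exact .cut (hΔ.distinct hd) hs' ha (h₁.accAll haa) (ih₁ (h₁.push _) (.refl _))
      (ih₂ (h₂.push _) hA)
  | cutBang hd h _ _ ih₂ =>
    intro Δ' A' hΔ hA
    exact .cutBang (hΔ.distinct hd) h (ih₂ (hΔ.push _) hA)

end

/-! ### Subtyping -/

/-- One step of subtyping of sessions in the domain `ω`: the rules for `↓`, and width subtyping. -/
inductive Conv (ω : Dom) : Ty → Ty → Prop
  | hereL (A) : Conv ω (.here A) (A.subst (Dom.single ω))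
  | hereR (A) : Conv ω (A.subst (Dom.single ω)) (.here A)
  | amp {I : Finset ℕ} {k : ℕ} (hk : k ∉ I) (A : {l // l ∈ insert k I} → Ty) :
      Conv ω (.amp (insert k I) A) (.amp I fun l => A ⟨l, Finset.mem_insert_of_mem l.2⟩)
  | plus {I : Finset ℕ} {k : ℕ} (hk : k ∉ I) (A : {l // l ∈ insert k I} → Ty) :
      Conv ω (.plus I fun l => A ⟨l, Finset.mem_insert_of_mem l.2⟩) (.plus (insert k I) A)

/-- Subtyping of sessions in the domain `ω`. -/
def Le (ω : Dom) : Ty → Ty → Prop := Relation.ReflTransGen (Conv ω)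

/-- `B` is the type `A`, with all outermost `↓` instantiated by `ω`. -/
inductive Unf (ω : Dom) : Ty → Ty → Prop
  | base {A} : (∀ B, A ≠ .here B) → Unf ω A A
  | here {A B} : Unf ω (A.subst (Dom.single ω)) B → Unf ω (.here A) B

/-- Width subtyping. -/
inductive Width : Ty → Ty → Prop
  | refl (A) : Width A A
  | amp {I J : Finset ℕ} {A : {l // l ∈ I} → Ty} {A' : {l // l ∈ J} → Ty} (h : J ⊆ I) :
      (∀ l : {l // l ∈ J}, A' l = A ⟨l, h l.2⟩) → Width (.amp I A) (.amp J A')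
  | plus {I J : Finset ℕ} {A : {l // l ∈ I} → Ty} {A' : {l // l ∈ J} → Ty} (h : I ⊆ J) :
      (∀ l : {l // l ∈ I}, A' ⟨l, h l.2⟩ = A l) → Width (.plus I A) (.plus J A')

theorem Width.trans {A B C : Ty} (h : Width A B) (h' : Width B C) : Width A C := by
  cases h with
  | refl => exact h'
  | amp h h₁ =>
    cases h' with
    | refl => exact .amp h h₁
    | amp h' h₂ => exact .amp (h'.trans h) fun l => by rw [h₂, h₁]
  | plus h h₁ =>
    cases h' with
    | refl => exact .plus h h₁
    | plus h' h₂ => exact .plus (h.trans h') fun l => by rw [← h₁ l, ← h₂]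

/-- Opening and closing a `↓` leave the fully unfolded type unchanged, and a width step concerns a
type that is already unfolded. So along a chain only width steps are visible after unfolding. An
unfolding is assumed at one end and transported, so no termination argument is required. -/
theorem Le.unf {ω : Dom} {A B A' : Ty} (h : Le ω A B) (hA : Unf ω A A') :
    ∃ B', Unf ω B B' ∧ Width A' B' := by
  induction h with
  | refl => exact ⟨A', hA, .refl _⟩
  | tail _ hc ih =>
    obtain ⟨B', hB, hw⟩ := ih
    cases hc with
    | hereL A =>
      cases hB with
      | base h => exact absurd rfl (h A)
      | here h => exact ⟨B', h, hw⟩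
    | hereR A => exact ⟨B', .here hB, hw⟩
    | amp hk A =>
      cases hB with
      | base h =>
        exact ⟨_, .base (by simp), hw.trans (.amp (Finset.subset_insert _ _) fun l => rfl)⟩
    | plus hk A =>
      cases hB with
      | base h =>
        exact ⟨_, .base (by simp), hw.trans (.plus (Finset.subset_insert _ _) fun l => rfl)⟩

/-- In particular, the head constructors agree. This is how the type offered by a provider is
matched with the type under which a user acts on it. -/
theorem Le.width {ω : Dom} {A B : Ty} (h : Le ω A B) (hA : ∀ C, A ≠ .here C)
    (hB : ∀ C, B ≠ .here C) : Width A B := by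
  obtain ⟨B', hB', hw⟩ := h.unf (.base hA)
  cases hB' with
  | base => exact hw
  | here => exact absurd rfl (hB _)

section

variable {𝓡 : Set AccRule} {Ω : AccCtx} {Γ Γ' Δ Δ' : Ctx} {P S : Proc} {z x y : ℕ} {A A' C : Ty}
  {ω ω₁ ω₂ : Dom} {B Bs : Finset ℕ} {M : Multiset Proc}

/-- Three of the four steps are typing rules; opening an offered `↓` is inversion. -/
theorem Typed.convR (h : Typed 𝓡 Ω Γ Δ P z A ω) (hc : Conv ω A A') :
    Typed 𝓡 Ω Γ Δ P z A' ω := by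
  cases hc with
  | hereL A => exact h.unfold (.refl _) (.here _ _)
  | hereR A => exact .hereR h.distinct h
  | amp hk A => exact .ampR₂ h.distinct hk h
  | plus hk A => exact .plusR₂ h.distinct hk h

theorem Typed.convL (hd : Distinct Γ Δ z) (hx : Δ x = some (A, ω₂)) (hc : Conv ω₂ A A')
    (h : Typed 𝓡 Ω Γ (Δ.set x (some (A', ω₂))) P z C ω₁) : Typed 𝓡 Ω Γ Δ P z C ω₁ := by
  cases hc with
  | hereL A => exact .hereL hd hx h
  -- No left rule closes a `↓`; the premise, in which `x` has the type with `↓`, is inverted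
  -- instead.
  | hereR A =>
    refine h.unfold (fun n => ?_) (.refl _)
    rw [Ctx.set_apply]
    split_ifs with hn
    · rw [hn, hx]
      exact .here _ _
    · exact .refl _
  | amp hk A => exact .ampL₂ hd hk hx h
  | plus hk A => exact .plusL₂ hd hk hx h

end

/-! ### Typed threads and multisets of threads -/

/-- The names in `B` are not declared in the sequent. -/
def Fresh (B : Finset ℕ) (Γ Δ : Ctx) (z : ℕ) : Prop :=
  ∀ b ∈ B, Γ b = none ∧ Δ b = none ∧ b ≠ z

/-- `Blk Γ Δ B S z A ω`: the thread `S` (with `B = ∅`), or the bound output `(ν y) S` (with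
`B = {y}`), is typed by a logical rule, the identity rule or the copy rule. -/
inductive Blk (𝓡 : Set AccRule) (Ω : AccCtx) (Γ : Ctx) :
    Ctx → Finset ℕ → Proc → ℕ → Ty → Dom → Prop
  | fwd {x z A ω} : Blk 𝓡 Ω Γ (Ctx.empty.set x (some (A, ω))) ∅ (.fwd x z) z A ω
  | lolliR {Δ P z A B ω} :
      Typed 𝓡 Ω (Γ.push none) (Δ.push (some (A, ω))) P (z + 1) B ω →
      Blk 𝓡 Ω Γ Δ ∅ (.inp z P) z (.lolli A B) ω
  | lolliL {Δ Δ₁ Δ₂ P Q z C ω₁ x y A B ω₂} :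
      Δ x = some (.lolli A B, ω₂) →
      (Δ.set x none).Split Δ₁ Δ₂ →
      AccAll 𝓡 Ω ω₂ Δ₁ →
      Typed 𝓡 Ω Γ Δ₁ P y A ω₂ →
      Typed 𝓡 Ω Γ (Δ₂.set x (some (B, ω₂))) Q z C ω₁ →
      Blk 𝓡 Ω Γ Δ {y} (.out x y (.par P Q)) z C ω₁
  | tensorR {Δ Δ₁ Δ₂ P Q z y A B ω} :
      Δ.Split Δ₁ Δ₂ →
      Typed 𝓡 Ω Γ Δ₁ P y A ω →
      Typed 𝓡 Ω Γ Δ₂ Q z B ω →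
      Blk 𝓡 Ω Γ Δ {y} (.out z y (.par P Q)) z (.tensor A B) ω
  | tensorL {Δ P z C ω₁ x A B ω₂} :
      Δ x = some (.tensor A B, ω₂) →
      Typed 𝓡 Ω (Γ.push none) ((Δ.set x (some (B, ω₂))).push (some (A, ω₂))) P (z + 1) C ω₁ →
      Blk 𝓡 Ω Γ Δ ∅ (.inp x P) z C ω₁
  | ampR {Δ z I} {A : {l // l ∈ I} → Ty} {P : {l // l ∈ I} → Proc} {ω} :
      (∀ l, Typed 𝓡 Ω Γ Δ (P l) z (A l) ω) →
      Blk 𝓡 Ω Γ Δ ∅ (.branch z I P) z (.amp I A) ω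
  | ampL {Δ P z C ω₁ x l A ω₂} :
      Δ x = some (.amp {l} (fun _ => A), ω₂) →
      Typed 𝓡 Ω Γ (Δ.set x (some (A, ω₂))) P z C ω₁ →
      Blk 𝓡 Ω Γ Δ ∅ (.sel x l P) z C ω₁
  | plusR {Δ P z l A ω} :
      Typed 𝓡 Ω Γ Δ P z A ω →
      Blk 𝓡 Ω Γ Δ ∅ (.sel z l P) z (.plus {l} (fun _ => A)) ω
  | plusL {Δ z C ω₁ x I} {A : {l // l ∈ I} → Ty} {Q : {l // l ∈ I} → Proc} {ω₂} :
      Δ x = some (.plus I A, ω₂) →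
      (∀ l, Typed 𝓡 Ω Γ (Δ.set x (some (A l, ω₂))) (Q l) z C ω₁) →
      Blk 𝓡 Ω Γ Δ ∅ (.branch x I Q) z C ω₁
  | bangR {Q z y A ω} :
      Typed 𝓡 Ω (Γ.push none) Ctx.empty Q 0 A ω →
      Blk 𝓡 Ω Γ Ctx.empty {y} (.out z y (.rep y Q)) z (.bang A) ω
  | bangL {Δ P z C ω₁ x A ω₂} :
      Δ x = some (.bang A, ω₂) →
      Typed 𝓡 Ω (Γ.push (some (A, ω₂))) ((Δ.set x none).push none) P (z + 1) C ω₁ →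
      Blk 𝓡 Ω Γ Δ ∅ (.inp x P) z C ω₁
  | atR {Δ P z y A ω₁ ω₂} :
      Acc 𝓡 Ω ω₁ ω₂ →
      AccAll 𝓡 Ω ω₂ Δ →
      Typed 𝓡 Ω Γ Δ P y A ω₂ →
      Blk 𝓡 Ω Γ Δ {y} (.moveOut z y ω₂ P) z (.atDom ω₂ A) ω₁
  | atL {Δ P z C ω₁ x A ω₂ ω₃} :
      Δ x = some (.atDom ω₃ A, ω₂) →
      Typed 𝓡 ((ω₂, ω₃) :: Ω) (Γ.push none) ((Δ.set x none).push (some (A, ω₃)))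
        P (z + 1) C ω₁ →
      Blk 𝓡 Ω Γ Δ ∅ (.moveIn x ω₃ P) z C ω₁
  | allR {Δ P z A ω₁} :
      Typed 𝓡 ((ω₁.subst Dom.wk, .var 0) :: Ω.dwk) Γ.dwk Δ.dwk P z A (ω₁.subst Dom.wk) →
      Blk 𝓡 Ω Γ Δ ∅ (.domIn z P) z (.all A) ω₁
  | allL {Δ Q z C ω₁ x A ω₂ ω₃} :
      Δ x = some (.all A, ω₂) →
      Acc 𝓡 Ω ω₂ ω₃ →
      Typed 𝓡 Ω Γ (Δ.set x (some (A.subst (Dom.single ω₃), ω₂))) Q z C ω₁ →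
      Blk 𝓡 Ω Γ Δ ∅ (.domOut x ω₃ Q) z C ω₁
  | exR {Δ P z A ω₁ ω₂} :
      Acc 𝓡 Ω ω₁ ω₂ →
      Typed 𝓡 Ω Γ Δ P z (A.subst (Dom.single ω₂)) ω₁ →
      Blk 𝓡 Ω Γ Δ ∅ (.domOut z ω₂ P) z (.ex A) ω₁
  | exL {Δ Q z C ω₁ x A ω₂} :
      Δ x = some (.ex A, ω₂) →
      Typed 𝓡 ((ω₂.subst Dom.wk, .var 0) :: Ω.dwk) Γ.dwk
        (Δ.dwk.set x (some (A, ω₂.subst Dom.wk))) Q z (C.subst Dom.wk) (ω₁.subst Dom.wk) →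
      Blk 𝓡 Ω Γ Δ ∅ (.domIn x Q) z C ω₁
  | copy {Δ P z C ω₁ u y A ω₂} :
      Γ u = some (A, ω₂) →
      AccStar 𝓡 Ω ω₁ ω₂ →
      Typed 𝓡 Ω Γ (Δ.set y (some (A, ω₂))) P z C ω₁ →
      Blk 𝓡 Ω Γ Δ {y} (.out u y P) z C ω₁

/-- Typing of a multiset `M` of threads whose free names are pairwise different names of one
global name space; the names in `B` are those of cuts and the objects of bound outputs. -/
inductive OT (𝓡 : Set AccRule) (Ω : AccCtx) :
    Ctx → Ctx → Finset ℕ → Multiset Proc → ℕ → Ty → Dom → Prop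
  | blk {Γ Δ B S z A ω} (hd : Distinct Γ Δ z) (hf : Fresh B Γ Δ z) :
      Blk 𝓡 Ω Γ Δ B S z A ω → OT 𝓡 Ω Γ Δ B {S} z A ω
  | zero {Γ z ω} (hd : Distinct Γ Ctx.empty z) : OT 𝓡 Ω Γ Ctx.empty ∅ 0 z .one ω
  | oneL {Γ Δ B M z C ω₁ x ω₂} (hd : Distinct Γ Δ z) (hf : Fresh B Γ Δ z) :
      Δ x = some (.one, ω₂) →
      OT 𝓡 Ω Γ (Δ.set x none) B M z C ω₁ → OT 𝓡 Ω Γ Δ B M z C ω₁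
  | convL {Γ Δ B M z C ω₁ x A A' ω₂} (hd : Distinct Γ Δ z) (hf : Fresh B Γ Δ z) :
      Δ x = some (A, ω₂) → Conv ω₂ A A' →
      OT 𝓡 Ω Γ (Δ.set x (some (A', ω₂))) B M z C ω₁ → OT 𝓡 Ω Γ Δ B M z C ω₁
  | convR {Γ Δ B M z A A' ω} (hd : Distinct Γ Δ z) (hf : Fresh B Γ Δ z) :
      Conv ω A A' → OT 𝓡 Ω Γ Δ B M z A ω → OT 𝓡 Ω Γ Δ B M z A' ω
  | cut {Γ Δ Δ₁ Δ₂ x B₁ B₂ M₁ M₂ z C ω₁ A ω₂} (hd : Distinct Γ Δ z)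
      (hf : Fresh (insert x (B₁ ∪ B₂)) Γ Δ z) (hx : x ∉ B₁ ∪ B₂) (hB : Disjoint B₁ B₂) :
      Δ.Split Δ₁ Δ₂ →
      AccStar 𝓡 Ω ω₁ ω₂ →
      AccAll 𝓡 Ω ω₂ Δ₁ →
      OT 𝓡 Ω Γ Δ₁ B₁ M₁ x A ω₂ →
      OT 𝓡 Ω Γ (Δ₂.set x (some (A, ω₂))) B₂ M₂ z C ω₁ →
      OT 𝓡 Ω Γ Δ (insert x (B₁ ∪ B₂)) (M₁ + M₂) z C ω₁
  | cutBang {Γ Δ u B P M z C ω₂ A ω₁} (hd : Distinct Γ Δ z)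
      (hf : Fresh (insert u B) Γ Δ z) (hu : u ∉ B) :
      Typed 𝓡 Ω (Γ.push none) Ctx.empty P 0 A ω₁ →
      OT 𝓡 Ω (Γ.set u (some (A, ω₁))) Δ B M z C ω₂ →
      OT 𝓡 Ω Γ Δ (insert u B) (.rep u P ::ₘ M) z C ω₂

/-! ### Renaming and weakening of typed multisets -/

section

variable {𝓡 : Set AccRule} {Ω : AccCtx} {Γ Γ' Δ Δ' : Ctx} {P S : Proc} {z x y : ℕ} {A A' C : Ty}
  {ω ω₁ ω₂ : Dom} {B Bs : Finset ℕ} {M : Multiset Proc}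

theorem OT.distinct (h : OT 𝓡 Ω Γ Δ B M z A ω) : Distinct Γ Δ z := by cases h <;> assumption

theorem OT.fresh (h : OT 𝓡 Ω Γ Δ B M z A ω) : Fresh B Γ Δ z := by
  cases h <;> first | assumption | simp [Fresh]

theorem GMap.set {ρ : ℕ → ℕ} (hρ : Function.Injective ρ) (h : GMap ρ Γ Γ') (x : ℕ)
    (e : Option (Ty × Dom)) : GMap ρ (Γ.set x e) (Γ'.set (ρ x) e) := by
  intro n a
  have := h n a
  simp only [Ctx.set_apply, hρ.eq_iff]
  split_ifs <;> simp_all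

theorem Blk.rename {ρ : ℕ → ℕ} (h : Blk 𝓡 Ω Γ Δ Bs S z A ω)
    (hΓ : GMap ρ Γ Γ') (hΔ : LMap ρ Δ Δ') (hd' : Distinct Γ' Δ' (ρ z))
    (hf : Fresh (Bs.image ρ) Γ' Δ' (ρ z)) :
    Blk 𝓡 Ω Γ' Δ' (Bs.image ρ) (S.rename ρ) (ρ z) A ω := by
  cases h with
  | fwd =>
    obtain rfl := hΔ.eq_single
    exact .fwd
  | lolliR h => exact .lolliR (h.rename (hΓ.lift _) (hΔ.lift _) (hd'.push _))
  | @lolliL _ _ _ _ _ _ _ _ x y _ _ _ hx hs ha h₁ h₂ =>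
    rw [Finset.image_singleton] at hf ⊢
    have hy := hf (ρ y) (Finset.mem_singleton_self _)
    obtain ⟨Δ₁', Δ₂', hs', m₁, m₂⟩ :=
      (hΔ.set_of_mem (x := x) (e := none) (by simp [hx])).split hs
    have d := hd'.set_none (x := ρ x)
    have hn : (Δ'.set (ρ x) none) (ρ x) = none := by simp [Ctx.set_apply]
    refine .lolliL (hΔ.map _ _ hx) hs' (ha.lmap m₁) (h₁.rename hΓ m₁ ⟨hy.1, ?_, ?_⟩)
      (h₂.rename hΓ (m₂.set_of_none (hs'.right_none hn))
        ((d.mono fun _ => hs'.right_none).set_of_fresh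
          (by have := hd'.2.2 (ρ x); have := hΔ.map _ _ hx; grind)
          (by have := hd'.2.1; have := hΔ.map _ _ hx; grind)))
    · exact hs'.left_none (Ctx.set_none_none hy.2.1)
    · exact (d.mono fun _ => hs'.left_none).2.2
  | @tensorR _ _ _ _ _ _ y _ _ _ hs h₁ h₂ =>
    rw [Finset.image_singleton] at hf ⊢
    have hy := hf (ρ y) (Finset.mem_singleton_self _)
    obtain ⟨Δ₁', Δ₂', hs', m₁, m₂⟩ := hΔ.split hs
    exact .tensorR hs' (h₁.rename hΓ m₁ ⟨hy.1, hs'.left_none hy.2.1,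
      (hd'.mono fun _ => hs'.left_none).2.2⟩) (h₂.rename hΓ m₂ (hd'.mono fun _ => hs'.right_none))
  | tensorL hx h =>
    have hx' := hΔ.map _ _ hx
    exact .tensorL hx' (h.rename (hΓ.lift _) ((hΔ.set_of_mem (by simp [hx])).lift _)
      ((hd'.set_of_mem (by simp [hx'])).push _))
  | ampR h => exact .ampR fun l => (h l).rename hΓ hΔ hd'
  | ampL hx h =>
    have hx' := hΔ.map _ _ hx
    exact .ampL hx' (h.rename hΓ (hΔ.set_of_mem (by simp [hx])) (hd'.set_of_mem (by simp [hx'])))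
  | plusR h => exact .plusR (h.rename hΓ hΔ hd')
  | plusL hx h =>
    have hx' := hΔ.map _ _ hx
    exact .plusL hx' fun l => (h l).rename hΓ (hΔ.set_of_mem (by simp [hx]))
      (hd'.set_of_mem (by simp [hx']))
  | bangR h =>
    obtain rfl := hΔ.eq_empty
    rw [Finset.image_singleton]
    exact .bangR (h.rename (hΓ.lift _) (LMap.empty _) ⟨rfl, rfl, fun _ => Or.inr rfl⟩)
  | bangL hx h =>
    exact .bangL (hΔ.map _ _ hx) (h.rename (hΓ.lift _) ((hΔ.set_of_mem (by simp [hx])).lift _)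
      (hd'.set_none.push_unr _))
  | @atR _ _ _ y _ _ _ ha haa h =>
    rw [Finset.image_singleton] at hf ⊢
    have hy := hf (ρ y) (Finset.mem_singleton_self _)
    exact .atR ha (haa.lmap hΔ) (h.rename hΓ hΔ ⟨hy.1, hy.2.1, hd'.2.2⟩)
  | atL hx h =>
    exact .atL (hΔ.map _ _ hx) (h.rename (hΓ.lift _) ((hΔ.set_of_mem (by simp [hx])).lift _)
      (hd'.set_none.push _))
  | allR h => exact .allR (h.rename hΓ.dwk hΔ.dwk hd'.dwk)
  | allL hx ha h =>
    have hx' := hΔ.map _ _ hx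
    exact .allL hx' ha
      (h.rename hΓ (hΔ.set_of_mem (by simp [hx])) (hd'.set_of_mem (by simp [hx'])))
  | exR ha h => exact .exR ha (h.rename hΓ hΔ hd')
  | exL hx h =>
    have hx' := hΔ.map _ _ hx
    exact .exL hx' (h.rename hΓ.dwk (hΔ.dwk.set_of_mem (by simp [Ctx.dwk_apply, hx]))
      (hd'.dwk.set_of_mem (by simp [Ctx.dwk_apply, hx'])))
  | @copy _ _ _ _ _ _ y _ _ hu ha h =>
    rw [Finset.image_singleton] at hf ⊢
    have hy := hf (ρ y) (Finset.mem_singleton_self _)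
    exact .copy (hΓ _ _ hu) ha (h.rename hΓ (hΔ.set_of_none hy.2.1)
      (hd'.set_of_fresh hy.1 hy.2.2))

theorem Fresh.mono {B' : Finset ℕ} (h : Fresh B Γ Δ z) (hB : B' ⊆ B)
    (hΔ : ∀ n, Δ n = none → Δ' n = none) : Fresh B' Γ Δ' z :=
  fun b hb => ⟨(h b (hB hb)).1, hΔ b (h b (hB hb)).2.1, (h b (hB hb)).2.2⟩

/-- In contrast to `Typed.rename`, the renaming has to be injective: the names of cuts belong to the
same name space as the free names and must stay apart from them and from each other. -/
theorem OT.rename {ρ : ℕ → ℕ} (hρ : Function.Injective ρ) (h : OT 𝓡 Ω Γ Δ B M z A ω) :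
    ∀ {Γ' Δ' : Ctx}, GMap ρ Γ Γ' → LMap ρ Δ Δ' → Distinct Γ' Δ' (ρ z) →
      Fresh (B.image ρ) Γ' Δ' (ρ z) →
      OT 𝓡 Ω Γ' Δ' (B.image ρ) (M.map (Proc.rename ρ)) (ρ z) A ω := by
  induction h with
  | blk _ _ h =>
    intro Γ' Δ' hΓ hΔ hd hf
    exact .blk hd hf (h.rename hΓ hΔ hd hf)
  | zero =>
    intro Γ' Δ' hΓ hΔ hd hf
    obtain rfl := hΔ.eq_empty
    exact .zero hd
  | oneL _ _ hx _ ih =>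
    intro Γ' Δ' hΓ hΔ hd hf
    exact .oneL hd hf (hΔ.map _ _ hx) (ih hΓ (hΔ.set_of_mem (by simp [hx])) hd.set_none
      (hf.mono (Finset.Subset.refl _) fun _ => Ctx.set_none_none))
  | @convL _ _ _ _ _ _ _ x _ _ _ _ _ hx hc _ ih =>
    intro Γ' Δ' hΓ hΔ hd hf
    have hx' := hΔ.map _ _ hx
    refine .convL hd hf hx' hc (ih hΓ (hΔ.set_of_mem (by simp [hx]))
      (hd.set_of_mem (by simp [hx'])) fun b hb => ?_)
    have := hf b hb
    rw [Ctx.set_apply]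
    grind
  | convR _ _ hc _ ih =>
    intro Γ' Δ' hΓ hΔ hd hf
    exact .convR hd hf hc (ih hΓ hΔ hd hf)
  | @cut _ _ Δ₁ Δ₂ x B₁ B₂ _ _ _ _ _ _ _ _ _ hx hB hs ha haa _ _ ih₁ ih₂ =>
    intro Γ' Δ' hΓ hΔ hd hf
    rw [Finset.image_insert, Finset.image_union] at hf ⊢
    rw [Multiset.map_add]
    obtain ⟨Δ₁', Δ₂', hs', m₁, m₂⟩ := hΔ.split hs
    have hfx := hf (ρ x) (Finset.mem_insert_self _ _)
    have hx' : ρ x ∉ B₁.image ρ ∪ B₂.image ρ := by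
      rw [← Finset.image_union]
      simpa [hρ.eq_iff] using hx
    refine .cut hd hf hx' ?_ hs' ha (haa.lmap m₁) (ih₁ hΓ m₁ ?_ ?_)
      (ih₂ hΓ (m₂.set_of_none (hs'.right_none hfx.2.1)) ?_ ?_)
    · rwa [Finset.disjoint_image hρ]
    · exact ⟨hfx.1, hs'.left_none hfx.2.1, (hd.mono fun _ => hs'.left_none).2.2⟩
    · intro b hb
      have := hf b (by grind)
      exact ⟨this.1, hs'.left_none this.2.1, by grind⟩
    · exact (hd.mono fun _ => hs'.right_none).set_of_fresh hfx.1 hfx.2.2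
    · intro b hb
      have := hf b (by grind)
      refine ⟨this.1, ?_, this.2.2⟩
      have := hs'.right_none this.2.1
      rw [Ctx.set_apply]
      grind
  | @cutBang _ _ u B P _ _ _ _ _ _ _ _ hu h _ ih =>
    intro Γ' Δ' hΓ hΔ hd hf
    rw [Finset.image_insert] at hf ⊢
    rw [Multiset.map_cons]
    have hfu := hf (ρ u) (Finset.mem_insert_self _ _)
    refine .cutBang hd hf (by simpa [hρ.eq_iff] using hu)
      (h.rename (hΓ.lift _) (LMap.empty _) ⟨rfl, rfl, fun _ => Or.inr rfl⟩)
      (ih (hΓ.set hρ _ _) hΔ ⟨?_, hd.2.1, fun n => ?_⟩ fun b hb => ?_)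
    · have := hd.1
      rw [Ctx.set_apply]
      grind
    · have := hd.2.2 n
      rw [Ctx.set_apply]
      grind
    · have := hf b (Finset.mem_insert_of_mem hb)
      have hb' : b ≠ ρ u := by
        rintro rfl
        rw [Finset.mem_image] at hb
        obtain ⟨c, hc, hc'⟩ := hb
        exact hu (hρ hc' ▸ hc)
      rw [Ctx.set_apply, if_neg hb']
      exact this

/-- Weakening of unrestricted environments. -/
theorem OT.weaken (h : OT 𝓡 Ω Γ Δ B M z A ω) (hΓ : ∀ n e, Γ n = some e → Γ' n = some e)
    (hd : Distinct Γ' Δ z) (hf : Fresh B Γ' Δ z) : OT 𝓡 Ω Γ' Δ B M z A ω := by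
  have e : Proc.rename id = id := funext Proc.rename_id
  have := h.rename (ρ := id) Function.injective_id hΓ (LMap.id Δ) hd (by simpa using hf)
  simpa [e] using this

theorem Blk.weaken (h : Blk 𝓡 Ω Γ Δ Bs S z A ω) (hΓ : ∀ n e, Γ n = some e → Γ' n = some e)
    (hd : Distinct Γ' Δ z) (hf : Fresh Bs Γ' Δ z) : Blk 𝓡 Ω Γ' Δ Bs S z A ω := by
  have := h.rename (ρ := id) hΓ (LMap.id Δ) hd (by simpa using hf)
  simpa [Proc.rename_id] using this

end

section

variable {𝓡 : Set AccRule} {Ω : AccCtx} {Γ Γ' Δ Δ' Δ₁ Δ₂ : Ctx} {P Q S : Proc} {z x y b : ℕ}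
  {A A' C : Ty} {ω ω₁ ω₂ : Dom} {B Bs X X₁ X₂ : Finset ℕ} {M : Multiset Proc} {ρ : ℕ → ℕ}

/-! ### From typed multisets of threads to typed processes -/

theorem GMap.abs (h : Γ b = none) : GMap (absName b) Γ (Γ.push none) := by
  intro n e hn
  have : n ≠ b := by rintro rfl; simp [h] at hn
  simpa [absName, this] using hn

theorem GMap.abs_set (e : Option (Ty × Dom)) : GMap (absName b) (Γ.set b e) (Γ.push e) := by
  intro n a hn
  rw [Ctx.set_apply] at hn
  split_ifs at hn with h
  · simpa [absName, h] using hn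
  · simpa [absName, h] using hn

theorem LMap.abs_set (hb : Δ b = none) (e : Option (Ty × Dom)) :
    LMap (absName b) (Δ.set b e) (Δ.push e) := by
  refine ⟨GMap.abs_set e, ?_, ?_⟩
  · rintro (_ | n) a h
    · exact ⟨b, by simpa [Ctx.set_apply] using h, by simp [absName]⟩
    · have hn : n ≠ b := by rintro rfl; simp [hb] at h
      exact ⟨n, by simpa [Ctx.set_apply, hn] using h, by simp [absName, hn]⟩
  · intro n n' _ _ h
    unfold absName at h
    split_ifs at h <;> simp_all

theorem Ctx.set_none_eq (h : Δ b = none) : Δ.set b none = Δ := by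
  funext n
  rw [Ctx.set_apply]
  split_ifs with hn
  · rw [hn, h]
  · rfl

theorem LMap.abs (hb : Δ b = none) : LMap (absName b) Δ (Δ.push none) := by
  have := LMap.abs_set hb none
  rwa [Ctx.set_none_eq hb] at this

theorem absName_self (b : ℕ) : absName b b = 0 := if_pos rfl

theorem absName_of_ne {n : ℕ} (h : n ≠ b) : absName b n = n + 1 := if_neg h

theorem flat_nuAt (h : Flat P id B M) (hb : b ∉ B) : Flat (nuAt b P) id (insert b B) M := by
  refine ⟨b, B, hb, rfl, ?_⟩
  rwa [flat_rename, consName_comp_absName]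

theorem Typed.abs_self (h : Typed 𝓡 Ω Γ Δ P y A ω) (hd : Distinct Γ Δ z) :
    Typed 𝓡 Ω (Γ.push none) (Δ.push none) (P.rename (absName y)) 0 A ω := by
  have := h.rename (GMap.abs h.distinct.1) (LMap.abs h.distinct.2.1)
  rw [absName_self] at this
  exact this hd.push_zero

theorem Typed.abs_set {a : Ty × Dom} (h : Typed 𝓡 Ω Γ (Δ.set y (some a)) P z A ω)
    (hΔ : Δ y = none) (hd : Distinct Γ Δ z) :
    Typed 𝓡 Ω (Γ.push none) (Δ.push (some a)) (P.rename (absName y)) (z + 1) A ω := by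
  have hd' := h.distinct
  have hy : Γ y = none := by
    have := hd'.2.2 y
    simp [Ctx.set_apply] at this
    exact this
  have hz : z ≠ y := by
    rintro rfl
    have := hd'.2.1
    simp [Ctx.set_apply] at this
  have := h.rename (GMap.abs hy) (LMap.abs_set hΔ _)
  rw [absName_of_ne hz] at this
  exact this (hd.push _)

theorem Proc.rename_absName (h : y ∉ P.fn) : P.rename (absName y) = P.wk :=
  P.rename_congr fun n hn => absName_of_ne fun e => h (e ▸ hn)

theorem Typed.not_mem_fn (h : Typed 𝓡 Ω Γ Δ P z A ω) (h₁ : Γ y = none) (h₂ : Δ y = none)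
    (h₃ : y ≠ z) : y ∉ P.fn := fun hy => by
  have := h.mem_fn y hy
  tauto

/-- A name in `Bs` is the object of a bound output and is turned back into its restriction. The part
of the continuation that may not use this name does not contain it, by `Typed.mem_fn`, so
abstraction acts on it as the weakening that the typing rule demands. -/
theorem Blk.exists_typed (h : Blk 𝓡 Ω Γ Δ Bs S z A ω) (hd : Distinct Γ Δ z)
    (hf : Fresh Bs Γ Δ z) : ∃ P, Flat P id Bs {S} ∧ Typed 𝓡 Ω Γ Δ P z A ω := by
  have base : ∀ {S : Proc}, S.IsThread → Typed 𝓡 Ω Γ Δ S z A ω →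
      ∃ P, Flat P id ∅ {S} ∧ Typed 𝓡 Ω Γ Δ P z A ω := by
    intro S hS h
    refine ⟨S, (flat_thread hS).2 ⟨rfl, S, ?_, rfl⟩, h⟩
    rw [Proc.rename_id]
    exact hS.refl
  have bound : ∀ {y : ℕ} {S : Proc}, S.IsThread → Typed 𝓡 Ω Γ Δ (nuAt y S) z A ω →
      ∃ P, Flat P id {y} {S} ∧ Typed 𝓡 Ω Γ Δ P z A ω := by
    intro y S hS h
    refine ⟨_, flat_nuAt (B := ∅) ((flat_thread hS).2 ⟨rfl, S, ?_, rfl⟩) (by simp), h⟩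
    rw [Proc.rename_id]
    exact hS.refl
  cases h with
  | fwd => exact base trivial (.id hd)
  | lolliR h => exact base trivial (.lolliR hd h)
  | @lolliL _ Δ₁ Δ₂ P Q _ _ _ x y _ _ _ hx hs ha h₁ h₂ =>
    have hy := hf y (Finset.mem_singleton_self _)
    have hxy : x ≠ y := by rintro rfl; simp [hy.2.1] at hx
    refine bound trivial ?_
    rw [nuAt, Proc.rename, absName_of_ne hxy, absName_self, Proc.rename,
      Proc.rename_absName (h₂.not_mem_fn hy.1 ?_ hy.2.2)]
    · exact .lolliL hd hx hs ha (h₁.abs_self (hd.set_none.mono fun _ => hs.left_none)) h₂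
    · rw [Ctx.set_apply, if_neg hxy.symm]
      exact hs.right_none (Ctx.set_none_none hy.2.1)
  | @tensorR _ Δ₁ Δ₂ P Q _ y _ _ _ hs h₁ h₂ =>
    have hy := hf y (Finset.mem_singleton_self _)
    refine bound trivial ?_
    rw [nuAt, Proc.rename, absName_of_ne hy.2.2.symm, absName_self, Proc.rename,
      Proc.rename_absName (h₂.not_mem_fn hy.1 (hs.right_none hy.2.1) hy.2.2)]
    exact .tensorR hd hs (h₁.abs_self (hd.mono fun _ => hs.left_none)) h₂
  | tensorL hx h => exact base trivial (.tensorL hd hx h)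
  | ampR h => exact base trivial (.ampR hd h)
  | ampL hx h => exact base trivial (.ampL₁ hd hx h)
  | plusR h => exact base trivial (.plusR₁ hd h)
  | plusL hx h => exact base trivial (.plusL hd hx h)
  | @bangR Q _ y _ _ h =>
    have hy := hf y (Finset.mem_singleton_self _)
    refine bound trivial ?_
    have e : Q.rename (lift (absName y)) = Q.wk₁ := by
      refine Q.rename_congr (lift_eqOn fun n hn => absName_of_ne ?_)
      rintro rfl
      exact h.not_mem_fn (y := n + 1) hy.1 rfl (by simp) hn
    rw [nuAt, Proc.rename, absName_of_ne hy.2.2.symm, absName_self, Proc.rename, absName_self, e]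
    exact .bangR hd h
  | bangL hx h => exact base trivial (.bangL hd hx h)
  | @atR _ _ _ y _ _ _ ha haa h =>
    have hy := hf y (Finset.mem_singleton_self _)
    refine bound trivial ?_
    rw [nuAt, Proc.rename, absName_of_ne hy.2.2.symm, absName_self]
    exact .atR hd ha haa (h.abs_self hd)
  | atL hx h => exact base trivial (.atL hd hx h)
  | allR h => exact base trivial (.allR hd h)
  | allL hx ha h => exact base trivial (.allL hd hx ha h)
  | exR ha h => exact base trivial (.exR hd ha h)
  | exL hx h => exact base trivial (.exL hd hx h)
  | @copy _ _ _ _ _ u y _ _ hu ha h =>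
    have hy := hf y (Finset.mem_singleton_self _)
    have huy : u ≠ y := by rintro rfl; simp [hy.1] at hu
    refine bound trivial ?_
    rw [nuAt, Proc.rename, absName_of_ne huy, absName_self]
    exact .copy hd hu ha (h.abs_set hy.2.1 hd)

/-- Each cut becomes a restricted parallel composition, and the conversion rules leave the process
alone. The process obtained is one of many with this flattening; `cong_of_flat` makes the choice
immaterial. -/
theorem OT.exists_typed (h : OT 𝓡 Ω Γ Δ B M z A ω) :
    ∃ P, Flat P id B M ∧ Typed 𝓡 Ω Γ Δ P z A ω := by
  induction h with
  | blk hd hf h => exact h.exists_typed hd hf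
  | zero hd => exact ⟨.zero, ⟨rfl, rfl⟩, .oneR hd⟩
  | oneL hd _ hx _ ih =>
    obtain ⟨P, hP, h⟩ := ih
    exact ⟨P, hP, .oneL hd hx h⟩
  | convL hd _ hx hc _ ih =>
    obtain ⟨P, hP, h⟩ := ih
    exact ⟨P, hP, h.convL hd hx hc⟩
  | convR hd _ hc _ ih =>
    obtain ⟨P, hP, h⟩ := ih
    exact ⟨P, hP, h.convR hc⟩
  | @cut _ _ _ _ x B₁ B₂ M₁ M₂ _ _ _ _ _ hd hf hx hB hs ha haa _ _ ih₁ ih₂ =>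
    obtain ⟨P, hP, h₁⟩ := ih₁
    obtain ⟨Q, hQ, h₂⟩ := ih₂
    have hfx := hf x (Finset.mem_insert_self _ _)
    refine ⟨nuAt x (.par P Q), flat_nuAt ⟨B₁, B₂, M₁, M₂, rfl, rfl, hB, hP, hQ⟩ hx, ?_⟩
    exact .cut hd hs ha haa (h₁.abs_self (hd.mono fun _ => hs.left_none))
      (h₂.abs_set (hs.right_none hfx.2.1) (hd.mono fun _ => hs.right_none))
  | @cutBang _ Δ u B P M _ _ _ _ _ hd hf hu h _ ih =>
    obtain ⟨Q, hQ, h₂⟩ := ih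
    have hfu := hf u (Finset.mem_insert_self _ _)
    refine ⟨nuAt u (.par (.rep u P) Q), flat_nuAt ⟨∅, B, {.rep u P}, M, by simp, rfl, by simp,
      (flat_thread (P := .rep u P) trivial).2 ⟨rfl, _, ?_, rfl⟩, hQ⟩ hu, ?_⟩
    · rw [Proc.rename_id]
      exact .rep (.refl _)
    · have e : P.rename (lift (absName u)) = P.wk₁ := by
        refine P.rename_congr (lift_eqOn fun n hn => absName_of_ne ?_)
        rintro rfl
        exact h.not_mem_fn (y := n + 1) hfu.1 rfl (by simp) hn
      rw [nuAt, Proc.rename, Proc.rename, absName_self, e]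
      refine .cutBang hd h ?_
      have := h₂.rename (GMap.abs_set _) (LMap.abs hfu.2.1)
      rw [absName_of_ne hfu.2.2.symm] at this
      exact this (hd.push_unr _)

/-! ### From typed processes to typed multisets of threads -/

/-- The process `P`, with its free names renamed by `ρ`, can be flattened to a typed multiset of
threads; its restrictions get names in any infinite set of names that are not in use. -/
def Real (𝓡 : Set AccRule) (Ω : AccCtx) (ρ : ℕ → ℕ) (X : Finset ℕ) (Γ Δ : Ctx) (P : Proc) (z : ℕ)
    (A : Ty) (ω : Dom) : Prop :=
  ∀ N : Set ℕ, N.Infinite → (∀ n ∈ N, n ∉ X ∧ Γ n = none ∧ Δ n = none ∧ n ≠ z) →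
    ∃ Bf B M, Flat P ρ Bf M ∧ OT 𝓡 Ω Γ Δ B M z A ω ∧ (Bf : Set ℕ) ⊆ N ∧ (B : Set ℕ) ⊆ N ∪ X

/-- The multiset and its typing are kept; only the names `Bf` of the restrictions change. For this
reason `Bf` and the names `B` bound by the `OT` derivation are separate in `Real`. -/
theorem Real.cong (h : Real 𝓡 Ω ρ X Γ Δ P z A ω) (hc : Cong P Q) :
    Real 𝓡 Ω ρ X Γ Δ Q z A ω := by
  intro N hN hf
  obtain ⟨Bf, B, M, h₁, h₂, h₃, h₄⟩ := h N hN hf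
  obtain ⟨Bf', h₁', h₃'⟩ := hc.flatLE.1 _ _ _ _ hN h₁
  exact ⟨Bf', B, M, h₁', h₂, h₃'.trans (Set.union_subset h₃ subset_rfl), h₄⟩

theorem Real.mono (h : Real 𝓡 Ω ρ X Γ Δ P z A ω) {X' : Finset ℕ} (hX : X ⊆ X') :
    Real 𝓡 Ω ρ X' Γ Δ P z A ω := by
  intro N hN hf
  obtain ⟨Bf, B, M, h₁, h₂, h₃, h₄⟩ := h N hN fun n hn => ⟨fun h => (hf n hn).1 (hX h), (hf n hn).2⟩
  exact ⟨Bf, B, M, h₁, h₂, h₃, h₄.trans (Set.union_subset_union_right _ (by exact_mod_cast hX))⟩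

theorem Real.thread (hP : P.IsThread) (hd : Distinct Γ Δ z)
    (h : Blk 𝓡 Ω Γ Δ ∅ (P.rename ρ) z A ω) : Real 𝓡 Ω ρ ∅ Γ Δ P z A ω := by
  intro N hN hf
  exact ⟨∅, ∅, {P.rename ρ}, (flat_thread hP).2 ⟨rfl, _, (hP.rename ρ).refl, rfl⟩,
    .blk hd (by simp [Fresh]) h, by simp, by simp⟩

theorem Real.bound (hP : P.IsThread) (hd : Distinct Γ Δ z)
    (h : ∀ y, Γ y = none → Δ y = none → y ≠ z →
      Blk 𝓡 Ω Γ Δ {y} (P.rename (consName y ρ)) z A ω) :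
    Real 𝓡 Ω ρ ∅ Γ Δ (.nu P) z A ω := by
  intro N hN hf
  obtain ⟨y, hy⟩ := hN.nonempty
  obtain ⟨-, hy₁, hy₂, hy₃⟩ := hf y hy
  exact ⟨{y}, {y}, {P.rename (consName y ρ)}, ⟨y, ∅, by simp, rfl,
      (flat_thread hP).2 ⟨rfl, _, (hP.rename _).refl, rfl⟩⟩,
    .blk hd (by simp [Fresh, hy₁, hy₂, hy₃]) (h y hy₁ hy₂ hy₃), by simpa using hy,
    by simpa using hy⟩

theorem Real.nu (h : ∀ b, Γ b = none → Δ b = none → b ≠ z →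
    Real 𝓡 Ω (consName b ρ) {b} Γ Δ P z A ω) : Real 𝓡 Ω ρ ∅ Γ Δ (.nu P) z A ω := by
  intro N hN hf
  obtain ⟨b, hb⟩ := hN.nonempty
  obtain ⟨-, hb₁, hb₂, hb₃⟩ := hf b hb
  obtain ⟨Bf, B, M, h₁, h₂, h₃, h₄⟩ := h b hb₁ hb₂ hb₃ (N \ ({b} : Finset ℕ))
    (infinite_sdiff_finset hN _) fun n hn => ⟨fun h => hn.2 h, (hf n hn.1).2⟩
  refine ⟨insert b Bf, B, M, ⟨b, Bf, fun h => ?_, rfl, h₁⟩, h₂, ?_, ?_⟩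
  · exact (h₃ h).2 (by simp)
  · intro n hn
    have := @h₃ n
    simp only [Finset.coe_insert, Set.mem_insert_iff, Finset.mem_coe] at hn this
    rcases hn with rfl | hn
    · exact hb
    · exact (this hn).1
  · intro n hn
    rcases h₄ hn with h | h
    · exact Or.inl h.1
    · simp only [Finset.coe_singleton, Set.mem_singleton_iff] at h
      exact Or.inl (h ▸ hb)

theorem Real.cut (hd : Distinct Γ Δ z) (hf : Fresh (insert x (X₁ ∪ X₂)) Γ Δ z)
    (hx : x ∉ X₁ ∪ X₂) (hX : Disjoint X₁ X₂) (hs : Δ.Split Δ₁ Δ₂) (ha : AccStar 𝓡 Ω ω₁ ω₂)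
    (haa : AccAll 𝓡 Ω ω₂ Δ₁) (h₁ : Real 𝓡 Ω ρ X₁ Γ Δ₁ P x A ω₂)
    (h₂ : Real 𝓡 Ω ρ X₂ Γ (Δ₂.set x (some (A, ω₂))) Q z C ω₁) :
    Real 𝓡 Ω ρ (insert x (X₁ ∪ X₂)) Γ Δ (.par P Q) z C ω₁ := by
  intro N hN hN'
  obtain ⟨Bf₁, B₁, M₁, f₁, o₁, s₁, t₁⟩ := h₁ N hN fun n hn => by
    have := hN' n hn
    have := hs n
    grind
  -- The second premise draws its names from what the first has left over.
  obtain ⟨Bf₂, B₂, M₂, f₂, o₂, s₂, t₂⟩ := h₂ (N \ (Bf₁ ∪ B₁ : Finset ℕ))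
    (infinite_sdiff_finset hN _) fun n hn => by
      have := hN' n hn.1
      have := hs n
      rw [Ctx.set_apply]
      grind
  have t₁' : ∀ b ∈ B₁, b ∈ N ∨ b ∈ X₁ := fun b hb => t₁ hb
  have t₂' : ∀ b ∈ B₂, (b ∈ N ∧ b ∉ Bf₁ ∪ B₁) ∨ b ∈ X₂ := fun b hb => t₂ hb
  have s₂' : ∀ b ∈ Bf₂, b ∈ N ∧ b ∉ Bf₁ ∪ B₁ := fun b hb => s₂ hb
  have hXl : ∀ b ∈ X₁, b ∉ X₂ := fun b h h' => Finset.disjoint_left.1 hX h h'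
  refine ⟨Bf₁ ∪ Bf₂, insert x (B₁ ∪ B₂), M₁ + M₂, ⟨Bf₁, Bf₂, M₁, M₂, rfl, rfl, ?_, f₁, f₂⟩,
    .cut hd ?_ ?_ ?_ hs ha haa o₁ o₂, ?_, ?_⟩
  · rw [Finset.disjoint_left]
    intro b hb hb'
    have := s₂' b hb'
    grind
  · intro b hb
    rcases Finset.mem_insert.1 hb with rfl | hb
    · exact hf _ (Finset.mem_insert_self _ _)
    · have h₁ := t₁' b
      have h₂ := t₂' b
      have h₃ := hN' b
      have h₄ := hf b
      grind
  · intro hb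
    have h₁ := t₁' x
    have h₂ := t₂' x
    have h₃ := hN' x
    grind
  · rw [Finset.disjoint_left]
    intro b hb hb'
    have h₁ := t₁' b
    have h₂ := t₂' b
    have h₃ := hN' b
    have := hXl b
    grind
  · intro b hb
    have := s₂' b
    have := @s₁ b
    simp only [Finset.coe_union, Set.mem_union, Finset.mem_coe] at *
    grind
  · intro b hb
    have h₁ := t₁' b
    have h₂ := t₂' b
    simp only [Finset.coe_insert, Finset.coe_union, Set.mem_union, Set.mem_insert_iff,
      Finset.mem_coe] at *
    grind

theorem Real.cutBang {u : ℕ} (hd : Distinct Γ Δ z) (hf : Fresh (insert u X) Γ Δ z) (hu : u ∉ X)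
    {S : Proc} (hS : S.rename ρ = .rep u P)
    (h₁ : Typed 𝓡 Ω (Γ.push none) Ctx.empty P 0 A ω₁)
    (h₂ : Real 𝓡 Ω ρ X (Γ.set u (some (A, ω₁))) Δ Q z C ω₂) :
    Real 𝓡 Ω ρ (insert u X) Γ Δ (.par S Q) z C ω₂ := by
  intro N hN hN'
  obtain ⟨Bf, B, M, f, o, s, t⟩ := h₂ N hN fun n hn => by
    have := hN' n hn
    rw [Ctx.set_apply]
    grind
  have t' : ∀ b ∈ B, b ∈ N ∨ b ∈ X := fun b hb => t hb
  have hS' : S.IsThread := by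
    cases S <;> simp [Proc.rename] at hS
    trivial
  refine ⟨Bf, insert u B, .rep u P ::ₘ M, ⟨∅, Bf, {.rep u P}, M, by simp, rfl, by simp,
    (flat_thread hS').2 ⟨rfl, _, ?_, rfl⟩, f⟩, .cutBang hd ?_ ?_ h₁ o, s, ?_⟩
  · rw [hS]
    exact .rep (.refl _)
  · intro b hb
    rcases Finset.mem_insert.1 hb with rfl | hb
    · exact hf _ (Finset.mem_insert_self _ _)
    · have h₁ := t' b
      have h₃ := hN' b
      have h₄ := hf b
      grind
  · intro hb
    have h₁ := t' u
    have h₃ := hN' u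
    grind
  · intro b hb
    have h₁ := t' b
    simp only [Finset.coe_insert, Set.mem_union, Set.mem_insert_iff, Finset.mem_coe] at *
    grind

theorem Real.oneL (hd : Distinct Γ Δ z) (hx : Δ x = some (.one, ω₂))
    (h : Real 𝓡 Ω ρ ∅ Γ (Δ.set x none) P z C ω₁) : Real 𝓡 Ω ρ ∅ Γ Δ P z C ω₁ := by
  intro N hN hN'
  obtain ⟨Bf, B, M, f, o, s, t⟩ := h N hN fun n hn =>
    ⟨by simp, (hN' n hn).2.1, Ctx.set_none_none (hN' n hn).2.2.1, (hN' n hn).2.2.2⟩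
  refine ⟨Bf, B, M, f, .oneL hd (fun b hb => (hN' b ?_).2) hx o, s, t⟩
  simpa using t hb

theorem Real.convL (hd : Distinct Γ Δ z) (hx : Δ x = some (A, ω₂)) (hc : Conv ω₂ A A')
    (h : Real 𝓡 Ω ρ ∅ Γ (Δ.set x (some (A', ω₂))) P z C ω₁) : Real 𝓡 Ω ρ ∅ Γ Δ P z C ω₁ := by
  intro N hN hN'
  obtain ⟨Bf, B, M, f, o, s, t⟩ := h N hN fun n hn => by
    have := hN' n hn
    rw [Ctx.set_apply]
    grind
  refine ⟨Bf, B, M, f, .convL hd (fun b hb => (hN' b ?_).2) hx hc o, s, t⟩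
  simpa using t hb

theorem Real.convR (hc : Conv ω A A') (h : Real 𝓡 Ω ρ ∅ Γ Δ P z A ω) :
    Real 𝓡 Ω ρ ∅ Γ Δ P z A' ω := by
  intro N hN hN'
  obtain ⟨Bf, B, M, f, o, s, t⟩ := h N hN hN'
  exact ⟨Bf, B, M, f, .convR o.distinct o.fresh hc o, s, t⟩

/-- Only cuts and the silent rules recurse. A rule with a prefix becomes a leaf, whose continuation
stays an ordinary typed process. The congruence rule is absorbed by `Real.cong`, so the resulting
derivation no longer contains it. -/
theorem Typed.real (h : Typed 𝓡 Ω Γ Δ P z A ω) : ∀ {ρ : ℕ → ℕ} {Γ' Δ' : Ctx},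
    GMap ρ Γ Γ' → LMap ρ Δ Δ' → Distinct Γ' Δ' (ρ z) → Real 𝓡 Ω ρ ∅ Γ' Δ' P (ρ z) A ω := by
  induction h with
  | cong _ hc ih => intro ρ Γ' Δ' hΓ hΔ hd'; exact (ih hΓ hΔ hd').cong hc
  | id hd =>
    intro ρ Γ' Δ' hΓ hΔ hd'
    obtain rfl := hΔ.eq_single
    exact .thread trivial hd' .fwd
  | oneR hd =>
    intro ρ Γ' Δ' hΓ hΔ hd' N hN _
    obtain rfl := hΔ.eq_empty
    exact ⟨∅, ∅, 0, ⟨rfl, rfl⟩, .zero hd', by simp, by simp⟩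
  | oneL hd hx _ ih =>
    intro ρ Γ' Δ' hΓ hΔ hd'
    exact .oneL hd' (hΔ.map _ _ hx) (ih hΓ (hΔ.set_of_mem (by simp [hx])) hd'.set_none)
  | lolliR hd h _ =>
    intro ρ Γ' Δ' hΓ hΔ hd'
    exact .thread trivial hd' (.lolliR (h.rename (hΓ.lift _) (hΔ.lift _) (hd'.push _)))
  | @lolliL _ _ _ _ _ _ Q _ _ _ x _ _ _ hd hx hs ha h₁ h₂ _ _ =>
    intro ρ Γ' Δ' hΓ hΔ hd'
    obtain ⟨Δ₁', Δ₂', hs', m₁, m₂⟩ :=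
      (hΔ.set_of_mem (x := x) (e := none) (by simp [hx])).split hs
    have d := hd'.set_none (x := ρ x)
    have hn : (Δ'.set (ρ x) none) (ρ x) = none := by simp [Ctx.set_apply]
    refine .bound trivial hd' fun y hy₁ hy₂ hy₃ => ?_
    have hy₄ : Δ₁' y = none := hs'.left_none (Ctx.set_none_none hy₂)
    have := h₁.rename (hΓ.consName y) (m₁.consName_none y)
      ⟨hy₁, hy₄, (d.mono fun _ => hs'.left_none).2.2⟩
    simp only [Proc.rename, Proc.wk_rename_consName, consName_zero, consName_succ]
    exact .lolliL (hΔ.map _ _ hx) hs' (ha.lmap m₁) this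
      (h₂.rename hΓ (m₂.set_of_none (hs'.right_none hn))
        ((d.mono fun _ => hs'.right_none).set_of_fresh
          (by have := hd'.2.2 (ρ x); have := hΔ.map _ _ hx; grind)
          (by have := hd'.2.1; have := hΔ.map _ _ hx; grind)))
  | tensorR hd hs h₁ h₂ _ _ =>
    intro ρ Γ' Δ' hΓ hΔ hd'
    obtain ⟨Δ₁', Δ₂', hs', m₁, m₂⟩ := hΔ.split hs
    refine .bound trivial hd' fun y hy₁ hy₂ hy₃ => ?_
    have := h₁.rename (hΓ.consName y) (m₁.consName_none y)
      ⟨hy₁, hs'.left_none hy₂, (hd'.mono fun _ => hs'.left_none).2.2⟩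
    simp only [Proc.rename, Proc.wk_rename_consName, consName_zero, consName_succ]
    exact .tensorR hs' this (h₂.rename hΓ m₂ (hd'.mono fun _ => hs'.right_none))
  | tensorL hd hx h _ =>
    intro ρ Γ' Δ' hΓ hΔ hd'
    have hx' := hΔ.map _ _ hx
    exact .thread trivial hd' (.tensorL hx' (h.rename (hΓ.lift _)
      ((hΔ.set_of_mem (by simp [hx])).lift _) ((hd'.set_of_mem (by simp [hx'])).push _)))
  | ampR hd h _ =>
    intro ρ Γ' Δ' hΓ hΔ hd'
    exact .thread trivial hd' (.ampR fun l => (h l).rename hΓ hΔ hd')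
  | ampR₂ hd hk _ ih =>
    intro ρ Γ' Δ' hΓ hΔ hd'
    exact .convR (.amp hk _) (ih hΓ hΔ hd')
  | ampL₁ hd hx h _ =>
    intro ρ Γ' Δ' hΓ hΔ hd'
    have hx' := hΔ.map _ _ hx
    exact .thread trivial hd' (.ampL hx'
      (h.rename hΓ (hΔ.set_of_mem (by simp [hx])) (hd'.set_of_mem (by simp [hx']))))
  | ampL₂ hd hk hx _ ih =>
    intro ρ Γ' Δ' hΓ hΔ hd'
    have hx' := hΔ.map _ _ hx
    exact .convL hd' hx' (.amp hk _)
      (ih hΓ (hΔ.set_of_mem (by simp [hx])) (hd'.set_of_mem (by simp [hx'])))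
  | plusR₁ hd h _ =>
    intro ρ Γ' Δ' hΓ hΔ hd'
    exact .thread trivial hd' (.plusR (h.rename hΓ hΔ hd'))
  | plusR₂ hd hk _ ih =>
    intro ρ Γ' Δ' hΓ hΔ hd'
    exact .convR (.plus hk _) (ih hΓ hΔ hd')
  | plusL hd hx h _ =>
    intro ρ Γ' Δ' hΓ hΔ hd'
    have hx' := hΔ.map _ _ hx
    exact .thread trivial hd' (.plusL hx' fun l =>
      (h l).rename hΓ (hΔ.set_of_mem (by simp [hx])) (hd'.set_of_mem (by simp [hx'])))
  | plusL₂ hd hk hx _ ih =>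
    intro ρ Γ' Δ' hΓ hΔ hd'
    have hx' := hΔ.map _ _ hx
    exact .convL hd' hx' (.plus hk _)
      (ih hΓ (hΔ.set_of_mem (by simp [hx])) (hd'.set_of_mem (by simp [hx'])))
  | bangR hd h _ =>
    intro ρ Γ' Δ' hΓ hΔ hd'
    obtain rfl := hΔ.eq_empty
    refine .bound trivial hd' fun y hy₁ hy₂ hy₃ => ?_
    simp only [Proc.rename, Proc.wk₁_rename_consName, consName_zero, consName_succ]
    exact .bangR (h.rename (hΓ.lift _) (LMap.empty _) ⟨rfl, rfl, fun _ => Or.inr rfl⟩)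
  | bangL hd hx h _ =>
    intro ρ Γ' Δ' hΓ hΔ hd'
    exact .thread trivial hd' (.bangL (hΔ.map _ _ hx) (h.rename (hΓ.lift _)
      ((hΔ.set_of_mem (by simp [hx])).lift _) (hd'.set_none.push_unr _)))
  | atR hd ha haa h _ =>
    intro ρ Γ' Δ' hΓ hΔ hd'
    refine .bound trivial hd' fun y hy₁ hy₂ hy₃ => ?_
    have := h.rename (hΓ.consName y) (hΔ.consName_none y) ⟨hy₁, hy₂, hd'.2.2⟩
    exact .atR ha (haa.lmap hΔ) this
  | atL hd hx h _ =>
    intro ρ Γ' Δ' hΓ hΔ hd'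
    exact .thread trivial hd' (.atL (hΔ.map _ _ hx) (h.rename (hΓ.lift _)
      ((hΔ.set_of_mem (by simp [hx])).lift _) (hd'.set_none.push _)))
  | allR hd h _ =>
    intro ρ Γ' Δ' hΓ hΔ hd'
    exact .thread trivial hd' (.allR (h.rename hΓ.dwk hΔ.dwk hd'.dwk))
  | allL hd hx ha h _ =>
    intro ρ Γ' Δ' hΓ hΔ hd'
    have hx' := hΔ.map _ _ hx
    exact .thread trivial hd' (.allL hx' ha
      (h.rename hΓ (hΔ.set_of_mem (by simp [hx])) (hd'.set_of_mem (by simp [hx']))))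
  | exR hd ha h _ =>
    intro ρ Γ' Δ' hΓ hΔ hd'
    exact .thread trivial hd' (.exR ha (h.rename hΓ hΔ hd'))
  | exL hd hx h _ =>
    intro ρ Γ' Δ' hΓ hΔ hd'
    have hx' := hΔ.map _ _ hx
    exact .thread trivial hd' (.exL hx' (h.rename hΓ.dwk
      (hΔ.dwk.set_of_mem (by simp [Ctx.dwk_apply, hx]))
      (hd'.dwk.set_of_mem (by simp [Ctx.dwk_apply, hx']))))
  | hereR hd _ ih =>
    intro ρ Γ' Δ' hΓ hΔ hd'
    exact .convR (.hereR _) (ih hΓ hΔ hd')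
  | hereL hd hx _ ih =>
    intro ρ Γ' Δ' hΓ hΔ hd'
    have hx' := hΔ.map _ _ hx
    exact .convL hd' hx' (.hereL _)
      (ih hΓ (hΔ.set_of_mem (by simp [hx])) (hd'.set_of_mem (by simp [hx'])))
  | copy hd hu ha h _ =>
    intro ρ Γ' Δ' hΓ hΔ hd'
    refine .bound trivial hd' fun y hy₁ hy₂ hy₃ => ?_
    exact .copy (hΓ _ _ hu) ha
      (h.rename (hΓ.consName y) (hΔ.consName hy₂ _) (hd'.set_of_fresh hy₁ hy₃))
  | cut hd hs ha haa _ _ ih₁ ih₂ =>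
    intro ρ Γ' Δ' hΓ hΔ hd'
    obtain ⟨Δ₁', Δ₂', hs', m₁, m₂⟩ := hΔ.split hs
    refine .nu fun b hb₁ hb₂ hb₃ => ?_
    have h₁ := ih₁ (hΓ.consName b) (m₁.consName_none b)
      ⟨hb₁, hs'.left_none hb₂, (hd'.mono fun _ => hs'.left_none).2.2⟩
    have h₂ := ih₂ (hΓ.consName b) (m₂.consName (hs'.right_none hb₂) _)
      ((hd'.mono fun _ => hs'.right_none).set_of_fresh hb₁ hb₃)
    exact Real.cut (X₁ := ∅) (X₂ := ∅) hd' (by simp [Fresh, hb₁, hb₂, hb₃]) (by simp) (by simp)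
      hs' ha (haa.lmap m₁) h₁ h₂
  | @cutBang _ _ _ P _ _ _ _ _ _ hd h _ _ ih =>
    intro ρ Γ' Δ' hΓ hΔ hd'
    refine .nu fun b hb₁ hb₂ hb₃ => ?_
    have h₁ := h.rename (hΓ.lift none) (LMap.empty _) ⟨rfl, rfl, fun _ => Or.inr rfl⟩
    refine Real.cutBang (X := ∅) hd' (by simp [Fresh, hb₁, hb₂, hb₃]) (by simp) ?_ h₁
      (ih (ρ := consName b ρ) ?_ (hΔ.consName_none b) ⟨?_, hd'.2.1, fun n => ?_⟩)
    · simp only [Proc.rename, consName_zero, Proc.wk₁_rename_consName]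
    · rintro (_ | n) e hn
      · simpa [Ctx.set_apply] using hn
      · have := hΓ n e hn
        have hne : ρ n ≠ b := by rintro rfl; simp [hb₁] at this
        simpa [Ctx.set_apply, hne] using this
    · have := hd'.1
      rw [Ctx.set_apply]
      simp only [consName_succ]
      grind
    · have := hd'.2.2 n
      rw [Ctx.set_apply]
      grind

end

/-! ### Free names and contexts of a single thread -/

section

variable {𝓡 : Set AccRule} {Ω : AccCtx} {Γ Γ' Δ Δ' Δ₁ Δ₂ : Ctx} {P Q S : Proc} {z z' x y b : ℕ}
  {A A' C C' : Ty} {ω ω' ω₁ ω₂ : Dom} {B Bs B₀ : Finset ℕ} {M M₀ : Multiset Proc}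

theorem OT.mem_fn (h : OT 𝓡 Ω Γ Δ B M z A ω) {n : ℕ} (hS : S ∈ M) (hn : n ∈ S.fn) :
    Γ n ≠ none ∨ Δ n ≠ none ∨ n = z ∨ n ∈ B := by
  obtain ⟨P, hP, ht⟩ := h.exists_typed
  rcases hP.mem_fn _ S hS n hn with h | ⟨m, hm, rfl⟩
  · exact Or.inr (Or.inr (Or.inr h))
  · have := ht.mem_fn m hm
    simp only [id]
    tauto

/-- No leaf rule types a replicated input, so a replicated input in a typed multiset was introduced
by a `cut!` on its subject. -/
theorem OT.rep_mem {u : ℕ} (h : OT 𝓡 Ω Γ Δ B M z A ω) (hS : .rep u P ∈ M) : u ∈ B := by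
  induction h with
  | blk _ _ h =>
    obtain rfl := Multiset.mem_singleton.1 hS
    cases h
  | zero => simp at hS
  | oneL _ _ _ _ ih | convL _ _ _ _ _ ih | convR _ _ _ _ ih => exact ih hS
  | cut _ _ _ _ _ _ _ _ _ ih₁ ih₂ =>
    rcases Multiset.mem_add.1 hS with h | h
    · have := ih₁ h; simp [this]
    · have := ih₂ h; simp [this]
  | cutBang _ _ _ _ _ ih =>
    rcases Multiset.mem_cons.1 hS with h | h
    · cases h; exact Finset.mem_insert_self _ _
    · exact Finset.mem_insert_of_mem (ih h)

end

/-- The thread `S` of the typed multiset `M` is typed by the sequent `Γ' ; Δ' ⊢ z':C'[ω']`, and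
can be replaced by other threads with the same offered session, which use the sessions in `D`
instead of the session `x`. -/
structure UserHole (𝓡 : Set AccRule) (Ω : AccCtx) (Γ Δ : Ctx) (B : Finset ℕ) (M : Multiset Proc)
    (z : ℕ) (C : Ty) (ω : Dom) (S : Proc) (M₀ : Multiset Proc) (Γ' Δ' : Ctx) (B₀ Bs : Finset ℕ)
    (z' : ℕ) (C' : Ty) (ω' : Dom) : Prop where
  threads : M = S ::ₘ M₀
  names : B = B₀ ∪ Bs
  disj : Disjoint B₀ Bs
  blk : Blk 𝓡 Ω Γ' Δ' Bs S z' C' ω'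
  dist : Distinct Γ' Δ' z'
  fresh : Fresh Bs Γ' Δ' z'
  unr : ∀ n e, Γ n = some e → Γ' n = some e
  unr_mem : ∀ n, Γ' n ≠ none → Γ n ≠ none ∨ n ∈ B₀
  lin : ∀ n A₀ ω₂, n ∉ B₀ → Δ' n = some (A₀, ω₂) → ∃ A, Δ n = some (A, ω₂) ∧ Le ω₂ A A₀
  root : z' = z ∨ z' ∈ B₀
  acc : AccStar 𝓡 Ω ω ω'
  acc_lin : ∀ n A₀ ω₂, n ∉ B₀ → Δ' n = some (A₀, ω₂) → AccStar 𝓡 Ω ω ω₂ → AccStar 𝓡 Ω ω' ω₂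
  plug : ∀ x D ΔT Δn BT MT, x ∉ B₀ → (Δ x ≠ none → Δ' x ≠ none) →
    ΔT.Split (Δ'.set x none) D → Δn.Split (Δ.set x none) D → AccAll 𝓡 Ω ω' D →
    Disjoint B₀ BT → Distinct Γ Δn z → Fresh (B₀ ∪ BT) Γ Δn z →
    OT 𝓡 Ω Γ' ΔT BT MT z' C' ω' → OT 𝓡 Ω Γ Δn (B₀ ∪ BT) (M₀ + MT) z C ω

/-- The thread `S` of the typed multiset `M` is typed by the sequent `Γ' ; Δ' ⊢ z:C'[ω]` for the
session `z` that `M` offers, and can be replaced by other threads which use the sessions in `Δ'`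
and `D` and offer any session. -/
structure ProvHole (𝓡 : Set AccRule) (Ω : AccCtx) (Γ Δ : Ctx) (B : Finset ℕ) (M : Multiset Proc)
    (z : ℕ) (C : Ty) (ω : Dom) (S : Proc) (M₀ : Multiset Proc) (Γ' Δ' : Ctx) (B₀ Bs : Finset ℕ)
    (C' : Ty) : Prop where
  threads : M = S ::ₘ M₀
  names : B = B₀ ∪ Bs
  disj : Disjoint B₀ Bs
  blk : Blk 𝓡 Ω Γ' Δ' Bs S z C' ω
  dist : Distinct Γ' Δ' z
  fresh : Fresh Bs Γ' Δ' z
  unr : ∀ n e, Γ n = some e → Γ' n = some e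
  unr_mem : ∀ n, Γ' n ≠ none → Γ n ≠ none ∨ n ∈ B₀
  lin : ∀ n, Δ' n ≠ none → Δ n ≠ none ∨ n ∈ B₀
  le : Le ω C' C
  acc : AccAll 𝓡 Ω ω Δ → AccAll 𝓡 Ω ω Δ'
  plug : ∀ D ΔT Δn BT MT zT CT ωT, ΔT.Split Δ' D → Δn.Split Δ D → AccAll 𝓡 Ω ω Δ →
    AccStar 𝓡 Ω ωT ω → Disjoint B₀ BT → Distinct Γ Δn zT → Fresh (B₀ ∪ BT) Γ Δn zT →
    OT 𝓡 Ω Γ' ΔT BT MT zT CT ωT → OT 𝓡 Ω Γ Δn (B₀ ∪ BT) (M₀ + MT) zT CT ωT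

section

variable {𝓡 : Set AccRule} {Ω : AccCtx} {Γ Γ' Δ Δ' Δ₁ Δ₂ : Ctx} {P Q S : Proc} {z z' x y b : ℕ}
  {A A' C C' : Ty} {ω ω' ω₁ ω₂ : Dom} {B Bs B₀ : Finset ℕ} {M M₀ : Multiset Proc}

theorem Ctx.Split.unique (h : Δ.Split Δ₁ Δ₂) (h' : Δ'.Split Δ₁ Δ₂) : Δ = Δ' := by
  funext n
  have := h n
  have := h' n
  grind

/-- The union of two environments. -/
def Ctx.join (Δ D : Ctx) : Ctx := fun n => (D n).or (Δ n)

theorem Ctx.join_apply (Δ D : Ctx) (n : ℕ) :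
    Δ.join D n = if D n = none then Δ n else D n := by
  unfold Ctx.join
  rcases D n with _ | a <;> simp

/-- Follow the path from the root of the derivation to the leaf of `S`. Every linear session of the
leaf is either the name of a cut on this path or comes from `Δ`, with its type changed only by
conversions. In a right premise the root domain stays the same. In a left premise it becomes the
domain of the cut, from which the sessions of that premise are accessible by the side condition;
this gives `acc_lin`. Refilling the leaf repeats the same inferences, with `D` in place of `x` in
all environments between. -/
theorem OT.userHole (h : OT 𝓡 Ω Γ Δ B M z C ω) (hS : S ∈ M) (hr : ∀ u P, S ≠ .rep u P) :
    ∃ M₀ Γ' Δ' B₀ Bs z' C' ω', UserHole 𝓡 Ω Γ Δ B M z C ω S M₀ Γ' Δ' B₀ Bs z' C' ω' := by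
  induction h with
  | @blk Γ Δ B _ z A ω hd hf h =>
    obtain rfl := Multiset.mem_singleton.1 hS
    refine ⟨0, Γ, Δ, ∅, B, z, A, ω, rfl, by simp, by simp, h, hd, hf, fun _ _ h => h,
      fun _ h => Or.inl h, fun n A₀ ω₂ _ h => ⟨A₀, h, .refl⟩, Or.inl rfl, .refl,
      fun _ _ _ _ _ h => h, ?_⟩
    intro x D ΔT Δn BT MT _ _ hT hn _ _ _ _ h
    obtain rfl := hT.unique hn
    simpa using h
  | zero => simp at hS
  | @oneL Γ Δ B M z C ω₁ x₀ ω₂ hd hf hx _ ih =>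
    obtain ⟨M₀, Γ', Δ', B₀, Bs, z', C', ω', H⟩ := ih hS
    refine ⟨M₀, Γ', Δ', B₀, Bs, z', C', ω', H.threads, H.names, H.disj, H.blk, H.dist, H.fresh,
      H.unr, H.unr_mem, ?_, H.root, H.acc, H.acc_lin, ?_⟩
    · intro n A₀ ω₃ hn hn'
      obtain ⟨A, hA, hle⟩ := H.lin n A₀ ω₃ hn hn'
      refine ⟨A, ?_, hle⟩
      rw [Ctx.set_apply] at hA
      grind
    · intro x D ΔT Δn BT MT hxB hx' hT hn haa hdj hd' hf' h
      -- A session that `1L` discards does not reach the leaf, so it is not the one to be replaced.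
      have hne : x ≠ x₀ := by
        rintro rfl
        obtain ⟨⟨A, ω₃⟩, h'⟩ := Option.ne_none_iff_exists'.1 (hx' (by simp [hx]))
        obtain ⟨A', hA', -⟩ := H.lin x A ω₃ hxB h'
        simp [Ctx.set_apply] at hA'
      have hnx : Δn x₀ = some (.one, ω₂) := by
        have := hn x₀
        simp only [Ctx.set_apply] at this
        grind
      refine .oneL hd' hf' hnx (H.plug x D ΔT _ BT MT hxB (fun h => hx' fun h' => ?_) hT ?_ haa
        hdj hd'.set_none (hf'.mono subset_rfl fun _ => Ctx.set_none_none) h)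
      · rw [Ctx.set_apply] at h
        grind
      · intro n
        have := hn n
        simp only [Ctx.set_apply] at this ⊢
        grind
  | @convL Γ Δ B M z C ω₁ x₀ A A' ω₂ hd hf hx hc _ ih =>
    obtain ⟨M₀, Γ', Δ', B₀, Bs, z', C', ω', H⟩ := ih hS
    refine ⟨M₀, Γ', Δ', B₀, Bs, z', C', ω', H.threads, H.names, H.disj, H.blk, H.dist, H.fresh,
      H.unr, H.unr_mem, ?_, H.root, H.acc, H.acc_lin, ?_⟩
    · intro n A₀ ω₃ hn hn'
      obtain ⟨A₁, hA, hle⟩ := H.lin n A₀ ω₃ hn hn'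
      rw [Ctx.set_apply] at hA
      split_ifs at hA with h
      · subst h
        cases hA
        exact ⟨A, hx, Relation.ReflTransGen.head hc hle⟩
      · exact ⟨A₁, hA, hle⟩
    · intro x D ΔT Δn BT MT hxB hx' hT hn haa hdj hd' hf' h
      have hx'' : Δ.set x₀ (some (A', ω₂)) x ≠ none → Δ' x ≠ none := by
        intro h
        refine hx' ?_
        rw [Ctx.set_apply] at h
        grind
      -- If the converted session is the one given up, the conversion disappears together with it;
      -- otherwise it is repeated below the refilled derivation.
      rcases eq_or_ne x x₀ with rfl | hne
      · refine H.plug x D ΔT _ BT MT hxB hx'' hT ?_ haa hdj hd' hf' h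
        intro n
        have := hn n
        simp only [Ctx.set_apply] at this ⊢
        grind
      · have hnx : Δn x₀ = some (A, ω₂) := by
          have := hn x₀
          simp only [Ctx.set_apply] at this
          grind
        refine .convL hd' hf' hnx hc (H.plug x D ΔT _ BT MT hxB hx'' hT ?_ haa
          hdj (hd'.set_of_mem (by simp [hnx])) ?_ h)
        · intro n
          have := hn n
          simp only [Ctx.set_apply] at this ⊢
          grind
        · intro b hb
          have := hf' b hb
          rw [Ctx.set_apply]
          grind
  | convR hd hf hc _ ih =>
    obtain ⟨M₀, Γ', Δ', B₀, Bs, z', C', ω', H⟩ := ih hS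
    refine ⟨M₀, Γ', Δ', B₀, Bs, z', C', ω', H.threads, H.names, H.disj, H.blk, H.dist, H.fresh,
      H.unr, H.unr_mem, H.lin, H.root, H.acc, H.acc_lin, ?_⟩
    intro x D ΔT Δn BT MT hxB hx' hT hn haa hdj hd' hf' h
    exact .convR hd' hf' hc (H.plug x D ΔT Δn BT MT hxB hx' hT hn haa hdj hd' hf' h)
  | @cut Γ Δ Δ₁ Δ₂ w B₁ B₂ M₁ M₂ z C ω₁ A ω₂ hd hf hw hB hs ha haa o₁ o₂ ih₁ ih₂ =>
    have hBl : ∀ b ∈ B₁, b ∉ B₂ := fun b h h' => Finset.disjoint_left.1 hB h h'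
    have f₁ := o₁.fresh
    have f₂ := o₂.fresh
    rcases Multiset.mem_add.1 hS with hS | hS
    · obtain ⟨M₀, Γ', Δ', B₀, Bs, z', C', ω', H⟩ := ih₁ hS
      have hN := H.names
      have hdl : ∀ b ∈ B₀, b ∉ Bs := fun b h h' => Finset.disjoint_left.1 H.disj h h'
      subst hN
      have hlin : ∀ n A₀ ω₃, n ∉ insert w (B₀ ∪ B₂) → Δ' n = some (A₀, ω₃) →
          ∃ A, Δ₁ n = some (A, ω₃) ∧ Δ n = some (A, ω₃) ∧ Le ω₃ A A₀ := by
        intro n A₀ ω₃ hn hn'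
        obtain ⟨A₁, hA, hle⟩ := H.lin n A₀ ω₃ (by grind) hn'
        refine ⟨A₁, hA, ?_, hle⟩
        have := hs n
        grind
      refine ⟨M₀ + M₂, Γ', Δ', insert w (B₀ ∪ B₂), Bs, z', C', ω', ?_, ?_, ?_, H.blk, H.dist,
        H.fresh, H.unr, ?_, ?_, ?_, ha.trans H.acc, ?_, ?_⟩
      · rw [H.threads, Multiset.cons_add]
      · ext b; grind
      · rw [Finset.disjoint_left]
        intro b hb
        grind
      · intro n hn
        have := H.unr_mem n hn
        grind
      · intro n A₀ ω₃ hn hn'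
        obtain ⟨A₁, -, h₂, h₃⟩ := hlin n A₀ ω₃ hn hn'
        exact ⟨A₁, h₂, h₃⟩
      · have := H.root
        grind
      · intro n A₀ ω₃ hn hn' _
        obtain ⟨A₁, h₁, -, -⟩ := hlin n A₀ ω₃ hn hn'
        -- Here accessibility starts afresh from the domain of the cut, by its condition `ω₂ ≺* Δ₁`.
        exact H.acc_lin n A₀ ω₃ (by grind) hn' (haa n A₁ ω₃ h₁)
      · intro x D ΔT Δn BT MT hxB hx' hT hn haaD hdj hd' hf' h
        have hdj' : ∀ b ∈ insert w (B₀ ∪ B₂), b ∉ BT := fun b h h' =>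
          Finset.disjoint_left.1 hdj h h'
        have hx₁ : Δ x ≠ none → Δ₁ x ≠ none := by
          intro h
          obtain ⟨⟨A, ω₃⟩, h'⟩ := Option.ne_none_iff_exists'.1 (hx' h)
          obtain ⟨A', hA', -⟩ := hlin x A ω₃ hxB h'
          simp [hA']
        have hn₁ : ((Δ₁.set x none).join D).Split (Δ₁.set x none) D := by
          intro n
          have h₂ := hs n
          have h₁ := hn n
          clear hn hs ih₁ ih₂ o₁ o₂ H h hlin
          simp only [Ctx.set_apply] at h₁
          simp only [Ctx.join_apply, Ctx.set_apply]
          grind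
        have hn₂ : Δn.Split ((Δ₁.set x none).join D) Δ₂ := by
          intro n
          have h₂ := hs n
          have h₁ := hn n
          clear hn hs ih₁ ih₂ o₁ o₂ H h hlin
          simp only [Ctx.set_apply] at h₁
          simp only [Ctx.join_apply, Ctx.set_apply]
          grind
        have hwf := hf' w (by simp)
        have e₁ : insert w (B₀ ∪ B₂) ∪ BT = insert w ((B₀ ∪ BT) ∪ B₂) := by
          ext b; grind
        have e₂ : M₀ + M₂ + MT = M₀ + MT + M₂ := add_right_comm _ _ _
        rw [e₁] at hf' ⊢
        rw [e₂]
        refine .cut hd' hf' ?_ ?_ hn₂ ha ?_ (H.plug x D ΔT _ BT MT (by grind) ?_ hT hn₁ haaD ?_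
          ?_ ?_ h) o₂
        · have := hdj' w
          grind
        · rw [Finset.disjoint_left]
          intro b hb
          have := hdj' b
          grind
        · intro n A₁ ω₃ h
          rw [Ctx.join_apply, Ctx.set_apply] at h
          split_ifs at h with h₁ h₂
          · exact haa n A₁ ω₃ h
          -- The sessions in `D` are new in the left premise: `ω₂ ≺* ω'` along the path, and `ω' ≺*
          -- D` by assumption.
          · exact H.acc.trans (haaD n A₁ ω₃ h)
        · intro h
          refine hx' ?_
          have := hs x
          grind
        · rw [Finset.disjoint_left]
          intro b hb
          have := hdj' b
          grind
        · exact ⟨hwf.1, hn₂.left_none hwf.2.1, (hd'.mono fun _ => hn₂.left_none).2.2⟩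
        · intro b hb
          have h₁ := hf' b (by grind)
          refine ⟨h₁.1, hn₂.left_none h₁.2.1, ?_⟩
          rintro rfl
          have := hdj' b
          grind
    · obtain ⟨M₀, Γ', Δ', B₀, Bs, z', C', ω', H⟩ := ih₂ hS
      have hN := H.names
      have hdl : ∀ b ∈ B₀, b ∉ Bs := fun b h h' => Finset.disjoint_left.1 H.disj h h'
      subst hN
      have hlin : ∀ n A₀ ω₃, n ∉ insert w (B₁ ∪ B₀) → Δ' n = some (A₀, ω₃) →
          ∃ A, Δ₂ n = some (A, ω₃) ∧ Δ n = some (A, ω₃) ∧ Le ω₃ A A₀ := by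
        intro n A₀ ω₃ hn hn'
        obtain ⟨A₁, hA, hle⟩ := H.lin n A₀ ω₃ (by grind) hn'
        rw [Ctx.set_apply, if_neg (by grind)] at hA
        refine ⟨A₁, hA, ?_, hle⟩
        have := hs n
        grind
      refine ⟨M₁ + M₀, Γ', Δ', insert w (B₁ ∪ B₀), Bs, z', C', ω', ?_, ?_, ?_, H.blk, H.dist,
        H.fresh, H.unr, ?_, ?_, ?_, H.acc, ?_, ?_⟩
      · rw [H.threads, Multiset.add_cons]
      · ext b; grind
      · rw [Finset.disjoint_left]
        intro b hb
        grind
      · intro n hn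
        have := H.unr_mem n hn
        grind
      · intro n A₀ ω₃ hn hn'
        obtain ⟨A₁, -, h₂, h₃⟩ := hlin n A₀ ω₃ hn hn'
        exact ⟨A₁, h₂, h₃⟩
      · have := H.root
        grind
      · intro n A₀ ω₃ hn hn'
        exact H.acc_lin n A₀ ω₃ (by grind) hn'
      · intro x D ΔT Δn BT MT hxB hx' hT hn haaD hdj hd' hf' h
        have hdj' : ∀ b ∈ insert w (B₁ ∪ B₀), b ∉ BT := fun b h h' =>
          Finset.disjoint_left.1 hdj h h'
        have hx₁ : Δ x ≠ none → Δ₂ x ≠ none := by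
          intro h
          obtain ⟨⟨A, ω₃⟩, h'⟩ := Option.ne_none_iff_exists'.1 (hx' h)
          obtain ⟨A', hA', -⟩ := hlin x A ω₃ hxB h'
          simp [hA']
        have hwf := hf' w (by simp)
        have hwx : x ≠ w := by rintro rfl; simp at hxB
        have hn₁ : (((Δ₂.set x none).join D).set w (some (A, ω₂))).Split
            ((Δ₂.set w (some (A, ω₂))).set x none) D := by
          intro n
          have h₂ := hs n
          have h₁ := hn n
          clear hn hs ih₁ ih₂ o₁ o₂ H h hlin
          simp only [Ctx.set_apply] at h₁
          simp only [Ctx.join_apply, Ctx.set_apply]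
          grind
        have hn₂ : Δn.Split Δ₁ ((Δ₂.set x none).join D) := by
          intro n
          have h₂ := hs n
          have h₁ := hn n
          clear hn hs ih₁ ih₂ o₁ o₂ H h hlin
          simp only [Ctx.set_apply] at h₁
          simp only [Ctx.join_apply, Ctx.set_apply]
          grind
        have e₁ : insert w (B₁ ∪ B₀) ∪ BT = insert w (B₁ ∪ (B₀ ∪ BT)) := by
          ext b; grind
        have e₂ : M₁ + M₀ + MT = M₁ + (M₀ + MT) := add_assoc _ _ _
        rw [e₁] at hf' ⊢
        rw [e₂]
        refine .cut hd' hf' ?_ ?_ hn₂ ha haa o₁ (H.plug x D ΔT _ BT MT (by grind) ?_ hT hn₁ haaD ?_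
          ?_ ?_ h)
        · have := hdj' w
          grind
        · rw [Finset.disjoint_left]
          intro b hb
          have := hdj' b
          grind
        · intro h
          refine hx' ?_
          rw [Ctx.set_apply, if_neg hwx] at h
          have := hs x
          grind
        · rw [Finset.disjoint_left]
          intro b hb
          have := hdj' b
          grind
        · exact (hd'.mono fun _ => hn₂.right_none).set_of_fresh hwf.1 hwf.2.2
        · intro b hb
          have h₁ := hf' b (by grind)
          refine ⟨h₁.1, ?_, h₁.2.2⟩
          have h₂ := hn₂.right_none h₁.2.1
          have := hdj' b
          rw [Ctx.set_apply]
          grind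
  | @cutBang Γ Δ u B P M z C ω₂ A ω₁ hd hf hu hP o ih =>
    rcases Multiset.mem_cons.1 hS with rfl | hS
    · exact absurd rfl (hr u P)
    obtain ⟨M₀, Γ', Δ', B₀, Bs, z', C', ω', H⟩ := ih hS
    have hN := H.names
    have hdl : ∀ b ∈ B₀, b ∉ Bs := fun b h h' => Finset.disjoint_left.1 H.disj h h'
    subst hN
    have hfu := hf u (by simp)
    refine ⟨.rep u P ::ₘ M₀, Γ', Δ', insert u B₀, Bs, z', C', ω', ?_, ?_, ?_, H.blk, H.dist,
      H.fresh, ?_, ?_, ?_, ?_, H.acc, ?_, ?_⟩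
    · rw [H.threads, Multiset.cons_swap]
    · ext b; grind
    · rw [Finset.disjoint_left]
      intro b hb
      grind
    · intro n e hn
      refine H.unr n e ?_
      rw [Ctx.set_apply]
      grind
    · intro n hn
      have := H.unr_mem n hn
      rw [Ctx.set_apply] at this
      grind
    · intro n A₀ ω₃ hn
      exact H.lin n A₀ ω₃ (by grind)
    · have := H.root
      grind
    · intro n A₀ ω₃ hn
      exact H.acc_lin n A₀ ω₃ (by grind)
    · intro x D ΔT Δn BT MT hxB hx' hT hn haaD hdj hd' hf' h
      have hdj' : ∀ b ∈ insert u B₀, b ∉ BT := fun b h h' => Finset.disjoint_left.1 hdj h h'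
      have hfu' := hf' u (by simp)
      rw [Finset.insert_union] at hf' ⊢
      rw [Multiset.cons_add]
      refine .cutBang hd' hf' ?_ hP (H.plug x D ΔT Δn BT MT (by grind) hx' hT hn haaD ?_ ?_ ?_ h)
      · have := hdj' u
        grind
      · rw [Finset.disjoint_left]
        intro b hb
        have := hdj' b
        grind
      · obtain ⟨d₁, d₂, d₃⟩ := hd'
        refine ⟨?_, d₂, fun n => ?_⟩
        · rw [Ctx.set_apply]
          grind
        · have := d₃ n
          rw [Ctx.set_apply]
          grind
      · intro b hb
        have h₁ := hf' b (by grind)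
        have := hdj' b
        rw [Ctx.set_apply]
        grind

end

section

variable {𝓡 : Set AccRule} {Ω : AccCtx} {Γ Γ' Δ Δ' Δ₁ Δ₂ : Ctx} {P Q S : Proc} {z z' x y b : ℕ}
  {A A' C C' : Ty} {ω ω' ω₁ ω₂ : Dom} {B Bs B₀ : Finset ℕ} {M M₀ : Multiset Proc}

/-- Since the offered name `z` occurs in `S`, the path to its leaf takes the right premise at every
cut. So the leaf offers `z` in the same domain, at a type changed only by conversions. This makes it
possible to replace the offered session altogether: each cut on the path remains correct when the
root domain is moved to some `ωT` with `ωT ≺* ω`. -/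
theorem OT.provHole (h : OT 𝓡 Ω Γ Δ B M z C ω) (hS : S ∈ M) (hz : z ∈ S.fn)
    (hr : ∀ u P, S ≠ .rep u P) :
    ∃ M₀ Γ' Δ' B₀ Bs C', ProvHole 𝓡 Ω Γ Δ B M z C ω S M₀ Γ' Δ' B₀ Bs C' := by
  induction h with
  | @blk Γ Δ B _ z A ω hd hf h =>
    obtain rfl := Multiset.mem_singleton.1 hS
    refine ⟨0, Γ, Δ, ∅, B, A, rfl, by simp, by simp, h, hd, hf, fun _ _ h => h,
      fun _ h => Or.inl h, fun _ h => Or.inl h, .refl, fun h => h, ?_⟩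
    intro D ΔT Δn BT MT zT CT ωT hT hn _ _ _ _ _ h
    obtain rfl := hT.unique hn
    simpa using h
  | zero => simp at hS
  | @oneL Γ Δ B M z C ω₁ x₀ ω₂ hd hf hx _ ih =>
    obtain ⟨M₀, Γ', Δ', B₀, Bs, C', H⟩ := ih hS hz
    have ha : AccAll 𝓡 Ω ω₁ Δ → AccAll 𝓡 Ω ω₁ (Δ.set x₀ none) := by
      intro h n A ω hn
      rw [Ctx.set_apply] at hn
      split_ifs at hn
      exact h n A ω hn
    refine ⟨M₀, Γ', Δ', B₀, Bs, C', H.threads, H.names, H.disj, H.blk, H.dist, H.fresh,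
      H.unr, H.unr_mem, ?_, H.le, fun h => H.acc (ha h), ?_⟩
    · intro n hn
      refine (H.lin n hn).imp_left fun h => ?_
      rw [Ctx.set_apply] at h
      grind
    · intro D ΔT Δn BT MT zT CT ωT hT hn haa hac hdj hd' hf' h
      have hnx : Δn x₀ = some (.one, ω₂) := by
        have := hn x₀
        grind
      have hDx : D x₀ = none := by
        have := hn x₀
        grind
      refine .oneL hd' hf' hnx (H.plug D ΔT _ BT MT zT CT ωT hT ?_ (ha haa) hac
        hdj hd'.set_none (hf'.mono subset_rfl fun _ => Ctx.set_none_none) h)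
      intro n
      have := hn n
      simp only [Ctx.set_apply]
      grind
  | @convL Γ Δ B M z C ω₁ x₀ A A' ω₂ hd hf hx hc _ ih =>
    obtain ⟨M₀, Γ', Δ', B₀, Bs, C', H⟩ := ih hS hz
    have ha : AccAll 𝓡 Ω ω₁ Δ → AccAll 𝓡 Ω ω₁ (Δ.set x₀ (some (A', ω₂))) := by
      intro h n A₁ ω hn
      rw [Ctx.set_apply] at hn
      split_ifs at hn
      · cases hn
        exact h x₀ A ω₂ hx
      · exact h n A₁ ω hn
    refine ⟨M₀, Γ', Δ', B₀, Bs, C', H.threads, H.names, H.disj, H.blk, H.dist, H.fresh,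
      H.unr, H.unr_mem, ?_, H.le, fun h => H.acc (ha h), ?_⟩
    · intro n hn
      refine (H.lin n hn).imp_left fun h => ?_
      rw [Ctx.set_apply] at h
      grind
    · intro D ΔT Δn BT MT zT CT ωT hT hn haa hac hdj hd' hf' h
      have hnx : Δn x₀ = some (A, ω₂) := by
        have := hn x₀
        grind
      have hDx : D x₀ = none := by
        have := hn x₀
        grind
      refine .convL hd' hf' hnx hc (H.plug D ΔT _ BT MT zT CT ωT hT ?_ (ha haa) hac
        hdj (hd'.set_of_mem (by simp [hnx])) ?_ h)
      · intro n
        have := hn n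
        simp only [Ctx.set_apply]
        grind
      · intro b hb
        have := hf' b hb
        rw [Ctx.set_apply]
        grind
  | convR hd hf hc _ ih =>
    obtain ⟨M₀, Γ', Δ', B₀, Bs, C', H⟩ := ih hS hz
    exact ⟨M₀, Γ', Δ', B₀, Bs, C', H.threads, H.names, H.disj, H.blk, H.dist, H.fresh,
      H.unr, H.unr_mem, H.lin, H.le.tail hc, H.acc, H.plug⟩
  | @cut Γ Δ Δ₁ Δ₂ w B₁ B₂ M₁ M₂ z C ω₁ A ω₂ hd hf hw hB hs ha haa o₁ o₂ ih₁ ih₂ =>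
    have hBl : ∀ b ∈ B₁, b ∉ B₂ := fun b h h' => Finset.disjoint_left.1 hB h h'
    have hwf := hf w (by simp)
    rcases Multiset.mem_add.1 hS with hS | hS
    -- The left premise of a cut neither declares nor binds the offered name `z`, so `z` is free in
    -- none of its threads.
    · exfalso
      rcases o₁.mem_fn hS hz with h | h | h | h
      · exact h hd.1
      · exact h (hs.left_none hd.2.1)
      · exact hwf.2.2 h.symm
      · exact (hf z (by simp [h])).2.2 rfl
    · obtain ⟨M₀, Γ', Δ', B₀, Bs, C', H⟩ := ih₂ hS hz
      have hN := H.names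
      have hdl : ∀ b ∈ B₀, b ∉ Bs := fun b h h' => Finset.disjoint_left.1 H.disj h h'
      subst hN
      have ha' : AccAll 𝓡 Ω ω₁ Δ → AccAll 𝓡 Ω ω₁ (Δ₂.set w (some (A, ω₂))) := by
        intro h n A₁ ω hn
        rw [Ctx.set_apply] at hn
        split_ifs at hn
        · cases hn
          exact ha
        · refine h n A₁ ω ?_
          have := hs n
          grind
      refine ⟨M₁ + M₀, Γ', Δ', insert w (B₁ ∪ B₀), Bs, C', ?_, ?_, ?_, H.blk, H.dist,
        H.fresh, H.unr, ?_, ?_, H.le, fun h => H.acc (ha' h), ?_⟩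
      · rw [H.threads, Multiset.add_cons]
      · ext b; grind
      · rw [Finset.disjoint_left]
        intro b hb
        grind
      · intro n hn
        have := H.unr_mem n hn
        grind
      · intro n hn
        have := H.lin n hn
        rw [Ctx.set_apply] at this
        have := hs n
        grind
      · intro D ΔT Δn BT MT zT CT ωT hT hn haa' hac hdj hd' hf' h
        have hdj' : ∀ b ∈ insert w (B₁ ∪ B₀), b ∉ BT := fun b h h' =>
          Finset.disjoint_left.1 hdj h h'
        have hwf' := hf' w (by simp)
        have hn₁ : (((Δ₂.join D)).set w (some (A, ω₂))).Split (Δ₂.set w (some (A, ω₂))) D := by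
          intro n
          have h₁ := hn n
          have h₂ := hs n
          clear hn hs ih₁ ih₂ o₁ o₂ H h
          simp only [Ctx.join_apply, Ctx.set_apply]
          grind
        have hn₂ : Δn.Split Δ₁ (Δ₂.join D) := by
          intro n
          have h₁ := hn n
          have h₂ := hs n
          clear hn hs ih₁ ih₂ o₁ o₂ H h
          simp only [Ctx.join_apply]
          grind
        have e₁ : insert w (B₁ ∪ B₀) ∪ BT = insert w (B₁ ∪ (B₀ ∪ BT)) := by
          ext b; grind
        have e₂ : M₁ + M₀ + MT = M₁ + (M₀ + MT) := add_assoc _ _ _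
        rw [e₁] at hf' ⊢
        rw [e₂]
        -- The condition of the cut for the new root is `ωT ≺* ω₁ ≺* ω₂`.
        refine .cut hd' hf' ?_ ?_ hn₂ (hac.trans ha) haa o₁ (H.plug D ΔT _ BT MT zT CT ωT hT hn₁
          (ha' haa') hac ?_ ?_ ?_ h)
        · have := hdj' w
          grind
        · rw [Finset.disjoint_left]
          intro b hb
          have := hdj' b
          grind
        · rw [Finset.disjoint_left]
          intro b hb
          have := hdj' b
          grind
        · exact (hd'.mono fun _ => hn₂.right_none).set_of_fresh hwf'.1 hwf'.2.2
        · intro b hb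
          have h₁ := hf' b (by grind)
          refine ⟨h₁.1, ?_, h₁.2.2⟩
          have h₂ := hn₂.right_none h₁.2.1
          have := hdj' b
          rw [Ctx.set_apply]
          grind
  | @cutBang Γ Δ u B P M z C ω₂ A ω₁ hd hf hu hP o ih =>
    rcases Multiset.mem_cons.1 hS with rfl | hS
    · exact absurd rfl (hr u P)
    obtain ⟨M₀, Γ', Δ', B₀, Bs, C', H⟩ := ih hS hz
    have hN := H.names
    have hdl : ∀ b ∈ B₀, b ∉ Bs := fun b h h' => Finset.disjoint_left.1 H.disj h h'
    subst hN
    have hfu := hf u (by simp)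
    refine ⟨.rep u P ::ₘ M₀, Γ', Δ', insert u B₀, Bs, C', ?_, ?_, ?_, H.blk, H.dist,
      H.fresh, ?_, ?_, ?_, H.le, H.acc, ?_⟩
    · rw [H.threads, Multiset.cons_swap]
    · ext b; grind
    · rw [Finset.disjoint_left]
      intro b hb
      grind
    · intro n e hn
      refine H.unr n e ?_
      rw [Ctx.set_apply]
      grind
    · intro n hn
      have := H.unr_mem n hn
      rw [Ctx.set_apply] at this
      grind
    · intro n hn
      have := H.lin n hn
      grind
    · intro D ΔT Δn BT MT zT CT ωT hT hn haa' hac hdj hd' hf' h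
      have hdj' : ∀ b ∈ insert u B₀, b ∉ BT := fun b h h' => Finset.disjoint_left.1 hdj h h'
      have hfu' := hf' u (by simp)
      rw [Finset.insert_union] at hf' ⊢
      rw [Multiset.cons_add]
      refine .cutBang hd' hf' ?_ hP (H.plug D ΔT Δn BT MT zT CT ωT hT hn haa' hac ?_ ?_ ?_ h)
      · have := hdj' u
        grind
      · rw [Finset.disjoint_left]
        intro b hb
        have := hdj' b
        grind
      · obtain ⟨d₁, d₂, d₃⟩ := hd'
        refine ⟨?_, d₂, fun n => ?_⟩
        · rw [Ctx.set_apply]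
          grind
        · have := d₃ n
          rw [Ctx.set_apply]
          grind
      · intro b hb
        have h₁ := hf' b (by grind)
        have := hdj' b
        rw [Ctx.set_apply]
        grind

end

/-! ### Principal cuts of a provider against a user -/

theorem Ctx.set_set (Δ : Ctx) (x : ℕ) (e e' : Option (Ty × Dom)) :
    (Δ.set x e).set x e' = Δ.set x e' := Function.update_idem _ _ _

theorem Ctx.set_comm (Δ : Ctx) {x y : ℕ} (h : x ≠ y) (e e' : Option (Ty × Dom)) :
    (Δ.set x e).set y e' = (Δ.set y e').set x e := Function.update_comm h _ _ _

theorem Ctx.Split.assoc {Δ Δ' Δ₁ Δ₂ E : Ctx} (h : Δ.Split Δ' E) (h' : Δ'.Split Δ₁ Δ₂) :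
    Δ.Split Δ₁ (E.join Δ₂) ∧ (E.join Δ₂).Split Δ₂ E := by
  constructor <;> intro n <;> have h₁ := h n <;> have h₂ := h' n <;> clear h h' <;>
    simp only [Ctx.join_apply] <;> grind

theorem Ctx.Split.set {Δ Δ₁ Δ₂ : Ctx} (h : Δ.Split Δ₁ Δ₂) {y : ℕ} (hy : Δ₁ y = none)
    {e : Option (Ty × Dom)} : (Δ.set y e).Split Δ₁ (Δ₂.set y e) := by
  intro n
  have h₁ := h n
  simp only [Ctx.set_apply]
  grind

theorem Width.amp_inv {I J : Finset ℕ} {A : {l // l ∈ I} → Ty} {A' : {l // l ∈ J} → Ty}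
    (h : Width (.amp I A) (.amp J A')) {l : ℕ} (hI : l ∈ I) (hJ : l ∈ J) :
    A' ⟨l, hJ⟩ = A ⟨l, hI⟩ := by
  cases h with
  | refl => rfl
  | amp _ h => exact h ⟨l, hJ⟩

theorem Width.plus_inv {I J : Finset ℕ} {A : {l // l ∈ I} → Ty} {A' : {l // l ∈ J} → Ty}
    (h : Width (.plus I A) (.plus J A')) {l : ℕ} (hI : l ∈ I) (hJ : l ∈ J) :
    A' ⟨l, hJ⟩ = A ⟨l, hI⟩ := by
  cases h with
  | refl => rfl
  | plus _ h => exact h ⟨l, hI⟩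

theorem instName_eq (y : ℕ) : instName y = consName y id := by
  funext n; cases n <;> rfl

section

variable {𝓡 : Set AccRule} {Ω : AccCtx} {Γ Γ' Δ Δ' Δ₁ Δ₂ Δp Δu : Ctx} {P Q S T Sp Su : Proc}
  {z x y : ℕ} {A A' B C : Ty} {ω ω' ω₁ ω₂ : Dom} {X Xp Xu : Finset ℕ}

theorem Typed.inst {a : Ty × Dom} (h : Typed 𝓡 Ω (Γ.push none) (Δ.push (some a)) P (z + 1) C ω)
    (hΔ : Δ y = none) (hΓ : Γ y = none) (hz : y ≠ z) (hd : Distinct Γ Δ z) :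
    Typed 𝓡 Ω Γ (Δ.set y (some a)) (P.inst y) z C ω := by
  have := h.rename (ρ := instName y) (Γ' := Γ) (Δ' := Δ.set y (some a))
  rw [instName_eq] at this
  rw [Proc.inst, instName_eq]
  exact this ((GMap.id Γ).consName y) ((LMap.id Δ).consName hΔ _) (hd.set_of_fresh hΓ hz)

theorem Typed.inst_unr {a : Ty × Dom} (h : Typed 𝓡 Ω (Γ.push (some a)) (Δ.push none) P (z + 1) C ω)
    (hΔ : Δ y = none) (hΓ : Γ y = none) (hz : y ≠ z) (hd : Distinct Γ Δ z) :
    Typed 𝓡 Ω (Γ.set y (some a)) Δ (P.inst y) z C ω := by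
  have := h.rename (ρ := instName y) (Γ' := Γ.set y (some a)) (Δ' := Δ)
  rw [instName_eq] at this
  rw [Proc.inst, instName_eq]
  refine this ?_ ((LMap.id Δ).consName_none y) ⟨?_, hd.2.1, fun n => ?_⟩
  · rintro (_ | n) e he
    · simpa [Ctx.set_apply] using he
    · have hn : n ≠ y := by
        rintro rfl
        simp [hΓ] at he
      simpa [Ctx.set_apply, hn] using he
  · rw [Ctx.set_apply]
    have := hd.1
    simp only [consName_succ, _root_.id]
    grind
  · rw [Ctx.set_apply]
    have := hd.2.2 n
    grind

theorem Typed.real_id (h : Typed 𝓡 Ω Γ Δ P z C ω) : Real 𝓡 Ω _root_.id ∅ Γ Δ P z C ω :=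
  h.real (GMap.id Γ) (LMap.id Δ) h.distinct

/-- The side conditions of a cut on `x` in the domain `ω₂`; the names in `Xp` and `Xu` belong to
the two sides. -/
structure CutCond (𝓡 : Set AccRule) (Ω : AccCtx) (Γ Δ Δp Δu : Ctx) (Xp Xu : Finset ℕ) (x : ℕ)
    (A : Ty) (ω₂ : Dom) (z : ℕ) (ω₁ : Dom) : Prop where
  dist : Distinct Γ Δ z
  prov_dist : Distinct Γ Δp x
  user_dist : Distinct Γ Δu z
  fresh : Fresh (insert x (Xp ∪ Xu)) Γ Δ z
  not_mem : x ∉ Xp ∪ Xu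
  user : Δu x = some (A, ω₂)
  acc : AccStar 𝓡 Ω ω₁ ω₂
  acc_prov : AccAll 𝓡 Ω ω₂ Δp
  split : Δ.Split Δp (Δu.set x none)

/-- The case in which the session continues on `x` in the same domain. The names of `Xp` and `Xu`
are no longer bound, hence the weaker bound on the names in use. -/
theorem CutCond.cut (H : CutCond 𝓡 Ω Γ Δ Δp Δu Xp Xu x A' ω₂ z ω₁)
    (h₁ : Typed 𝓡 Ω Γ Δp P x A ω₂) (h₂ : Typed 𝓡 Ω Γ (Δu.set x (some (A, ω₂))) Q z C ω₁) :
    Real 𝓡 Ω _root_.id (insert x (Xp ∪ Xu)) Γ Δ (.par P Q) z C ω₁ := by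
  refine (Real.cut (X₁ := ∅) (X₂ := ∅) (x := x) H.dist ?_ (by simp) (by simp) H.split H.acc
    H.acc_prov h₁.real_id ?_).mono ?_
  · exact fun b hb => H.fresh b (by simp at hb; simp [hb])
  · rw [Ctx.set_set]
    exact h₂.real_id
  · intro b hb
    simp at hb
    simp [hb]

/-- One cut on `x` becomes two nested ones: `P` provides `y` outside, `Q` provides `x` inside. Both
are in the domain `ω₂`, so the accessibility conditions are inherited by the parts of `Δp`. -/
theorem CutCond.tensor (H : CutCond 𝓡 Ω Γ Δ Δp Δu {y} ∅ x A' ω₂ z ω₁)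
    (hs : Δp.Split Δ₁ Δ₂) (h₁ : Typed 𝓡 Ω Γ Δ₁ P y A ω₂) (h₂ : Typed 𝓡 Ω Γ Δ₂ Q x B ω₂)
    (h₃ : Typed 𝓡 Ω (Γ.push none) ((Δu.set x (some (B, ω₂))).push (some (A, ω₂))) S (z + 1) C ω₁) :
    Real 𝓡 Ω _root_.id (insert x ({y} ∪ ∅)) Γ Δ (.par (.par P Q) (S.inst y)) z C ω₁ := by
  have hxy : x ≠ y := by simpa using H.not_mem
  have hx := H.fresh x (by simp)
  have hy := H.fresh y (by simp)
  have hu : Δu y = none := by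
    have := H.split.right_none hy.2.1
    rw [Ctx.set_apply] at this
    grind
  refine Real.cong (P := .par P (.par Q (S.inst y))) ?_ (.par_assoc _ _ _)
  obtain ⟨hso, hsi⟩ := H.split.assoc hs
  have hsy := hsi.set (e := some (A, ω₂)) (hsi.left_none (hso.right_none hy.2.1))
  have a₁ : AccAll 𝓡 Ω ω₂ Δ₁ := fun n A ω h => H.acc_prov n A ω (by have := hs n; grind)
  have a₂ : AccAll 𝓡 Ω ω₂ Δ₂ := fun n A ω h => H.acc_prov n A ω (by have := hs n; grind)
  have di : Distinct Γ (((Δu.set x none).join Δ₂).set y (some (A, ω₂))) z :=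
    (H.dist.mono fun _ => hso.right_none).set_of_fresh hy.1 hy.2.2
  have t₃ := h₃.inst (y := y) (by rw [Ctx.set_apply]; grind) hy.1 hy.2.2
    (H.user_dist.set_of_mem (by simp [H.user]))
  refine (Real.cut (X₁ := ∅) (X₂ := insert x (∅ ∪ ∅)) (x := y) H.dist ?_ (by simp [hxy.symm])
    (by simp) hso H.acc a₁ h₁.real_id (Real.cut di ?_ (by simp) (by simp) hsy H.acc
    a₂ h₂.real_id ?_)).mono ?_
  · intro b hb
    refine H.fresh b ?_
    simpa [or_comm] using hb
  · intro b hb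
    obtain rfl : b = x := by simpa using hb
    refine ⟨hx.1, ?_, hx.2.2⟩
    rw [Ctx.set_apply, if_neg hxy]
    exact hso.right_none hx.2.1
  · rw [Ctx.set_comm _ hxy.symm, Ctx.set_set]
    exact t₃.real_id
  · intro b hb
    simpa [or_comm] using hb

/-- The user's `P` provides the argument `y` to the provider's body, and the two together provide
`x` to `Q`. Sessions `Δ₁` that belonged to the user thus move to the provider's side, and the outer
cut requires `ω₂ ≺* Δ₁`; this is exactly the side condition of `⊸L`. -/
theorem CutCond.lolli (H : CutCond 𝓡 Ω Γ Δ Δp Δu ∅ {y} x A' ω₂ z ω₁)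
    (hs : (Δu.set x none).Split Δ₁ Δ₂) (haa : AccAll 𝓡 Ω ω₂ Δ₁) (h₁ : Typed 𝓡 Ω Γ Δ₁ P y A ω₂)
    (h₂ : Typed 𝓡 Ω Γ (Δ₂.set x (some (B, ω₂))) Q z C ω₁)
    (h₃ : Typed 𝓡 Ω (Γ.push none) (Δp.push (some (A, ω₂))) S (x + 1) B ω₂) :
    Real 𝓡 Ω _root_.id (insert x (∅ ∪ {y})) Γ Δ (.par (.par P Q) (S.inst y)) z C ω₁ := by
  have hxy : x ≠ y := by simpa using H.not_mem
  have hx := H.fresh x (by simp)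
  have hy := H.fresh y (by simp)
  have hc : Cong (.par (.par P (S.inst y)) Q) (.par (.par P Q) (S.inst y)) :=
    (Cong.par_assoc _ _ _).symm.trans ((Cong.par (.refl _) (.par_comm _ _)).trans
      (.par_assoc _ _ _))
  refine Real.cong ?_ hc
  obtain ⟨hso', hsi⟩ := H.split.symm.assoc hs.symm
  have hso := hso'.symm
  have di : Distinct Γ (Δp.join Δ₁) x :=
    ⟨hx.1, hso.left_none hx.2.1, fun n => (H.dist.2.2 n).imp_right hso.left_none⟩
  have hyi : (Δp.join Δ₁) y = none := hso.left_none hy.2.1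
  have t₃ := h₃.inst (y := y) (hsi.right_none hyi) hy.1 hxy.symm H.prov_dist
  refine (Real.cut (X₁ := insert y (∅ ∪ ∅)) (X₂ := ∅) (x := x) H.dist ?_ (by simp [hxy])
    (by simp) hso H.acc ?_ (Real.cut di ?_ (by simp) (by simp) hsi .refl haa h₁.real_id t₃.real_id)
    h₂.real_id).mono ?_
  · intro b hb
    refine H.fresh b ?_
    simp at hb ⊢
    tauto
  · intro n A₁ ω₃ hn
    rw [Ctx.join_apply] at hn
    split_ifs at hn
    · exact H.acc_prov n A₁ ω₃ hn
    · exact haa n A₁ ω₃ hn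
  · intro b hb
    obtain rfl : b = y := by simpa using hb
    exact ⟨hy.1, hyi, hxy.symm⟩
  · intro b hb
    simp at hb ⊢
    tauto

theorem Ctx.Split.eq_of_empty (h : Δ.Split Ctx.empty Δ') : Δ = Δ' := by
  funext n
  have := h n
  have : Ctx.empty n = none := rfl
  grind

/-- The linear cut turns into a `cut!`. The rule for offering `!A` has no linear sessions, so all of
`Δ` belongs to the user. -/
theorem CutCond.bang (H : CutCond 𝓡 Ω Γ Δ Ctx.empty Δu {y} ∅ x A' ω₂ z ω₁)
    (h₁ : Typed 𝓡 Ω (Γ.push none) Ctx.empty P 0 A ω₂)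
    (h₂ : Typed 𝓡 Ω (Γ.push (some (A, ω₂))) ((Δu.set x none).push none) S (z + 1) C ω₁) :
    Real 𝓡 Ω _root_.id (insert x ({y} ∪ ∅)) Γ Δ (.par (.rep y P) (S.inst y)) z C ω₁ := by
  have hy := H.fresh y (by simp)
  obtain rfl := H.split.eq_of_empty
  have t := h₂.inst_unr (y := y) hy.2.1 hy.1 hy.2.2 H.dist
  have e : (Proc.rep y P).rename _root_.id = .rep y P := Proc.rename_id _
  refine (Real.cutBang (X := ∅) H.dist ?_ (by simp) e h₁ t.real_id).mono ?_
  · intro b hb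
    refine H.fresh b ?_
    simp at hb ⊢
    tauto
  · intro b hb
    simp at hb ⊢
    tauto

/-- The cut moves to the domain `ω` of the migrated session. Its conditions are `ω₁ ≺* ω₂ ≺ ω` and
`ω ≺* Δp`, and both new ingredients are side conditions of `@R`. The first of them also discharges
the hypothesis under which the user was typed. -/
theorem CutCond.atDom (H : CutCond 𝓡 Ω Γ Δ Δp Δu {y} ∅ x A' ω₂ z ω₁)
    (ha : Acc 𝓡 Ω ω₂ ω) (haa : AccAll 𝓡 Ω ω Δp) (h₁ : Typed 𝓡 Ω Γ Δp P y A ω)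
    (h₂ : Typed 𝓡 ((ω₂, ω) :: Ω) (Γ.push none) ((Δu.set x none).push (some (A, ω))) S (z + 1) C
      ω₁) :
    Real 𝓡 Ω _root_.id (insert x ({y} ∪ ∅)) Γ Δ (.par P (S.inst y)) z C ω₁ := by
  have hy := H.fresh y (by simp)
  have h₂' : Typed 𝓡 Ω (Γ.push none) ((Δu.set x none).push (some (A, ω))) S (z + 1) C ω₁ := by
    refine h₂.of_hyps fun q hq => ?_
    rcases List.mem_cons.1 hq with rfl | hq
    · exact ha
    · exact .whyp hq
  have t := h₂'.inst (y := y) (H.split.right_none hy.2.1) hy.1 hy.2.2 H.user_dist.set_none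
  refine (Real.cut (X₁ := ∅) (X₂ := ∅) (x := y) H.dist ?_ (by simp) (by simp) H.split
    (H.acc.tail ha) haa h₁.real_id t.real_id).mono ?_
  · intro b hb
    refine H.fresh b ?_
    simp at hb ⊢
    tauto
  · intro b hb
    simp at hb ⊢
    tauto

/-- Substitution of an accessible domain for a domain variable of a derivation. -/
theorem Typed.dinst (ha : Acc 𝓡 Ω ω' ω) {A : Ty}
    (h : Typed 𝓡 ((ω'.subst Dom.wk, .var 0) :: Ω.dwk) Γ' Δ' P z A ω₁) :
    Typed 𝓡 Ω (Γ'.dsubst (Dom.single ω)) (Δ'.dsubst (Dom.single ω)) (P.dinst ω) z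
      (A.subst (Dom.single ω)) (ω₁.subst (Dom.single ω)) := by
  have := h.dsubst (Dom.single ω)
  rw [AccCtx.dsubst_cons, AccCtx.dwk_dsubst_single] at this
  refine this.of_hyps fun q hq => ?_
  rcases List.mem_cons.1 hq with rfl | hq
  · rw [Dom.wk_subst_single]
    exact ha
  · exact .whyp hq

/-- The communicated domain is substituted into the user's derivation. All entries except that of
`x` are weakened, so the substitution restores them. -/
theorem CutCond.ex (H : CutCond 𝓡 Ω Γ Δ Δp Δu Xp Xu x A' ω₂ z ω₁) (ha : Acc 𝓡 Ω ω₂ ω)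
    (h₁ : Typed 𝓡 Ω Γ Δp P x (A.subst (Dom.single ω)) ω₂)
    (h₂ : Typed 𝓡 ((ω₂.subst Dom.wk, .var 0) :: Ω.dwk) Γ.dwk
        (Δu.dwk.set x (some (A, ω₂.subst Dom.wk))) Q z (C.subst Dom.wk) (ω₁.subst Dom.wk)) :
    Real 𝓡 Ω _root_.id (insert x (Xp ∪ Xu)) Γ Δ (.par P (Q.dinst ω)) z C ω₁ := by
  refine H.cut h₁ ?_
  have := Typed.dinst ha h₂
  rwa [Ctx.dwk_dsubst_single, Ctx.dsubst_set_some, Ctx.dwk_dsubst_single, Dom.wk_subst_single,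
    Dom.wk_subst_single, Ty.wk_subst_single] at this

theorem CutCond.all (H : CutCond 𝓡 Ω Γ Δ Δp Δu Xp Xu x A' ω₂ z ω₁) (ha : Acc 𝓡 Ω ω₂ ω)
    (h₁ : Typed 𝓡 ((ω₂.subst Dom.wk, .var 0) :: Ω.dwk) Γ.dwk Δp.dwk P x A (ω₂.subst Dom.wk))
    (h₂ : Typed 𝓡 Ω Γ (Δu.set x (some (A.subst (Dom.single ω), ω₂))) Q z C ω₁) :
    Real 𝓡 Ω _root_.id (insert x (Xp ∪ Xu)) Γ Δ (.par Q (P.dinst ω)) z C ω₁ := by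
  have := Typed.dinst ha h₁
  rw [Ctx.dwk_dsubst_single, Ctx.dwk_dsubst_single, Dom.wk_subst_single] at this
  exact (H.cut this h₂).cong (.par_comm _ _)

/-- The two disjuncts of `hI` say whether the provider or the user sends. A prefix with subject `x`
leaves few possible leaf rules; those that treat `x` as unrestricted, as used by the provider or as
offered by the user contradict the sequents. `Le.width` rules out pairs with different head
constructors, and the remaining pairs are the principal cases. -/
theorem CutCond.principal (H : CutCond 𝓡 Ω Γ Δ Δp Δu Xp Xu x A' ω₂ z ω₁)
    (hI : Inter x Sp Su T ∨ Inter x Su Sp T) (hp : Blk 𝓡 Ω Γ Δp Xp Sp x A ω₂)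
    (hu : Blk 𝓡 Ω Γ Δu Xu Su z C ω₁) (hle : Le ω₂ A A') :
    Real 𝓡 Ω _root_.id (insert x (Xp ∪ Xu)) Γ Δ T z C ω₁ := by
  have hxp := H.prov_dist.2.1
  have hxΓ := H.prov_dist.1
  have hxu := H.user
  have hxz : x ≠ z := by
    rintro rfl
    simp [H.user_dist.2.1] at hxu
  have hA : ∀ {A₁ ω₃}, Δu x = some (A₁, ω₃) → A₁ = A' ∧ ω₃ = ω₂ := fun h =>
    Prod.mk.inj (Option.some.inj (h.symm.trans hxu))
  have hp' : ∀ {a}, Δp x ≠ some a := by simp [hxp]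
  have hΓ' : ∀ {a}, Γ x ≠ some a := by simp [hxΓ]
  rcases hI with hI | hI
  · cases hI with
    | comm y S Q =>
      cases hp with
      | lolliL h => exact absurd h hp'
      | copy h => exact absurd h hΓ'
      | tensorR hs h₁ h₂ =>
        cases hu with
        | lolliR => exact absurd rfl hxz
        | tensorL hx h₃ =>
          obtain ⟨rfl, rfl⟩ := hA hx
          cases hle.width (by simp) (by simp)
          exact H.tensor hs h₁ h₂ h₃
        | bangL hx =>
          obtain ⟨rfl, rfl⟩ := hA hx
          cases hle.width (by simp) (by simp)
      | bangR h₁ =>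
        cases hu with
        | lolliR => exact absurd rfl hxz
        | tensorL hx =>
          obtain ⟨rfl, rfl⟩ := hA hx
          cases hle.width (by simp) (by simp)
        | bangL hx h₃ =>
          obtain ⟨rfl, rfl⟩ := hA hx
          cases hle.width (by simp) (by simp)
          exact H.bang h₁ h₃
    | rep => cases hu
    | move y ω ω' P Q =>
      cases hp with
      | atR ha haa h₁ =>
        cases hu with
        | atL hx h₂ =>
          obtain ⟨rfl, rfl⟩ := hA hx
          cases hle.width (by simp) (by simp)
          exact H.atDom ha haa h₁ h₂
    | dom ω P Q =>
      cases hp with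
      | allL h => exact absurd h hp'
      | exR ha h₁ =>
        cases hu with
        | allR => exact absurd rfl hxz
        | exL hx h₂ =>
          obtain ⟨rfl, rfl⟩ := hA hx
          cases hle.width (by simp) (by simp)
          exact H.ex ha h₁ h₂
    | choice I j P Q =>
      obtain ⟨j, hj⟩ := j
      cases hp with
      | ampL h => exact absurd h hp'
      | plusR h₁ =>
        cases hu with
        | ampR => exact absurd rfl hxz
        | plusL hx h₂ =>
          obtain ⟨rfl, rfl⟩ := hA hx
          have hw := hle.width (by simp) (by simp)
          refine H.cut h₁ ?_
          have := h₂ ⟨j, hj⟩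
          -- The selection is typed at the singleton label set, and width subtyping leads from it to
          -- the set of the branching without altering the type at a common label.
          rwa [hw.plus_inv (Finset.mem_singleton_self _) hj] at this
  · cases hI with
    | comm y S Q =>
      cases hu with
      | tensorR => exact absurd rfl hxz
      | bangR => exact absurd rfl hxz
      | copy h => exact absurd h hΓ'
      | lolliL hx hs ha h₁ h₂ =>
        obtain ⟨rfl, rfl⟩ := hA hx
        cases hp with
        | lolliR h₃ =>
          cases hle.width (by simp) (by simp)
          exact H.lolli hs ha h₁ h₂ h₃
        | tensorL h => exact absurd h hp'
        | bangL h => exact absurd h hp'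
    | rep => cases hp
    | move y ω ω' P Q =>
      cases hu with
      | atR => exact absurd rfl hxz
    | dom ω P Q =>
      cases hu with
      | exR => exact absurd rfl hxz
      | allL hx ha h₂ =>
        obtain ⟨rfl, rfl⟩ := hA hx
        cases hp with
        | exL h => exact absurd h hp'
        | allR h₁ =>
          cases hle.width (by simp) (by simp)
          exact H.all ha h₁ h₂
    | choice I j P Q =>
      obtain ⟨j, hj⟩ := j
      cases hu with
      | plusR => exact absurd rfl hxz
      | ampL hx h₂ =>
        obtain ⟨rfl, rfl⟩ := hA hx
        cases hp with
        | plusL h => exact absurd h hp'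
        | ampR h₁ =>
          have hw := hle.width (by simp) (by simp)
          refine Real.cong (P := .par (Q ⟨j, hj⟩) P) (H.cut (h₁ _) ?_) (.par_comm _ _)
          rwa [← hw.amp_inv hj (Finset.mem_singleton_self _)]

end

/-! ### Interactions inside a typed multiset -/

section

variable {𝓡 : Set AccRule} {Ω : AccCtx} {Γ Γ' Δ Δ' Δ₁ Δ₂ Δp Δu : Ctx} {P Q S T Sp Su S₁ S₂ : Proc}
  {z x y w : ℕ} {A A' C : Ty} {ω ω' ω₁ ω₂ : Dom} {X Xp Xu B B₁ B₂ Bs : Finset ℕ}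
  {M₀ M₁ M₂ : Multiset Proc}

theorem _root_.Multiset.add_eq_cons_cons {α : Type*} {s t u : Multiset α} {a b : α}
    (h : s + t = a ::ₘ b ::ₘ u) :
    (∃ v, s = a ::ₘ b ::ₘ v ∧ u = v + t) ∨ (∃ v, t = a ::ₘ b ::ₘ v ∧ u = s + v) ∨
      (∃ v v', s = a ::ₘ v ∧ t = b ::ₘ v' ∧ u = v + v') ∨
      ∃ v v', s = b ::ₘ v ∧ t = a ::ₘ v' ∧ u = v + v' := by
  have ha : a ∈ s + t := by simp [h]
  rcases Multiset.mem_add.1 ha with ha | ha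
  · obtain ⟨s', rfl⟩ := Multiset.exists_cons_of_mem ha
    rw [Multiset.cons_add, Multiset.cons_inj_right] at h
    have hb : b ∈ s' + t := by simp [h]
    rcases Multiset.mem_add.1 hb with hb | hb
    · obtain ⟨s'', rfl⟩ := Multiset.exists_cons_of_mem hb
      rw [Multiset.cons_add, Multiset.cons_inj_right] at h
      exact Or.inl ⟨s'', rfl, h.symm⟩
    · obtain ⟨t', rfl⟩ := Multiset.exists_cons_of_mem hb
      rw [Multiset.add_cons, Multiset.cons_inj_right] at h
      exact Or.inr (Or.inr (Or.inl ⟨s', t', rfl, rfl, h.symm⟩))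
  · obtain ⟨t', rfl⟩ := Multiset.exists_cons_of_mem ha
    rw [Multiset.add_cons, Multiset.cons_inj_right] at h
    have hb : b ∈ s + t' := by simp [h]
    rcases Multiset.mem_add.1 hb with hb | hb
    · obtain ⟨s', rfl⟩ := Multiset.exists_cons_of_mem hb
      rw [Multiset.cons_add, Multiset.cons_inj_right] at h
      exact Or.inr (Or.inr (Or.inr ⟨s', t', rfl, rfl, h.symm⟩))
    · obtain ⟨t'', rfl⟩ := Multiset.exists_cons_of_mem hb
      rw [Multiset.add_cons, Multiset.cons_inj_right] at h
      exact Or.inr (Or.inl ⟨t'', rfl, h.symm⟩)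

theorem Inter.mem_fn (h : Inter x S₁ S₂ T) : x ∈ S₁.fn ∧ x ∈ S₂.fn := by
  cases h <;> simp [Proc.fn]

theorem Inter.left_ne_rep (h : Inter x S₁ S₂ T) {u : ℕ} {P : Proc} : S₁ ≠ .rep u P := by
  cases h <;> simp

/-- An unrestricted name can be the subject only of an output, typed by `copy`. A receiving thread
that is a leaf therefore has a linear or an offered subject. -/
theorem Inter.right_subject (h : Inter x S₁ S₂ T) (hB : Blk 𝓡 Ω Γ Δ Bs S₂ z C ω) :
    Δ x ≠ none ∨ x = z := by
  cases h <;> cases hB <;> simp_all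

theorem Blk.mem_fn (h : Blk 𝓡 Ω Γ Δ Bs S z C ω) (hd : Distinct Γ Δ z) (hf : Fresh Bs Γ Δ z) {n : ℕ}
    (hn : n ∈ S.fn) : Γ n ≠ none ∨ Δ n ≠ none ∨ n = z ∨ n ∈ Bs :=
  (OT.blk hd hf h).mem_fn (Multiset.mem_singleton_self _) hn

/-- The threads `M₀` together with the reduct `T` of some other threads are typed by the given
sequent; `T` is flattened with restricted names in `N`. -/
def Contracts (𝓡 : Set AccRule) (Ω : AccCtx) (N : Set ℕ) (Γ Δ : Ctx) (B : Finset ℕ) (T : Proc)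
    (M₀ : Multiset Proc) (z : ℕ) (C : Ty) (ω : Dom) : Prop :=
  ∃ Bf MT B', Flat T id Bf MT ∧ OT 𝓡 Ω Γ Δ B' (MT + M₀) z C ω ∧ (Bf : Set ℕ) ⊆ N ∧
    ∀ b ∈ B', b ∈ B ∨ b ∈ N

/-- The cut is moved up to the two leaves. Those are cut directly; the outcome fills the provider's
context, which now offers the session of the user's leaf, and the result fills the user's context
with `Δ₁` in place of `x`. Apart from the two domain conditions, the work consists in keeping the
names of the two contexts, of the leaves and of the new cuts apart. -/
theorem OT.contracts_cut (hd : Distinct Γ Δ z) (hf : Fresh (insert w (B₁ ∪ B₂)) Γ Δ z)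
    (hw : w ∉ B₁ ∪ B₂) (hB : Disjoint B₁ B₂) (hs : Δ.Split Δ₁ Δ₂) (ha : AccStar 𝓡 Ω ω₁ ω₂)
    (haa : AccAll 𝓡 Ω ω₂ Δ₁) (o₁ : OT 𝓡 Ω Γ Δ₁ B₁ (Sp ::ₘ M₁) w A ω₂)
    (o₂ : OT 𝓡 Ω Γ (Δ₂.set w (some (A, ω₂))) B₂ (Su ::ₘ M₂) z C ω₁)
    (hI : Inter x Sp Su T ∨ Inter x Su Sp T) {N : Set ℕ} (hN : N.Infinite)
    (hN' : ∀ n ∈ N, n ∉ insert w (B₁ ∪ B₂) ∧ Γ n = none ∧ Δ n = none ∧ n ≠ z) :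
    Contracts 𝓡 Ω N Γ Δ (insert w (B₁ ∪ B₂)) T (M₁ + M₂) z C ω₁ := by
  have F₁ : ∀ b ∈ B₁, b ∉ B₂ ∧ b ≠ w ∧ Γ b = none ∧ Δ b = none ∧ b ≠ z := by
    intro b hb
    have h₁ := hf b (by simp [hb])
    refine ⟨Finset.disjoint_left.1 hB hb, ?_, h₁⟩
    rintro rfl
    simp [hb] at hw
  have F₂ : ∀ b ∈ B₂, b ∉ B₁ ∧ b ≠ w ∧ Γ b = none ∧ Δ b = none ∧ b ≠ z := by
    intro b hb
    have h₁ := hf b (by simp [hb])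
    refine ⟨Finset.disjoint_right.1 hB hb, ?_, h₁⟩
    rintro rfl
    simp [hb] at hw
  have hwf := hf w (by simp)
  have hrep : ∀ u P, (Sp = .rep u P ∨ Su = .rep u P) → u ∈ B₁ ∨ u ∈ B₂ := by
    rintro u P (rfl | rfl)
    · exact Or.inl (o₁.rep_mem (Multiset.mem_cons_self _ _))
    · exact Or.inr (o₂.rep_mem (Multiset.mem_cons_self _ _))
  have hmem : x ∈ Sp.fn ∧ x ∈ Su.fn := by
    rcases hI with hI | hI
    · exact hI.mem_fn
    · exact hI.mem_fn.symm
  have hsub : ∀ {Γ Δ Bs z C ω}, (Inter x Sp Su T → Blk 𝓡 Ω Γ Δ Bs Su z C ω) →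
      (Inter x Su Sp T → Blk 𝓡 Ω Γ Δ Bs Sp z C ω) → Δ x ≠ none ∨ x = z := by
    intro Γ Δ Bs z C ω h₁ h₂
    rcases hI with hI | hI
    · exact hI.right_subject (h₁ hI)
    · exact hI.right_subject (h₂ hI)
  -- If the receiver is a replicated input, its subject is one of the bound names, which are fresh
  -- for `Γ`. If it is a leaf, its subject is linear or offered in an environment that still
  -- contains `Γ`.
  have hxΓ : Γ x = none := by
    by_contra hx
    have hx' : ∀ u P, (Sp = .rep u P ∨ Su = .rep u P) → u ≠ x := by
      rintro u P h rfl
      rcases hrep u P h with h | h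
      · exact hx (F₁ u h).2.2.1
      · exact hx (F₂ u h).2.2.1
    have key : ∀ {Δ B M z C ω S}, OT 𝓡 Ω Γ Δ B M z C ω → S ∈ M → (∀ u P, S ≠ .rep u P) →
        (∀ {Γ Δ Bs z C ω}, Blk 𝓡 Ω Γ Δ Bs S z C ω → Δ x ≠ none ∨ x = z) → False := by
      intro Δ B M z C ω S o hS hr hB
      obtain ⟨M₀, Γ', Δ', B₀, Bs, z', C', ω', H⟩ := o.userHole hS hr
      obtain ⟨e, he⟩ := Option.ne_none_iff_exists'.1 hx
      have h₁ := H.unr x e he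
      rcases hB H.blk with h | rfl
      · exact h ((H.dist.2.2 x).resolve_left (by simp [h₁]))
      · simp [H.dist.1] at h₁
    rcases hI with hI | hI
    · refine key o₂ (Multiset.mem_cons_self _ _) ?_ fun h => hI.right_subject h
      rintro u P rfl
      cases hI
      exact hx' _ _ (Or.inr rfl) rfl
    · refine key o₁ (Multiset.mem_cons_self _ _) ?_ fun h => hI.right_subject h
      rintro u P rfl
      cases hI
      exact hx' _ _ (Or.inl rfl) rfl
  -- The subject is free on both sides, and the premises have no linear, offered or bound name in
  -- common except `w`.
  have hxw : x = w := by
    have h₁ := o₁.mem_fn (Multiset.mem_cons_self _ _) hmem.1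
    have h₂ := o₂.mem_fn (Multiset.mem_cons_self _ _) hmem.2
    have h₃ := hs x
    have h₄ := F₁ x
    have h₅ := F₂ x
    have h₆ := hd.2.1
    rw [Ctx.set_apply] at h₂
    clear F₁ F₂ hsub hrep hmem hf hN' o₁ o₂ hs hI
    grind
  subst hxw
  -- A replicated input would have the cut name as its subject, but its subject is bound inside one
  -- of the premises.
  have hrp : ∀ u P, Sp ≠ .rep u P := by
    rintro u P rfl
    have : u = x := by
      rcases hI with hI | hI <;> cases hI
      rfl
    subst this
    rcases hrep u P (Or.inl rfl) with h | h <;> simp [h] at hw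
  have hru : ∀ u P, Su ≠ .rep u P := by
    rintro u P rfl
    have : u = x := by
      rcases hI with hI | hI <;> cases hI
      rfl
    subst this
    rcases hrep u P (Or.inr rfl) with h | h <;> simp [h] at hw
  clear hsub hrep
  obtain ⟨M₂', Γu, Δu, Bu, Xu, z', C', ω', Hu⟩ := o₂.userHole (Multiset.mem_cons_self _ _) hru
  obtain rfl := (Multiset.cons_inj_right _).1 Hu.threads
  have hBu : ∀ b, b ∈ B₂ ↔ b ∈ Bu ∨ b ∈ Xu := by simp [Hu.names]
  have hBu' : ∀ b ∈ Bu, b ∉ Xu := fun b h h' => Finset.disjoint_left.1 Hu.disj h h'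
  have UΓ : ∀ n, Γu n ≠ none → Γ n ≠ none ∨ n ∈ B₂ := fun n hn =>
    (Hu.unr_mem n hn).imp_right fun h => (hBu n).2 (Or.inl h)
  have UΔ : ∀ n, n ≠ x → Δu n ≠ none → Δ₂ n ≠ none ∨ n ∈ B₂ := by
    intro n hn h
    by_cases hn' : n ∈ B₂
    · exact Or.inr hn'
    obtain ⟨⟨A₀, ω₀⟩, h⟩ := Option.ne_none_iff_exists'.1 h
    obtain ⟨A₁, h₁, -⟩ := Hu.lin n A₀ ω₀ (fun h => hn' ((hBu n).2 (Or.inl h))) h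
    rw [Ctx.set_apply, if_neg hn] at h₁
    exact Or.inl (by simp [h₁])
  have Uz : z' = z ∨ z' ∈ B₂ := Hu.root.imp_right fun h => (hBu _).2 (Or.inl h)
  have hxu : x ∉ B₂ := fun h => hw (by simp [h])
  have hxuΓ : Γu x = none := by
    by_contra h
    rcases UΓ x h with h | h
    · exact h hxΓ
    · exact hxu h
  have hxuΔ : ∃ A₂, Δu x = some (A₂, ω₂) ∧ Le ω₂ A A₂ := by
    rcases Hu.blk.mem_fn Hu.dist Hu.fresh hmem.2 with h | h | h | h
    · exact absurd hxuΓ h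
    · obtain ⟨⟨A₀, ω₀⟩, h⟩ := Option.ne_none_iff_exists'.1 h
      obtain ⟨A₁, h₁, h₂⟩ := Hu.lin x A₀ ω₀ (fun h => hxu ((hBu x).2 (Or.inl h))) h
      rw [Ctx.set_apply, if_pos rfl] at h₁
      cases h₁
      exact ⟨A₀, h, h₂⟩
    · rcases Uz with h' | h'
      · exact absurd (h.trans h') hwf.2.2
      · exact absurd (h ▸ h') hxu
    · exact absurd ((hBu x).2 (Or.inr h)) hxu
  obtain ⟨A₂, hxuA, hle⟩ := hxuΔ
  -- The condition `ω₁ ≺* ω₂` of the old cut, transported to the root domain of the user's leaf.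
  have hac : AccStar 𝓡 Ω ω' ω₂ :=
    Hu.acc_lin x A₂ ω₂ (fun h => hxu ((hBu x).2 (Or.inl h))) hxuA ha
  -- The provider is to be placed at the user's leaf, where every `cut!` on the path has added an
  -- unrestricted name.
  have o₁' : OT 𝓡 Ω Γu Δ₁ B₁ (Sp ::ₘ M₁) x A ω₂ := by
    refine o₁.weaken Hu.unr ⟨hxuΓ, o₁.distinct.2.1, fun n => ?_⟩ fun b hb => ?_
    · by_contra! h
      rcases UΓ n h.1 with h' | h'
      · exact h.2 ((o₁.distinct.2.2 n).resolve_left h')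
      · exact h.2 (hs.left_none (F₂ n h').2.2.2.1)
    · refine ⟨?_, (o₁.fresh b hb).2⟩
      by_contra h
      rcases UΓ b h with h' | h'
      · exact h' (F₁ b hb).2.2.1
      · exact (F₁ b hb).1 h'
  obtain ⟨M₁', Γp, Δp, Bp, Xp, Ap, Hp⟩ := o₁'.provHole (Multiset.mem_cons_self _ _) hmem.1 hrp
  obtain rfl := (Multiset.cons_inj_right _).1 Hp.threads
  have hBp : ∀ b, b ∈ B₁ ↔ b ∈ Bp ∨ b ∈ Xp := by simp [Hp.names]
  have hBp' : ∀ b ∈ Bp, b ∉ Xp := fun b h h' => Finset.disjoint_left.1 Hp.disj h h'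
  have PΓ : ∀ n, Γp n ≠ none → Γu n ≠ none ∨ n ∈ B₁ := fun n hn =>
    (Hp.unr_mem n hn).imp_right fun h => (hBp n).2 (Or.inl h)
  have PΔ : ∀ n, Δp n ≠ none → Δ₁ n ≠ none ∨ n ∈ B₁ := fun n hn =>
    (Hp.lin n hn).imp_right fun h => (hBp n).2 (Or.inl h)
  have hsp : ((Δu.set x none).join Δp).Split Δp (Δu.set x none) := by
    intro n
    have h₁ := UΔ n
    have h₂ := PΔ n
    have h₃ := hs n
    have h₄ := F₁ n
    have h₅ := F₂ n
    have h₆ : (Δu.set x none) n = if n = x then none else Δu n := Ctx.set_apply _ _ _ _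
    rw [Ctx.join_apply]
    generalize (Δu.set x none) n = a at *
    clear * - h₁ h₂ h₃ h₄ h₅ h₆
    grind
  have hxu' : x ∉ Bu ∧ x ∉ Xu := ⟨fun h => hxu ((hBu x).2 (Or.inl h)),
    fun h => hxu ((hBu x).2 (Or.inr h))⟩
  have hxp : x ∉ Bp ∧ x ∉ Xp := ⟨fun h => (F₁ x ((hBp x).2 (Or.inl h))).2.1 rfl,
    fun h => (F₁ x ((hBp x).2 (Or.inr h))).2.1 rfl⟩
  have hzΓ : Γp z' = none := by
    by_contra h
    rcases PΓ z' h with h | h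
    · exact h Hu.dist.1
    · rcases Uz with h' | h'
      · exact (F₁ z' h).2.2.2.2 h'
      · exact (F₁ z' h).1 h'
  have hud : Distinct Γp Δu z' := by
    refine ⟨hzΓ, Hu.dist.2.1, fun n => ?_⟩
    by_contra! h
    have h₁ := Hu.dist.2.2 n
    rcases PΓ n h.1 with h' | h'
    · exact h.2 (h₁.resolve_left h')
    · obtain ⟨h₂, h₃, -, h₄, -⟩ := F₁ n h'
      rcases UΔ n h₃ h.2 with h | h
      · exact h (hs.right_none h₄)
      · exact h₂ h
  have hcΔ : ∀ n, ((Δu.set x none).join Δp) n ≠ none →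
      n ≠ x ∧ Δu n ≠ none ∨ Δp n ≠ none := by
    intro n hn
    rw [Ctx.join_apply, Ctx.set_apply] at hn
    clear * - hn
    grind
  have hzx : z' ≠ x := by
    rintro rfl
    rw [Hu.dist.2.1] at hxuA
    cases hxuA
  have hcd : Distinct Γp ((Δu.set x none).join Δp) z' := by
    refine ⟨hzΓ, ?_, fun n => ?_⟩
    · by_contra h
      rcases hcΔ z' h with h | h
      · exact h.2 Hu.dist.2.1
      · rcases PΔ z' h with h | h
        · rcases Uz with rfl | h'
          · exact h (hs.left_none hd.2.1)
          · exact h (hs.left_none (F₂ z' h').2.2.2.1)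
        · rcases Uz with h' | h'
          · exact (F₁ z' h).2.2.2.2 h'
          · exact (F₁ z' h).1 h'
    · by_contra! h
      rcases hcΔ n h.2 with h' | h'
      · exact h'.2 ((hud.2.2 n).resolve_left h.1)
      · exact h' ((Hp.dist.2.2 n).resolve_left h.1)
  have hcN : ∀ n, n ≠ x → n ∉ Bu → n ∉ Bp → Γ n = none → Δ n = none → n ≠ z →
      (n ∈ B₁ → n ∈ Xp) → (n ∈ B₂ → n ∈ Xu) →
      Γp n = none ∧ ((Δu.set x none).join Δp) n = none ∧ n ≠ z' := by
    intro n h₁ h₂ h₃ h₄ h₅ h₆ h₇ h₈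
    have c₁ : n ∈ B₁ → n ∉ B₂ := fun h => (F₁ n h).1
    refine ⟨?_, ?_, ?_⟩
    · by_contra h
      rcases PΓ n h with h' | h'
      · rcases UΓ n h' with h | h
        · exact h h₄
        · exact h' (Hu.fresh n (h₈ h)).1
      · exact h (Hp.fresh n (h₇ h')).1
    · by_contra h
      rcases hcΔ n h with ⟨-, h'⟩ | h'
      · rcases UΔ n h₁ h' with h | h
        · exact h (hs.right_none h₅)
        · exact h' (Hu.fresh n (h₈ h)).2.1
      · rcases PΔ n h' with h | h
        · exact h (hs.left_none h₅)
        · exact h' (Hp.fresh n (h₇ h)).2.1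
    · rintro rfl
      rcases Hu.root with h | h
      · exact h₆ h
      · exact h₂ h
  have hcX : ∀ n ∈ Xp, n ∈ B₁ ∧ n ∉ B₂ ∧ n ∉ Bp ∧ n ∉ Bu := by
    intro n hn
    have h₁ := (hBp n).2 (Or.inr hn)
    have h₂ := (F₁ n h₁).1
    exact ⟨h₁, h₂, fun h => hBp' n h hn, fun h => h₂ ((hBu n).2 (Or.inl h))⟩
  have hcX' : ∀ n ∈ Xu, n ∈ B₂ ∧ n ∉ B₁ ∧ n ∉ Bu ∧ n ∉ Bp := by
    intro n hn
    have h₁ := (hBu n).2 (Or.inr hn)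
    have h₂ := (F₂ n h₁).1
    exact ⟨h₁, h₂, fun h => hBu' n h hn, fun h => h₂ ((hBp n).2 (Or.inl h))⟩
  have hfu : Fresh Xu Γp Δu z' := by
    intro n hn
    obtain ⟨h₁, h₂, h₃, h₄⟩ := hcX' n hn
    obtain ⟨-, h₅, h₆, h₇, h₈⟩ := F₂ n h₁
    exact ⟨(hcN n h₅ h₃ h₄ h₆ h₇ h₈ (fun h => absurd h h₂) fun _ => hn).1, (Hu.fresh n hn).2⟩
  have hcond : CutCond 𝓡 Ω Γp ((Δu.set x none).join Δp) Δp Δu Xp Xu x A₂ ω₂ z' ω' := by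
    refine ⟨hcd, Hp.dist, hud, ?_, ?_, hxuA, hac, Hp.acc haa, hsp⟩
    · intro n hn
      simp only [Finset.mem_insert, Finset.mem_union] at hn
      rcases hn with rfl | hn | hn
      · refine ⟨Hp.dist.1, ?_, hzx.symm⟩
        by_contra h
        rcases hcΔ n h with h | h
        · exact h.1 rfl
        · exact h Hp.dist.2.1
      · obtain ⟨h₁, h₂, h₃, h₄⟩ := hcX n hn
        obtain ⟨-, h₅, h₆, h₇, h₈⟩ := F₁ n h₁
        exact hcN n h₅ h₄ h₃ h₆ h₇ h₈ (fun _ => hn) fun h => absurd h h₂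
      · obtain ⟨h₁, h₂, h₃, h₄⟩ := hcX' n hn
        obtain ⟨-, h₅, h₆, h₇, h₈⟩ := F₂ n h₁
        exact hcN n h₅ h₃ h₄ h₆ h₇ h₈ (fun h => absurd h h₂) fun _ => hn
    · simp [hxp.2, hxu'.2]
  -- The type of `x` at the provider's leaf, the cut type and the type at the user's leaf form one
  -- chain of conversions.
  have hreal := hcond.principal hI Hp.blk (Hu.blk.weaken Hp.unr hud hfu) (Hp.le.trans hle)
  have hNB : ∀ n ∈ N, n ≠ x ∧ n ∉ B₁ ∧ n ∉ B₂ ∧ Γ n = none ∧ Δ n = none ∧ n ≠ z := by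
    intro n hn
    have := hN' n hn
    simpa [not_or, and_assoc] using this
  have hNu : ∀ n ∈ N, n ∉ Bu ∧ n ∉ Xu ∧ n ∉ Bp ∧ n ∉ Xp := by
    intro n hn
    have := hNB n hn
    rw [hBu, hBp] at this
    tauto
  obtain ⟨Bf, BT, MT, f, o, s, t⟩ := hreal N hN fun n hn => by
    obtain ⟨h₁, h₂, h₃, h₄, h₅, h₆⟩ := hNB n hn
    obtain ⟨h₇, h₈, h₉, h₁₀⟩ := hNu n hn
    refine ⟨by simp [h₁, h₈, h₁₀], hcN n h₁ h₇ h₉ h₄ h₅ h₆ (fun h => absurd h h₂)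
      fun h => absurd h h₃⟩
  have t' : ∀ n ∈ BT, n ∈ N ∨ n = x ∨ n ∈ Xp ∨ n ∈ Xu := by
    intro n hn
    simpa [or_left_comm] using t hn
  have hBT : ∀ n ∈ BT, n ∉ Bp ∧ n ∉ Bu ∧ (n ≠ x → Γ n = none ∧ Δ n = none ∧ n ≠ z) := by
    intro n hn
    rcases t' n hn with h | rfl | h | h
    · exact ⟨(hNu n h).2.2.1, (hNu n h).1, fun _ => (hNB n h).2.2.2⟩
    · exact ⟨hxp.1, hxu'.1, fun h => absurd rfl h⟩
    · obtain ⟨h₁, h₂, h₃, h₄⟩ := hcX n h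
      exact ⟨h₃, h₄, fun _ => (F₁ n h₁).2.2⟩
    · obtain ⟨h₁, h₂, h₃, h₄⟩ := hcX' n h
      exact ⟨h₄, h₃, fun _ => (F₂ n h₁).2.2⟩
  have hn₁ : (Δ₁.join (Δu.set x none)).Split Δ₁ (Δu.set x none) := by
    intro n
    have h₁ := UΔ n
    have h₃ := hs n
    have h₅ := F₂ n
    have h₆ : (Δu.set x none) n = if n = x then none else Δu n := Ctx.set_apply _ _ _ _
    rw [Ctx.join_apply]
    generalize (Δu.set x none) n = a at *
    clear * - h₁ h₃ h₅ h₆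
    grind
  have hn₁' : ∀ n, (Δ₁.join (Δu.set x none)) n ≠ none → Δ₁ n ≠ none ∨ n ≠ x ∧ Δu n ≠ none := by
    intro n hn
    rw [Ctx.join_apply, Ctx.set_apply] at hn
    clear * - hn
    grind
  have hΔ₂ : (Δ₂.set x (some (A, ω₂))).set x none = Δ₂ := by
    rw [Ctx.set_set, Ctx.set_none_eq (hs.right_none hwf.2.1)]
  have hΔ₁x : Δ₁ x = none := hs.left_none hwf.2.1
  have o' : OT 𝓡 Ω Γu (Δ₁.join (Δu.set x none)) (Bp ∪ BT) (M₁ + MT) z' C' ω' := by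
    refine Hp.plug _ _ _ _ _ _ _ _ hsp hn₁ haa hac
      (Finset.disjoint_right.2 fun n hn => (hBT n hn).1) ⟨Hu.dist.1, ?_, fun n => ?_⟩ ?_ o
    · by_contra h
      rcases hn₁' z' h with h | ⟨-, h⟩
      · rcases Uz with rfl | h'
        · exact h (hs.left_none hd.2.1)
        · exact h (hs.left_none (F₂ z' h').2.2.2.1)
      · exact h Hu.dist.2.1
    · by_contra! h
      rcases hn₁' n h.2 with h' | ⟨-, h'⟩
      · exact h' ((o₁'.distinct.2.2 n).resolve_left h.1)
      · exact h' ((Hu.dist.2.2 n).resolve_left h.1)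
    · have hfp : ∀ n, Γu n = none → (n ≠ x → Δu n = none) → Δ₁ n = none → n ≠ z' →
          Γu n = none ∧ (Δ₁.join (Δu.set x none)) n = none ∧ n ≠ z' := by
        intro n h₁ h₂ h₃ h₄
        refine ⟨h₁, ?_, h₄⟩
        by_contra h
        rcases hn₁' n h with h | h
        · exact h h₃
        · exact h.2 (h₂ h.1)
      intro n hn
      rcases Finset.mem_union.1 hn with hn | hn
      · have hn₁ := (hBp n).2 (Or.inl hn)
        obtain ⟨h₁, h₂, h₃, h₄, h₅⟩ := F₁ n hn₁
        refine hfp n (o₁'.fresh n hn₁).1 (fun _ => ?_) (o₁'.fresh n hn₁).2.1 ?_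
        · by_contra h
          rcases UΔ n h₂ h with h | h
          · exact h (hs.right_none h₄)
          · exact h₁ h
        · rintro rfl
          rcases Uz with h | h
          · exact h₅ h
          · exact h₁ h
      · obtain ⟨c₁, c₂, c₃⟩ := o.fresh n hn
        have hΓ : Γu n = none := by
          by_contra h
          obtain ⟨e, he⟩ := Option.ne_none_iff_exists'.1 h
          rw [Hp.unr n e he] at c₁
          cases c₁
        refine hfp n hΓ (fun hnx => ?_) ?_ c₃
        · have := hsp.right_none c₂
          rwa [Ctx.set_apply, if_neg hnx] at this
        · rcases eq_or_ne n x with rfl | hnx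
          · exact hΔ₁x
          · exact hs.left_none ((hBT n hn).2.2 hnx).2.1
  refine ⟨Bf, MT, Bu ∪ (Bp ∪ BT), f, ?_, s, ?_⟩
  · have e : MT + (M₁ + M₂) = M₂ + (M₁ + MT) := by
      rw [add_comm MT, add_comm M₁ M₂, add_assoc]
    rw [e]
    -- In the user's context `x` is given up for the provider's sessions `Δ₁`, which turns `Δ₂, x`
    -- into `Δ`.
    refine Hu.plug x Δ₁ _ _ _ _ hxu'.1 (fun _ => by simp [hxuA]) hn₁.symm ?_ ?_ ?_ hd ?_ o'
    · rw [hΔ₂]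
      exact hs.symm
    · exact fun n A ω h => hac.trans (haa n A ω h)
    · refine Finset.disjoint_left.2 fun n hn hn' => ?_
      rcases Finset.mem_union.1 hn' with h | h
      · exact (F₂ n ((hBu n).2 (Or.inl hn))).1 ((hBp n).2 (Or.inl h))
      · exact (hBT n h).2.1 hn
    · intro n hn
      simp only [Finset.mem_union] at hn
      rcases hn with hn | hn | hn
      · exact (F₂ n ((hBu n).2 (Or.inl hn))).2.2
      · exact (F₁ n ((hBp n).2 (Or.inl hn))).2.2
      · rcases eq_or_ne n x with rfl | hnx
        · exact hwf
        · exact (hBT n hn).2.2 hnx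
  · intro n hn
    simp only [Finset.mem_union] at hn
    simp only [Finset.mem_insert, Finset.mem_union]
    rcases hn with hn | hn | hn
    · exact Or.inl (Or.inr (Or.inr ((hBu n).2 (Or.inl hn))))
    · exact Or.inl (Or.inr (Or.inl ((hBp n).2 (Or.inl hn))))
    · rcases t' n hn with h | h | h | h
      · exact Or.inr h
      · exact Or.inl (Or.inl h)
      · exact Or.inl (Or.inr (Or.inl (hcX n h).1))
      · exact Or.inl (Or.inr (Or.inr (hcX' n h).1))

end

section

variable {𝓡 : Set AccRule} {Ω : AccCtx} {Γ Γ' Δ Δ' Δ₁ Δ₂ Δp Δu : Ctx} {P Q S T Sp Su S₁ S₂ : Proc}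
  {z x y w u : ℕ} {A A' C : Ty} {ω ω' ω₁ ω₂ : Dom} {X Xp Xu B B₁ B₂ Bs : Finset ℕ}
  {M₀ M₁ M₂ M : Multiset Proc}

/-- The output on `u` is typed by `copy`, which supplies the continuation with a linear session `y`.
A fresh instance of the replicated body can provide `y` without linear resources, so a cut on `y` at
the leaf types the contractum, and the `cut!` is kept for the remaining copy. -/
theorem OT.contracts_rep (hd : Distinct Γ Δ z) (hf : Fresh (insert u B) Γ Δ z) (hu : u ∉ B)
    (hP : Typed 𝓡 Ω (Γ.push none) Ctx.empty P 0 A ω₁)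
    (o : OT 𝓡 Ω (Γ.set u (some (A, ω₁))) Δ B (S₁ ::ₘ M₀) z C ω₂) (hI : Inter u S₁ (.rep u P) T)
    {N : Set ℕ} (hN : N.Infinite)
    (hN' : ∀ n ∈ N, n ∉ insert u B ∧ Γ n = none ∧ Δ n = none ∧ n ≠ z) :
    Contracts 𝓡 Ω N Γ Δ (insert u B) T M₀ z C ω₂ := by
  cases hI with
  | rep y _ Q =>
  have hfu := hf u (by simp)
  obtain ⟨M₁, Γ', Δ', B₀, Bs, z', C', ω', H⟩ := o.userHole (Multiset.mem_cons_self _ _) (by simp)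
  obtain rfl := (Multiset.cons_inj_right _).1 H.threads
  have hB : ∀ b, b ∈ B ↔ b ∈ B₀ ∨ b ∈ Bs := by simp [H.names]
  have hB' : ∀ b ∈ B₀, b ∉ Bs := fun b h h' => Finset.disjoint_left.1 H.disj h h'
  have hΓu : Γ' u = some (A, ω₁) := H.unr u _ (by simp [Ctx.set_apply])
  have hΔu : ∀ a, Δ' u ≠ some a := by
    intro a h
    have := H.dist.2.2 u
    simp [hΓu, h] at this
  have hzu : u ≠ z' := by
    rintro rfl
    have := H.dist.1
    simp [hΓu] at this
  have hsub : ∀ n e, Γ n = some e → Γ' n = some e := by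
    intro n e hn
    refine H.unr n e ?_
    rw [Ctx.set_apply, if_neg, hn]
    rintro rfl
    simp [hfu.1] at hn
  have hb := H.blk
  -- The subject `u` is unrestricted at the leaf, so it is neither a linear name nor the offered
  -- one; only `copy` is left.
  cases hb with
  | lolliL h => exact absurd h (hΔu _)
  | tensorR => exact absurd rfl hzu
  | bangR => exact absurd rfl hzu
  | copy h ha hQ =>
  rw [hΓu] at h
  cases h
  have hy := H.fresh y (by simp)
  have hP' : Typed 𝓡 Ω Γ' Ctx.empty (P.inst y) y A ω₁ := by
    have := hP.rename (ρ := instName y) (Γ' := Γ') (Δ' := Ctx.empty)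
    rw [instName_eq] at this
    rw [Proc.inst, instName_eq]
    exact this (GMap.consName hsub y) (LMap.empty _) ⟨hy.1, rfl, fun _ => Or.inr rfl⟩
  -- Since the instance of `P` uses no linear session, `≺* Δ₁` is vacuous, and the other condition
  -- of the cut is the side condition of `copy`.
  have hreal : Real 𝓡 Ω id (insert y (∅ ∪ ∅)) Γ' Δ' (.par (P.inst y) Q) z' C' ω' := by
    refine Real.cut (Δ₁ := Ctx.empty) H.dist ?_ (by simp) (by simp) (fun n => Or.inr ⟨rfl, rfl⟩)
      ha (fun _ _ _ h => by cases h) hP'.real_id hQ.real_id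
    intro b hb
    exact H.fresh b (by simpa using hb)
  have hNB : ∀ n ∈ N, n ≠ u ∧ n ∉ B ∧ Γ n = none ∧ Δ n = none ∧ n ≠ z := by
    intro n hn
    simpa [not_or, and_assoc] using hN' n hn
  obtain ⟨Bf, BT, MT, f, o', s, t⟩ := hreal N hN fun n hn => by
    obtain ⟨h₁, h₂, h₃, h₄, h₅⟩ := hNB n hn
    rw [hB] at h₂
    refine ⟨?_, ?_, ?_, ?_⟩
    · simpa using fun h => h₂ (Or.inr (by simpa using h))
    · by_contra h
      rcases H.unr_mem n h with h | h
      · rw [Ctx.set_apply, if_neg h₁] at h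
        exact h h₃
      · exact h₂ (Or.inl h)
    · by_contra h
      obtain ⟨⟨A₀, ω₀⟩, h⟩ := Option.ne_none_iff_exists'.1 h
      obtain ⟨A₁, h', -⟩ := H.lin n A₀ ω₀ (fun h => h₂ (Or.inl h)) h
      simp [h₄] at h'
    · rintro rfl
      rcases H.root with h | h
      · exact h₅ h
      · exact h₂ (Or.inl h)
  have t' : ∀ n ∈ BT, n ∈ N ∨ n = y := by
    intro n hn
    simpa [or_comm] using t hn
  have hBT : ∀ n ∈ BT, n ≠ u ∧ n ∉ B₀ ∧ Γ n = none ∧ Δ n = none ∧ n ≠ z := by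
    intro n hn
    rcases t' n hn with h | rfl
    · have := hNB n h
      rw [hB] at this
      tauto
    · have h₁ := (hB n).2 (Or.inr (by simp))
      refine ⟨?_, fun h => hB' n h (by simp), hf n (by simp [h₁])⟩
      rintro rfl
      exact hu h₁
  have hΔu' : Δ u = none := hfu.2.1
  have hu₀ : u ∉ B₀ := fun h => hu ((hB u).2 (Or.inl h))
  have hfr : ∀ n ∈ B₀ ∪ BT, n ≠ u ∧ Γ n = none ∧ Δ n = none ∧ n ≠ z := by
    intro n hn
    rcases Finset.mem_union.1 hn with h | h
    · refine ⟨?_, hf n (by simp [(hB n).2 (Or.inl h)])⟩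
      rintro rfl
      exact hu₀ h
    · have := hBT n h
      tauto
  have o₂ : OT 𝓡 Ω (Γ.set u (some (A, ω₁))) Δ (B₀ ∪ BT) (M₀ + MT) z C ω₂ := by
    -- No linear session is exchanged here: `u` is not linear, and it is replaced by nothing.
    refine H.plug u Ctx.empty _ _ _ _ hu₀ (fun h => absurd hΔu' h) ?_ ?_ (fun _ _ _ h => by cases h)
      (Finset.disjoint_right.2 fun n hn => (hBT n hn).2.1) o.distinct ?_ o'
    · rw [Ctx.set_none_eq (by simpa using Option.eq_none_iff_forall_ne_some.2 hΔu)]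
      exact fun n => Or.inl ⟨rfl, rfl⟩
    · rw [Ctx.set_none_eq hΔu']
      exact fun n => Or.inl ⟨rfl, rfl⟩
    · intro n hn
      obtain ⟨h₁, h₂⟩ := hfr n hn
      rw [Ctx.set_apply, if_neg h₁]
      exact h₂
  have o₃ : OT 𝓡 Ω Γ Δ (insert u (B₀ ∪ BT)) (.rep u P ::ₘ (M₀ + MT)) z C ω₂ := by
    refine .cutBang hd ?_ (fun h => (hfr u h).1 rfl) hP o₂
    intro n hn
    rcases Finset.mem_insert.1 hn with rfl | hn
    · exact hfu
    · exact (hfr n hn).2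
  have f' : Flat (.par (.rep u P) (.par (P.inst y) Q)) id Bf (.rep u P ::ₘ MT) := by
    refine ⟨∅, Bf, {.rep u P}, MT, by simp, rfl, by simp, ?_, f⟩
    have hr : (Proc.rep u P).IsThread := trivial
    exact (flat_thread hr).2 ⟨rfl, _, by rw [Proc.rename_id]; exact hr.refl, rfl⟩
  have hc : Cong (.par (.rep u P) (.par (P.inst y) Q))
      (.par Q (.par (P.inst y) (.rep u P))) :=
    (Cong.par_comm _ _).trans ((Cong.par (.par_comm _ _) (.refl _)).trans (.symm (.par_assoc _ _ _)))
  obtain ⟨Bf', f'', s'⟩ := hc.flatLE.1 _ _ _ _ hN f'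
  refine ⟨Bf', _, insert u (B₀ ∪ BT), f'', ?_, s'.trans (Set.union_subset s subset_rfl), ?_⟩
  · rw [Multiset.cons_add, add_comm]
    exact o₃
  · intro n hn
    simp only [Finset.mem_insert, Finset.mem_union] at hn ⊢
    rcases hn with rfl | hn | hn
    · exact Or.inl (Or.inl rfl)
    · exact Or.inl (Or.inr ((hB n).2 (Or.inl hn)))
    · rcases t' n hn with h | rfl
      · exact Or.inr h
      · exact Or.inl (Or.inr ((hB n).2 (Or.inr (by simp))))

/-- Descend while both threads lie in the same premise. They part at a linear cut, where either of
them may be on the provider's side, or at the `cut!` that introduces the second thread as a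
replicated input. A leaf holds one thread only, so one of these happens. -/
theorem OT.contracts (hI : Inter x S₁ S₂ T) (h : OT 𝓡 Ω Γ Δ B M z C ω) {N : Set ℕ}
    (hN : N.Infinite) : ∀ {M₀}, M = S₁ ::ₘ S₂ ::ₘ M₀ →
    (∀ n ∈ N, n ∉ B ∧ Γ n = none ∧ Δ n = none ∧ n ≠ z) →
    Contracts 𝓡 Ω N Γ Δ B T M₀ z C ω := by
  have fresh : ∀ {Γ Δ z} {B B' : Finset ℕ}, Fresh B Γ Δ z →
      (∀ n ∈ N, n ∉ B ∧ Γ n = none ∧ Δ n = none ∧ n ≠ z) → (∀ b ∈ B', b ∈ B ∨ b ∈ N) →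
      Fresh B' Γ Δ z := by
    intro Γ Δ z B B' h₁ h₂ h₃ b hb
    rcases h₃ b hb with h | h
    · exact h₁ b h
    · exact (h₂ b h).2
  induction h with
  | blk =>
    intro M₀ hM
    have := congrArg Multiset.card hM
    simp at this
  | zero =>
    intro M₀ hM
    have := congrArg Multiset.card hM
    simp at this
  | oneL hd hf hx _ ih =>
    intro M₀ hM hN'
    obtain ⟨Bf, MT, B', f, o, s, t⟩ := ih hM fun n hn =>
      ⟨(hN' n hn).1, (hN' n hn).2.1, Ctx.set_none_none (hN' n hn).2.2.1, (hN' n hn).2.2.2⟩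
    exact ⟨Bf, MT, B', f, .oneL hd (fresh hf hN' t) hx o, s, t⟩
  | @convL Γ Δ B M z C ω₁ x A A' ω₂ hd hf hx hc _ ih =>
    intro M₀ hM hN'
    obtain ⟨Bf, MT, B', f, o, s, t⟩ := ih hM fun n hn => by
      obtain ⟨h₁, h₂, h₃, h₄⟩ := hN' n hn
      refine ⟨h₁, h₂, ?_, h₄⟩
      rw [Ctx.set_apply, if_neg, h₃]
      rintro rfl
      simp [h₃] at hx
    exact ⟨Bf, MT, B', f, .convL hd (fresh hf hN' t) hx hc o, s, t⟩
  | convR hd hf hc _ ih =>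
    intro M₀ hM hN'
    obtain ⟨Bf, MT, B', f, o, s, t⟩ := ih hM hN'
    exact ⟨Bf, MT, B', f, .convR hd (fresh hf hN' t) hc o, s, t⟩
  | @cut Γ Δ Δ₁ Δ₂ w B₁ B₂ M₁ M₂ z C ω₁ A ω₂ hd hf hw hB hs ha haa o₁ o₂ ih₁ ih₂ =>
    intro M₀ hM hN'
    have hNB : ∀ n ∈ N, n ≠ w ∧ n ∉ B₁ ∧ n ∉ B₂ ∧ Γ n = none ∧ Δ n = none ∧ n ≠ z := by
      intro n hn
      simpa [not_or, and_assoc] using hN' n hn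
    have hwB : w ∉ B₁ ∧ w ∉ B₂ := by simpa using hw
    have hwN : w ∉ N := fun h => (hNB w h).1 rfl
    rcases Multiset.add_eq_cons_cons hM with ⟨M', h₁, rfl⟩ | ⟨M', h₁, rfl⟩ |
      ⟨M₁', M₂', rfl, rfl, rfl⟩ | ⟨M₁', M₂', rfl, rfl, rfl⟩
    · obtain ⟨Bf, MT, B', f, o, s, t⟩ := ih₁ h₁ fun n hn => by
        obtain ⟨h₁, h₂, h₃, h₄, h₅, h₆⟩ := hNB n hn
        exact ⟨h₂, h₄, hs.left_none h₅, h₁⟩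
      have t' : ∀ b ∈ insert w (B' ∪ B₂), b ∈ insert w (B₁ ∪ B₂) ∨ b ∈ N := by
        intro b hb
        simp only [Finset.mem_insert, Finset.mem_union] at hb ⊢
        rcases hb with h | h | h
        · exact Or.inl (Or.inl h)
        · exact (t b h).imp_left fun h => Or.inr (Or.inl h)
        · exact Or.inl (Or.inr (Or.inr h))
      refine ⟨Bf, MT, _, f, ?_, s, t'⟩
      rw [← add_assoc]
      refine .cut hd (fresh hf hN' t') ?_ ?_ hs ha haa o o₂
      · intro h
        rcases Finset.mem_union.1 h with h | h
        · exact (t w h).elim hwB.1 hwN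
        · exact hwB.2 h
      · refine Finset.disjoint_left.2 fun b hb hb' => ?_
        rcases t b hb with h | h
        · exact Finset.disjoint_left.1 hB h hb'
        · exact (hNB b h).2.2.1 hb'
    · obtain ⟨Bf, MT, B', f, o, s, t⟩ := ih₂ h₁ fun n hn => by
        obtain ⟨h₁, h₂, h₃, h₄, h₅, h₆⟩ := hNB n hn
        refine ⟨h₃, h₄, ?_, h₆⟩
        rw [Ctx.set_apply, if_neg h₁]
        exact hs.right_none h₅
      have t' : ∀ b ∈ insert w (B₁ ∪ B'), b ∈ insert w (B₁ ∪ B₂) ∨ b ∈ N := by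
        intro b hb
        simp only [Finset.mem_insert, Finset.mem_union] at hb ⊢
        rcases hb with h | h | h
        · exact Or.inl (Or.inl h)
        · exact Or.inl (Or.inr (Or.inl h))
        · exact (t b h).imp_left fun h => Or.inr (Or.inr h)
      refine ⟨Bf, MT, _, f, ?_, s, t'⟩
      rw [add_left_comm]
      refine .cut hd (fresh hf hN' t') ?_ ?_ hs ha haa o₁ o
      · intro h
        rcases Finset.mem_union.1 h with h | h
        · exact hwB.1 h
        · exact (t w h).elim hwB.2 hwN
      · refine Finset.disjoint_right.2 fun b hb hb' => ?_
        rcases t b hb with h | h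
        · exact Finset.disjoint_left.1 hB hb' h
        · exact (hNB b h).2.1 hb'
    · exact OT.contracts_cut hd hf hw hB hs ha haa o₁ o₂ (Or.inl hI) hN hN'
    · exact OT.contracts_cut hd hf hw hB hs ha haa o₁ o₂ (Or.inr hI) hN hN'
  | @cutBang Γ Δ u B P M z C ω₂ A ω₁ hd hf hu hP o ih =>
    intro M₀ hM hN'
    have hmem : Proc.rep u P ∈ S₁ ::ₘ S₂ ::ₘ M₀ := by simp [← hM]
    rw [Multiset.mem_cons, Multiset.mem_cons] at hmem
    rcases hmem with h | rfl | h
    · exact absurd h.symm hI.left_ne_rep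
    · rw [Multiset.cons_swap, Multiset.cons_inj_right] at hM
      subst hM
      obtain rfl : x = u := by cases hI; rfl
      exact OT.contracts_rep hd hf hu hP o hI hN hN'
    · obtain ⟨M', rfl⟩ := Multiset.exists_cons_of_mem h
      rw [Multiset.cons_swap S₂, Multiset.cons_swap S₁, Multiset.cons_inj_right] at hM
      have hNB : ∀ n ∈ N, n ≠ u ∧ n ∉ B ∧ Γ n = none ∧ Δ n = none ∧ n ≠ z := by
        intro n hn
        simpa [not_or, and_assoc] using hN' n hn
      obtain ⟨Bf, MT, B', f, o', s, t⟩ := ih hM fun n hn => by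
        obtain ⟨h₁, h₂, h₃, h₄⟩ := hNB n hn
        exact ⟨h₂, by rw [Ctx.set_apply, if_neg h₁, h₃], h₄⟩
      have t' : ∀ b ∈ insert u B', b ∈ insert u B ∨ b ∈ N := by
        intro b hb
        simp only [Finset.mem_insert] at hb ⊢
        rcases hb with h | h
        · exact Or.inl (Or.inl h)
        · exact (t b h).imp_left Or.inr
      refine ⟨Bf, MT, _, f, ?_, s, t'⟩
      rw [Multiset.add_cons]
      refine .cutBang hd (fresh hf hN' t') ?_ hP o'
      intro h
      exact (t u h).elim hu fun h => (hNB u h).1 rfl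

end

/-! ### Forwarders inside a typed multiset -/

/-- The renaming of `a` to `c`. -/
def mergeName (a c : ℕ) : ℕ → ℕ := fun n => if n = a then c else n

theorem Proc.rename_eq_self {P : Proc} {σ : ℕ → ℕ} (h : ∀ n ∈ P.fn, σ n = n) : P.rename σ = P :=
  (P.rename_congr h).trans P.rename_id

theorem map_rename_congr {M : Multiset Proc} {σ τ : ℕ → ℕ}
    (h : ∀ S ∈ M, ∀ n ∈ S.fn, σ n = τ n) : M.map (Proc.rename σ) = M.map (Proc.rename τ) :=
  Multiset.map_congr rfl fun S hS => S.rename_congr (h S hS)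

theorem map_mergeName_eq_self {M : Multiset Proc} {a c : ℕ} (h : ∀ S ∈ M, a ∉ S.fn) :
    M.map (Proc.rename (mergeName a c)) = M := by
  refine (Multiset.map_congr rfl fun S hS => Proc.rename_eq_self fun n hn => ?_).trans
    (Multiset.map_id M)
  refine if_neg ?_
  rintro rfl
  exact h S hS hn

/-- `OT.rename` demands injectivity, which the identification of `a` with `c` lacks. On threads
without `c` the transposition has the same effect. -/
theorem map_swap_eq_mergeName {M : Multiset Proc} {a c : ℕ} (h : ∀ S ∈ M, c ∉ S.fn) :
    M.map (Proc.rename (Equiv.swap a c)) = M.map (Proc.rename (mergeName a c)) := by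
  refine map_rename_congr fun S hS n hn => ?_
  have hc : n ≠ c := by
    rintro rfl
    exact h S hS hn
  by_cases ha : n = a
  · simp [mergeName, ha]
  · simp [mergeName, ha, Equiv.swap_apply_of_ne_of_ne ha hc]

theorem image_swap_eq_self {B : Finset ℕ} {a c : ℕ} (ha : a ∉ B) (hc : c ∉ B) :
    B.image (Equiv.swap a c) = B := by
  have h : ∀ b ∈ B, Equiv.swap a c b = id b := by
    intro b hb
    refine Equiv.swap_apply_of_ne_of_ne ?_ ?_
    · rintro rfl; exact ha hb
    · rintro rfl; exact hc hb
  rw [Finset.image_congr (fun b hb => h b hb), Finset.image_id]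

section

variable {𝓡 : Set AccRule} {Ω : AccCtx} {Γ Γ' Δ Δ' Δ₁ Δ₂ : Ctx} {P Q S T : Proc}
  {z x y w u a c : ℕ} {A A' C : Ty} {ω ω' ω₁ ω₂ : Dom} {B B₁ B₂ : Finset ℕ}
  {M₀ M₁ M₂ M : Multiset Proc}

theorem OT.le_right (h : OT 𝓡 Ω Γ Δ B M z A ω) (hle : Le ω A A') : OT 𝓡 Ω Γ Δ B M z A' ω := by
  induction hle with
  | refl => exact h
  | tail _ hc ih => exact .convR h.distinct h.fresh hc ih

theorem OT.le_left (hle : Le ω₂ A A') (h : OT 𝓡 Ω Γ (Δ.set x (some (A', ω₂))) B M z C ω₁) :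
    OT 𝓡 Ω Γ (Δ.set x (some (A, ω₂))) B M z C ω₁ := by
  have hx : ∀ A, Δ.set x (some (A, ω₂)) x = some (A, ω₂) := fun A => by simp [Ctx.set_apply]
  have hd : ∀ A, Distinct Γ (Δ.set x (some (A, ω₂))) z := by
    intro A
    have := h.distinct.set_of_mem (x := x) (e := some (A, ω₂)) (by simp [hx])
    rwa [Ctx.set_set] at this
  have hf : ∀ A, Fresh B Γ (Δ.set x (some (A, ω₂))) z := by
    refine fun A => h.fresh.mono subset_rfl fun n hn => ?_
    rw [Ctx.set_apply] at hn ⊢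
    split_ifs at hn ⊢
    exact hn
  induction hle using Relation.ReflTransGen.head_induction_on with
  | refl => exact h
  | head hc _ ih => exact .convL (hd _) (hf _) (hx _) hc (by rwa [Ctx.set_set])

/-- The provider offers `w` through a forwarder, so at that leaf `w` is just another name for the
session `c`. The user, renamed so as to use `c` directly, takes the place of the forwarder in the
provider's context. The subtyping collected between the leaf and the cut is applied to the user's
assumption. -/
theorem OT.forward_provider (hd : Distinct Γ Δ z) (hf : Fresh (insert w (B₁ ∪ B₂)) Γ Δ z)
    (hw : w ∉ B₁ ∪ B₂) (hB : Disjoint B₁ B₂) (hs : Δ.Split Δ₁ Δ₂) (ha : AccStar 𝓡 Ω ω₁ ω₂)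
    (haa : AccAll 𝓡 Ω ω₂ Δ₁) (o₁ : OT 𝓡 Ω Γ Δ₁ B₁ (S ::ₘ M₁) w A ω₂)
    (o₂ : OT 𝓡 Ω Γ (Δ₂.set w (some (A, ω₂))) B₂ M₂ z C ω₁)
    (hS : S = .fwd w c ∨ S = .fwd c w) (hc : w ≠ c) :
    ∃ B', B' ⊆ insert w (B₁ ∪ B₂) ∧
      OT 𝓡 Ω Γ Δ B' ((M₁ + M₂).map (Proc.rename (mergeName w c))) z C ω₁ := by
  have hwB : w ∉ B₁ ∧ w ∉ B₂ := by simpa using hw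
  have hwf := hf w (by simp)
  have F₁ : ∀ b ∈ B₁, b ∉ B₂ ∧ Γ b = none ∧ Δ b = none ∧ b ≠ z := fun b hb =>
    ⟨Finset.disjoint_left.1 hB hb, hf b (by simp [hb])⟩
  have F₂ : ∀ b ∈ B₂, b ∉ B₁ ∧ Γ b = none ∧ Δ b = none ∧ b ≠ z := fun b hb =>
    ⟨Finset.disjoint_right.1 hB hb, hf b (by simp [hb])⟩
  obtain ⟨M₀, Γ', Δ', B₀, Bs, C', H⟩ := o₁.provHole (Multiset.mem_cons_self _ _)
    (by rcases hS with rfl | rfl <;> simp [Proc.fn]) (by rcases hS with rfl | rfl <;> simp)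
  obtain rfl := (Multiset.cons_inj_right _).1 H.threads
  have hB₀ : ∀ b ∈ B₀, b ∈ B₁ := fun b hb => by simp [H.names, hb]
  -- The leaf offers `w`, and `w ≠ c`, so only the orientation of the forwarder from `c` to `w` can
  -- be typed.
  have hΔ' : Δ' = Ctx.empty.set c (some (C', ω₂)) := by
    have h := H.blk
    rcases hS with rfl | rfl
    · cases h
      exact absurd rfl hc
    · cases h
      rfl
  have hc' : Δ' c = some (C', ω₂) := by simp [hΔ', Ctx.set_apply]
  have hcΔ : Δ₁ c ≠ none ∨ c ∈ B₁ := (H.lin c (by simp [hc'])).imp_right (hB₀ c)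
  have hcΓ' : Γ' c = none := (H.dist.2.2 c).resolve_right (by simp [hc'])
  have hcΓ : Γ c = none := by
    by_contra h
    obtain ⟨e, he⟩ := Option.ne_none_iff_exists'.1 h
    simp [H.unr c e he] at hcΓ'
  have hcs := hs c
  have hcz : c ≠ z := by
    rintro rfl
    rcases hcΔ with h | h
    · exact h (hs.left_none hd.2.1)
    · exact (F₁ _ h).2.2.2 rfl
  have hc₂ : Δ₂ c = none := by
    rcases hcΔ with h | h
    · exact (hcs.resolve_right fun h' => h h'.2).2
    · exact hs.right_none (F₁ c h).2.2.1
  have hcB : c ∉ B₂ := by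
    rcases hcΔ with h | h
    · exact fun h' => h (hs.left_none (F₂ c h').2.2.1)
    · exact (F₁ c h).1
  have hw₂ : Δ₂ w = none := hs.right_none hwf.2.1
  have hn₂ : ∀ n, n ≠ w → n ≠ c → Equiv.swap w c n = n := fun n =>
    Equiv.swap_apply_of_ne_of_ne
  have hzs : Equiv.swap w c z = z := hn₂ z hwf.2.2.symm hcz.symm
  have hΓ' : ∀ n, Γ' n ≠ none → Γ n ≠ none ∨ n ∈ B₁ := fun n hn =>
    (H.unr_mem n hn).imp_right (hB₀ n)
  have hz' : Γ' z = none := by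
    by_contra h
    rcases hΓ' z h with h | h
    · exact h hd.1
    · exact (F₁ z h).2.2.2 rfl
  have hsT : (Δ₂.set c (some (C', ω₂))).Split Δ' Δ₂ := by
    intro n
    rw [hΔ', Ctx.set_apply, Ctx.set_apply]
    split_ifs with hn
    · exact Or.inl ⟨rfl, hn ▸ hc₂⟩
    · exact Or.inr ⟨rfl, rfl⟩
  have hd₂ : ∀ e, Distinct Γ' (Δ₂.set c e) z := by
    intro e
    refine ⟨hz', ?_, fun n => ?_⟩
    · rw [Ctx.set_apply, if_neg hcz.symm]
      exact hs.right_none hd.2.1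
    · by_contra! h
      rcases hΓ' n h.1 with h' | h'
      · rw [Ctx.set_apply] at h
        split_ifs at h with hnc
        · exact h' (hnc ▸ hcΓ)
        · exact h.2 (hs.right_none ((hd.2.2 n).resolve_left h'))
      · rw [Ctx.set_apply] at h
        split_ifs at h with hnc
        · exact h.1 (hnc ▸ hcΓ')
        · exact h.2 (hs.right_none (F₁ n h').2.2.1)
  have hf₂ : ∀ e, Fresh B₂ Γ' (Δ₂.set c e) z := by
    intro e b hb
    obtain ⟨h₁, h₂, h₃, h₄⟩ := F₂ b hb
    refine ⟨?_, ?_, h₄⟩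
    · by_contra h
      rcases hΓ' b h with h | h
      · exact h h₂
      · exact h₁ h
    · rw [Ctx.set_apply, if_neg]
      · exact hs.right_none h₃
      · rintro rfl
        exact hcB hb
  have o₂' := o₂.rename (Γ' := Γ') (Δ' := Δ₂.set c (some (A, ω₂))) (Equiv.swap w c).injective
    (by
      intro n e hn
      rw [hn₂ n]
      · exact H.unr n e hn
      · rintro rfl
        simp [hwf.1] at hn
      · rintro rfl
        simp [hcΓ] at hn)
    (by
      have h₁ : LMap (Equiv.swap w c) Δ₂ Δ₂ := by
        have h₂ : ∀ n, Δ₂ n ≠ none → Equiv.swap w c n = n := by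
          intro n hn
          refine hn₂ n ?_ ?_
          · rintro rfl; exact hn hw₂
          · rintro rfl; exact hn hc₂
        refine ⟨fun n e hn => ?_, fun n e hn => ⟨n, hn, ?_⟩, fun n n' _ _ h =>
          (Equiv.swap w c).injective h⟩
        · rwa [h₂ n (by simp [hn])]
        · exact h₂ n (by simp [hn])
      have := h₁.set_of_none (x := w) (e := some (A, ω₂)) (by simpa using hc₂)
      simpa using this)
    (by rw [hzs]; exact hd₂ _)
    (by rw [image_swap_eq_self hwB.2 hcB, hzs]; exact hf₂ _)
  rw [image_swap_eq_self hwB.2 hcB, hzs, map_swap_eq_mergeName] at o₂'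
  · have o₃ := o₂'.le_left H.le
    have o₄ := H.plug Δ₂ _ Δ B₂ _ z C ω₁ hsT hs haa ha
      (Finset.disjoint_left.2 fun b hb => (F₁ b (hB₀ b hb)).1) hd (by
        intro b hb
        rcases Finset.mem_union.1 hb with h | h
        · exact (F₁ b (hB₀ b h)).2
        · exact (F₂ b h).2) o₃
    refine ⟨B₀ ∪ B₂, ?_, ?_⟩
    rotate_left
    · rw [Multiset.map_add, map_mergeName_eq_self]
      · exact o₄
      · intro S hS hn
        rcases o₄.mem_fn (Multiset.mem_add.2 (Or.inl hS)) hn with h | h | h | h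
        · exact h hwf.1
        · exact h hwf.2.1
        · exact hwf.2.2 h
        · rcases Finset.mem_union.1 h with h | h
          · exact hwB.1 (hB₀ w h)
          · exact hwB.2 h
    · intro b hb
      simp only [Finset.mem_union, Finset.mem_insert] at hb ⊢
      exact Or.inr (hb.imp_left (hB₀ b))
  · intro S hS hn
    rcases o₂.mem_fn hS hn with h | h | h | h
    · exact h hcΓ
    · rw [Ctx.set_apply, if_neg hc.symm] at h
      exact h hc₂
    · exact hcz h
    · exact hcB h

/-- Dually, the user's leaf consumes `w` only to offer it as `c`. The provider, renamed so as to
offer `c`, takes the place of this leaf; the subtyping between cut and leaf is applied to what it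
offers. Both are in the same domain, because the identity rule does not change domains. -/
theorem OT.forward_user (hd : Distinct Γ Δ z) (hf : Fresh (insert w (B₁ ∪ B₂)) Γ Δ z)
    (hw : w ∉ B₁ ∪ B₂) (hB : Disjoint B₁ B₂) (hs : Δ.Split Δ₁ Δ₂)
    (haa : AccAll 𝓡 Ω ω₂ Δ₁) (o₁ : OT 𝓡 Ω Γ Δ₁ B₁ M₁ w A ω₂)
    (o₂ : OT 𝓡 Ω Γ (Δ₂.set w (some (A, ω₂))) B₂ (S ::ₘ M₂) z C ω₁)
    (hS : S = .fwd w c ∨ S = .fwd c w) :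
    ∃ B', B' ⊆ insert w (B₁ ∪ B₂) ∧
      OT 𝓡 Ω Γ Δ B' ((M₁ + M₂).map (Proc.rename (mergeName w c))) z C ω₁ := by
  have hwB : w ∉ B₁ ∧ w ∉ B₂ := by simpa using hw
  have hwf := hf w (by simp)
  have F₁ : ∀ b ∈ B₁, b ∉ B₂ ∧ Γ b = none ∧ Δ b = none ∧ b ≠ z := fun b hb =>
    ⟨Finset.disjoint_left.1 hB hb, hf b (by simp [hb])⟩
  have F₂ : ∀ b ∈ B₂, b ∉ B₁ ∧ Γ b = none ∧ Δ b = none ∧ b ≠ z := fun b hb =>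
    ⟨Finset.disjoint_right.1 hB hb, hf b (by simp [hb])⟩
  obtain ⟨M₀, Γ', Δ', B₀, Bs, z', C', ω', H⟩ := o₂.userHole (Multiset.mem_cons_self _ _)
    (by rcases hS with rfl | rfl <;> simp)
  obtain rfl := (Multiset.cons_inj_right _).1 H.threads
  have hB₀ : ∀ b ∈ B₀, b ∈ B₂ := fun b hb => by simp [H.names, hb]
  have hz' : z' = z ∨ z' ∈ B₂ := H.root.imp_right (hB₀ z')
  have hwz' : w ≠ z' := by
    rintro rfl
    rcases hz' with h | h
    · exact hwf.2.2 h
    · exact hwB.2 h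
  have hw₀ : w ∉ B₀ := fun h => hwB.2 (hB₀ w h)
  obtain ⟨rfl, hΔ'⟩ : c = z' ∧ Δ' = Ctx.empty.set w (some (C', ω')) := by
    have h := H.blk
    rcases hS with rfl | rfl
    · cases h
      exact ⟨rfl, rfl⟩
    · cases h
      exact absurd rfl hwz'
  have hwΔ : Δ' w = some (C', ω') := by simp [hΔ', Ctx.set_apply]
  obtain ⟨rfl, hle⟩ : ω' = ω₂ ∧ Le ω' A C' := by
    obtain ⟨A₁, h₁, h₂⟩ := H.lin w C' ω' hw₀ hwΔ
    rw [Ctx.set_apply, if_pos rfl] at h₁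
    cases h₁
    exact ⟨rfl, h₂⟩
  have hcΓ' : Γ' c = none := H.dist.1
  have hcΓ : Γ c = none := by
    by_contra h
    obtain ⟨e, he⟩ := Option.ne_none_iff_exists'.1 h
    simp [H.unr c e he] at hcΓ'
  have hcΔ : Δ c = none := by
    rcases hz' with rfl | h
    · exact hd.2.1
    · exact (F₂ c h).2.2.1
  have hcB : c ∉ B₁ := by
    intro hc
    rcases hz' with rfl | h
    · exact (F₁ c hc).2.2.2 rfl
    · exact (F₁ c hc).1 h
  have hn₂ : ∀ n, n ≠ w → n ≠ c → Equiv.swap w c n = n := fun n =>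
    Equiv.swap_apply_of_ne_of_ne
  have hΓ' : ∀ n, Γ' n ≠ none → Γ n ≠ none ∨ n ∈ B₂ := fun n hn =>
    (H.unr_mem n hn).imp_right (hB₀ n)
  have hd₁ : Distinct Γ' Δ₁ c := by
    refine ⟨hcΓ', hs.left_none hcΔ, fun n => ?_⟩
    by_contra! h
    rcases hΓ' n h.1 with h' | h'
    · exact h.2 (hs.left_none ((hd.2.2 n).resolve_left h'))
    · exact h.2 (hs.left_none (F₂ n h').2.2.1)
  have hf₁ : Fresh B₁ Γ' Δ₁ c := by
    intro b hb
    obtain ⟨h₁, h₂, h₃, h₄⟩ := F₁ b hb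
    refine ⟨?_, hs.left_none h₃, ?_⟩
    · by_contra h
      rcases hΓ' b h with h | h
      · exact h h₂
      · exact h₁ h
    · rintro rfl
      exact hcB hb
  have hws : Equiv.swap w c w = c := Equiv.swap_apply_left _ _
  have o₁' := o₁.rename (Γ' := Γ') (Δ' := Δ₁) (Equiv.swap w c).injective
    (by
      intro n e hn
      rw [hn₂ n]
      · refine H.unr n e hn
      · rintro rfl
        simp [hwf.1] at hn
      · rintro rfl
        simp [hcΓ] at hn)
    (by
      have h₂ : ∀ n, Δ₁ n ≠ none → Equiv.swap w c n = n := by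
        intro n hn
        refine hn₂ n ?_ ?_
        · rintro rfl; exact hn (hs.left_none hwf.2.1)
        · rintro rfl; exact hn (hs.left_none hcΔ)
      refine ⟨fun n e hn => ?_, fun n e hn => ⟨n, hn, ?_⟩, fun n n' _ _ h =>
        (Equiv.swap w c).injective h⟩
      · rwa [h₂ n (by simp [hn])]
      · exact h₂ n (by simp [hn]))
    (by rw [hws]; exact hd₁)
    (by rw [image_swap_eq_self hwB.1 hcB, hws]; exact hf₁)
  rw [image_swap_eq_self hwB.1 hcB, hws, map_swap_eq_mergeName] at o₁'
  · have o₄ := H.plug w Δ₁ Δ₁ Δ B₁ _ hw₀ (fun _ => by simp [hwΔ])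
      (by
        rw [hΔ', Ctx.set_set]
        intro n
        refine Or.inr ⟨rfl, ?_⟩
        rw [Ctx.set_apply]
        split_ifs <;> rfl)
      (by
        rw [Ctx.set_set, Ctx.set_none_eq (hs.right_none hwf.2.1)]
        exact hs.symm) haa
      (Finset.disjoint_left.2 fun b hb => (F₂ b (hB₀ b hb)).1) hd (by
        intro b hb
        rcases Finset.mem_union.1 hb with h | h
        · exact (F₂ b (hB₀ b h)).2
        · exact (F₁ b h).2) (o₁'.le_right hle)
    refine ⟨B₀ ∪ B₁, ?_, ?_⟩
    · intro b hb
      simp only [Finset.mem_union, Finset.mem_insert] at hb ⊢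
      exact Or.inr (hb.symm.imp_right (hB₀ b))
    · rw [add_comm M₁, Multiset.map_add, map_mergeName_eq_self]
      · exact o₄
      · intro S hS hn
        rcases o₄.mem_fn (Multiset.mem_add.2 (Or.inl hS)) hn with h | h | h | h
        · exact h hwf.1
        · exact h hwf.2.1
        · exact hwf.2.2 h
        · rcases Finset.mem_union.1 h with h | h
          · exact hwB.2 (hB₀ w h)
          · exact hwB.1 h
  · intro S hS hn
    rcases o₁.mem_fn hS hn with h | h | h | h
    · exact h hcΓ
    · exact h (hs.left_none hcΔ)
    · exact hwz' h.symm
    · exact hcB h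

/-- Descend to the cut on `a`, and distinguish the side on which the forwarder lies. Until then `a`
is bound in the premise that contains the forwarder, so it does not occur in the other one and the
renaming leaves that premise unchanged. -/
theorem OT.forward (h : OT 𝓡 Ω Γ Δ B M z C ω) (hS : S = .fwd a c ∨ S = .fwd c a) (hac : a ≠ c) :
    ∀ {M₀}, M = S ::ₘ M₀ → a ∈ B →
    ∃ B', B' ⊆ B ∧ OT 𝓡 Ω Γ Δ B' (M₀.map (Proc.rename (mergeName a c))) z C ω := by
  have haS : a ∈ S.fn := by rcases hS with rfl | rfl <;> simp [Proc.fn]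
  induction h with
  | blk hd hf h =>
    intro M₀ hM ha
    have hM' := (Multiset.singleton_eq_cons_iff _).1 hM
    obtain ⟨rfl, rfl⟩ := hM'
    rcases hS with rfl | rfl <;> cases h <;> simp at ha
  | zero => intro M₀ hM; simp at hM
  | oneL hd hf hx _ ih =>
    intro M₀ hM ha
    obtain ⟨B', hB', o⟩ := ih hM ha
    exact ⟨B', hB', .oneL hd (hf.mono hB' fun _ h => h) hx o⟩
  | convL hd hf hx hc _ ih =>
    intro M₀ hM ha
    obtain ⟨B', hB', o⟩ := ih hM ha
    exact ⟨B', hB', .convL hd (hf.mono hB' fun _ h => h) hx hc o⟩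
  | convR hd hf hc _ ih =>
    intro M₀ hM ha
    obtain ⟨B', hB', o⟩ := ih hM ha
    exact ⟨B', hB', .convR hd (hf.mono hB' fun _ h => h) hc o⟩
  | @cut Γ Δ Δ₁ Δ₂ w B₁ B₂ M₁ M₂ z C ω₁ A ω₂ hd hf hw hB hs ha haa o₁ o₂ ih₁ ih₂ =>
    intro M₀ hM haB
    have hwB : w ∉ B₁ ∧ w ∉ B₂ := by simpa using hw
    have hmem : S ∈ M₁ + M₂ := by simp [hM]
    have haf := hf a haB
    rcases Multiset.mem_add.1 hmem with h | h
    · obtain ⟨M₁, rfl⟩ := Multiset.exists_cons_of_mem h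
      rw [Multiset.cons_add, Multiset.cons_inj_right] at hM
      subst hM
      rcases eq_or_ne a w with rfl | haw
      · exact OT.forward_provider hd hf hw hB hs ha haa o₁ o₂ hS hac
      · have ha₁ : a ∈ B₁ := by
          rcases o₁.mem_fn h haS with h | h | h | h
          · exact absurd haf.1 h
          · exact absurd (hs.left_none haf.2.1) h
          · exact absurd h haw
          · exact h
        obtain ⟨B', hB', o⟩ := ih₁ rfl ha₁
        have hsub : insert w (B' ∪ B₂) ⊆ insert w (B₁ ∪ B₂) :=
          Finset.insert_subset_insert _ (Finset.union_subset_union_left hB')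
        refine ⟨_, hsub, ?_⟩
        rw [Multiset.map_add, map_mergeName_eq_self (M := M₂)]
        · exact .cut hd (hf.mono hsub fun _ h => h)
            (fun h => hw (Finset.union_subset_union_left hB' h))
            (Finset.disjoint_of_subset_left hB' hB) hs ha haa o o₂
        · intro S hS hn
          rcases o₂.mem_fn hS hn with h | h | h | h
          · exact h haf.1
          · rw [Ctx.set_apply, if_neg haw] at h
            exact h (hs.right_none haf.2.1)
          · exact haf.2.2 h
          · exact Finset.disjoint_left.1 hB ha₁ h
    · obtain ⟨M₂, rfl⟩ := Multiset.exists_cons_of_mem h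
      rw [Multiset.add_cons, Multiset.cons_inj_right] at hM
      subst hM
      rcases eq_or_ne a w with rfl | haw
      · exact OT.forward_user hd hf hw hB hs haa o₁ o₂ hS
      · have ha₂ : a ∈ B₂ := by
          rcases o₂.mem_fn h haS with h | h | h | h
          · exact absurd haf.1 h
          · rw [Ctx.set_apply, if_neg haw] at h
            exact absurd (hs.right_none haf.2.1) h
          · exact absurd h haf.2.2
          · exact h
        obtain ⟨B', hB', o⟩ := ih₂ rfl ha₂
        have hsub : insert w (B₁ ∪ B') ⊆ insert w (B₁ ∪ B₂) :=
          Finset.insert_subset_insert _ (Finset.union_subset_union_right hB')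
        refine ⟨_, hsub, ?_⟩
        rw [Multiset.map_add, map_mergeName_eq_self (M := M₁)]
        · exact .cut hd (hf.mono hsub fun _ h => h)
            (fun h => hw (Finset.union_subset_union_right hB' h))
            (Finset.disjoint_of_subset_right hB' hB) hs ha haa o₁ o
        · intro S hS hn
          rcases o₁.mem_fn hS hn with h | h | h | h
          · exact h haf.1
          · exact h (hs.left_none haf.2.1)
          · exact haw h
          · exact Finset.disjoint_left.1 hB h ha₂
  | @cutBang Γ Δ u B P M z C ω₂ A ω₁ hd hf hu hP o ih =>
    intro M₀ hM haB
    have haf := hf a haB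
    have hmem : S ∈ .rep u P ::ₘ M := by simp [hM]
    have hSu : S ≠ .rep u P := by rcases hS with rfl | rfl <;> simp
    have h : S ∈ M := (Multiset.mem_cons.1 hmem).resolve_left hSu
    obtain ⟨M, rfl⟩ := Multiset.exists_cons_of_mem h
    rw [Multiset.cons_swap, Multiset.cons_inj_right] at hM
    subst hM
    -- Both names of a typed forwarder are linear or offered, so neither is the unrestricted name of
    -- this `cut!`.
    have hau : a ≠ u := by
      rintro rfl
      obtain ⟨M', Γ', Δ', B₀, Bs, z', C', ω', H⟩ := o.userHole h
        (by rcases hS with rfl | rfl <;> simp)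
      have h₁ : Γ' a = some (A, ω₁) := H.unr a _ (by simp [Ctx.set_apply])
      have h₂ := H.dist.2.2 a
      have h₃ := H.dist.1
      have h₄ := H.blk
      rcases hS with rfl | rfl <;> cases h₄ <;> simp [h₁, Ctx.set_apply] at h₂ h₃
    have ha : a ∈ B := (Finset.mem_insert.1 haB).resolve_left hau
    obtain ⟨B', hB', o'⟩ := ih rfl ha
    have hsub : insert u B' ⊆ insert u B := Finset.insert_subset_insert _ hB'
    refine ⟨_, hsub, ?_⟩
    have hr : (Proc.rep u P).rename (mergeName a c) = .rep u P := by
      refine Proc.rename_eq_self fun n hn => if_neg ?_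
      rintro rfl
      rcases hn with hn | hn
      · exact hau hn
      · rcases hP.mem_fn _ hn with h | h | h
        · exact h haf.1
        · exact h rfl
        · exact absurd h (by simp)
    rw [Multiset.map_cons, hr]
    exact .cutBang hd (hf.mono hsub fun _ h => h) (fun h => hu (hB' h)) hP o'

end

/-! ### Keeping free and bound names apart, and the preservation theorem -/

section

variable {𝓡 : Set AccRule} {Ω : AccCtx} {Γ Δ : Ctx} {P Q R S₁ S₂ S₁' S₂' T : Proc}
  {z x y n b : ℕ} {A : Ty} {ω : Dom} {B B₀ B₁ B₂ : Finset ℕ} {M M₁ M₂ : Multiset Proc}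
  {ρ : ℕ → ℕ}

/-- A flattening determines threads only up to `TEq`, so the threads that are actually typed
interact to a process congruent to the renamed contractum. -/
theorem Inter.rename_teq (h : Inter x S₁ S₂ T) (h₁ : TEq (S₁.rename ρ) S₁')
    (h₂ : TEq (S₂.rename ρ) S₂') : ∃ T', Inter (ρ x) S₁' S₂' T' ∧ Cong (T.rename ρ) T' := by
  cases h with
  | comm y P Q =>
    cases h₁ with
    | out h₁ =>
      cases h₂ with
      | inp h₂ =>
        refine ⟨_, .comm _ _ _ _, .par h₁ ?_⟩
        rw [Proc.rename_inst]
        exact h₂.rename _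
  | rep y P Q =>
    cases h₁ with
    | out h₁ =>
      cases h₂ with
      | rep h₂ =>
        refine ⟨_, .rep _ _ _ _, .par h₁ (.par ?_ (.rep h₂))⟩
        rw [Proc.rename_inst]
        exact h₂.rename _
  | move y ω ω' P Q =>
    cases h₁ with
    | moveOut h₁ =>
      cases h₂ with
      | moveIn h₂ =>
        refine ⟨_, .move _ _ _ _ _ _, .par h₁ ?_⟩
        rw [Proc.rename_inst]
        exact h₂.rename _
  | dom ω P Q =>
    cases h₁ with
    | domOut h₁ =>
      cases h₂ with
      | domIn h₂ =>
        refine ⟨_, .dom _ _ _ _, .par h₁ ?_⟩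
        rw [Proc.rename_dsubst]
        exact h₂.dsubst _
  | choice I j P Q =>
    cases h₁ with
    | sel h₁ =>
      cases h₂ with
      | branch h₂ => exact ⟨_, .choice _ _ _ _ _, .par h₁ (h₂ j)⟩

/-- The environment in which the name `n` is called `2 * n`. -/
def Ctx.dbl (Δ : Ctx) : Ctx := fun n => if Even n then Δ (n / 2) else none

theorem Ctx.dbl_two_mul (Δ : Ctx) (n : ℕ) : Δ.dbl (2 * n) = Δ n := by
  simp [Ctx.dbl]

theorem Ctx.dbl_ne_none (h : Ctx.dbl Δ n ≠ none) : ∃ m, n = 2 * m := by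
  unfold Ctx.dbl at h
  split_ifs at h with hn
  · obtain ⟨m, rfl⟩ := hn
    exact ⟨m, (two_mul m).symm⟩
  · exact absurd rfl h

theorem GMap.dbl (Γ : Ctx) : GMap (2 * ·) Γ Γ.dbl := fun n e h => by
  rwa [Ctx.dbl_two_mul]

theorem LMap.dbl (Δ : Ctx) : LMap (2 * ·) Δ Δ.dbl := by
  refine ⟨GMap.dbl Δ, fun m e h => ?_, fun n n' _ _ h => by simpa using h⟩
  obtain ⟨n, rfl⟩ := Ctx.dbl_ne_none (h.symm ▸ Option.some_ne_none e)
  exact ⟨n, by rwa [Ctx.dbl_two_mul] at h, rfl⟩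

theorem GMap.half (Γ : Ctx) : GMap (· / 2) Γ.dbl Γ := fun n e h => by
  obtain ⟨m, rfl⟩ := Ctx.dbl_ne_none (h.symm ▸ Option.some_ne_none e)
  rw [Ctx.dbl_two_mul] at h
  simpa using h

theorem LMap.half (Δ : Ctx) : LMap (· / 2) Δ.dbl Δ := by
  refine ⟨GMap.half Δ, fun m e h => ⟨2 * m, by rwa [Ctx.dbl_two_mul], by simp⟩,
    fun n n' h h' he => ?_⟩
  obtain ⟨m, rfl⟩ := Ctx.dbl_ne_none h
  obtain ⟨m', rfl⟩ := Ctx.dbl_ne_none h'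
  simpa using he

theorem Distinct.dbl (h : Distinct Γ Δ z) : Distinct Γ.dbl Δ.dbl (2 * z) := by
  obtain ⟨h₁, h₂, h₃⟩ := h
  refine ⟨by rwa [Ctx.dbl_two_mul], by rwa [Ctx.dbl_two_mul], fun n => ?_⟩
  by_contra! h
  obtain ⟨m, rfl⟩ := Ctx.dbl_ne_none h.1
  rw [Ctx.dbl_two_mul, Ctx.dbl_two_mul] at h
  exact h.2 ((h₃ m).resolve_left h.1)

theorem infinite_odd : {n : ℕ | Odd n}.Infinite :=
  Set.infinite_of_injective_forall_mem (f := fun n : ℕ => 2 * n + 1)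
    (fun a b h => by simpa using h) fun n => ⟨n, rfl⟩

theorem not_odd_two_mul (n : ℕ) : ¬ Odd (2 * n) := by simp

theorem OT.even_or_mem (h : OT 𝓡 Ω Γ.dbl Δ.dbl B M (2 * z) A ω) {S : Proc} (hS : S ∈ M)
    (hn : n ∈ S.fn) : (∃ m, n = 2 * m) ∨ n ∈ B := by
  rcases h.mem_fn hS hn with h | h | h | h
  · exact Or.inl (Ctx.dbl_ne_none h)
  · exact Or.inl (Ctx.dbl_ne_none h)
  · exact Or.inl ⟨z, h⟩
  · exact Or.inr h

/-- Free names are even and bound names odd, so nothing is captured, and a name of a thread is bound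
on one side exactly if it is bound on the other. Hence the process read off from `h` is congruent to
`Q` with its names doubled, and halving the names gives back `Q`. -/
theorem OT.typed_of_flat (hd : Distinct Γ Δ z) (h : OT 𝓡 Ω Γ.dbl Δ.dbl B M (2 * z) A ω)
    (hB : ∀ b ∈ B, Odd b) (hQ : Flat Q (2 * ·) B₁ M) (hB₁ : ∀ b ∈ B₁, Odd b) :
    Typed 𝓡 Ω Γ Δ Q z A ω := by
  obtain ⟨P, hP, ht⟩ := h.exists_typed
  have hc : Cong (P.rename id) (Q.rename (2 * ·)) := by
    refine cong_of_flat hP hQ (fun m hm hmB => ?_)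
      (fun m _ hm => not_odd_two_mul m (hB₁ _ hm)) fun S hS n hn => ?_
    · have h₁ : ∃ k, m = 2 * k := by
        rcases ht.mem_fn m hm with h | h | h
        · exact Ctx.dbl_ne_none h
        · exact Ctx.dbl_ne_none h
        · exact ⟨z, h⟩
      obtain ⟨k, rfl⟩ := h₁
      exact not_odd_two_mul k (hB _ hmB)
    · have h₁ := h.even_or_mem hS hn
      have h₂ := hQ.mem_fn _ S hS n hn
      constructor
      · intro h₃
        refine h₂.resolve_right ?_
        rintro ⟨m, -, rfl⟩
        exact not_odd_two_mul m (hB _ h₃)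
      · intro h₃
        refine h₁.resolve_left ?_
        rintro ⟨m, rfl⟩
        exact not_odd_two_mul m (hB₁ _ h₃)
  rw [Proc.rename_id] at hc
  have e : (fun x : ℕ => x / 2) ∘ (fun x => 2 * x) = id := by
    funext n
    simp
  have := (ht.cong hc).rename (GMap.half Γ) (LMap.half Δ) (by simpa using hd)
  rwa [Proc.rename_rename, e, Proc.rename_id, Nat.mul_div_cancel_left z two_pos] at this

/-- Type preservation. -/
theorem Typed.red (h : Typed 𝓡 Ω Γ Δ P z A ω) (hr : Red P Q) : Typed 𝓡 Ω Γ Δ Q z A ω := by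
  obtain ⟨n, R, X, T, hX, hP, hQ⟩ := hr.standard
  refine Typed.cong ?_ hQ.symm
  -- Doubling the free names leaves the odd numbers as an infinite supply for restrictions and cuts.
  obtain ⟨Bf, B, M, hf, ho, hBf, hB⟩ := (h.cong hP).real (GMap.dbl Γ) (LMap.dbl Δ) h.distinct.dbl
    {n | Odd n} infinite_odd fun n hn => by
      have h₁ : ∀ {Δ : Ctx}, Δ.dbl n = none := by
        intro Δ
        by_contra h
        obtain ⟨m, rfl⟩ := Ctx.dbl_ne_none h
        exact not_odd_two_mul m hn
      refine ⟨by simp, h₁, h₁, ?_⟩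
      rintro rfl
      exact not_odd_two_mul z hn
  have hB' : ∀ b ∈ B, Odd b := fun b hb => by simpa using hB hb
  have hBf' : ∀ b ∈ Bf, Odd b := fun b hb => hBf hb
  obtain ⟨ρ, B₀, B₁, hB₀, rfl, hRX, hρ, hre⟩ := hf.nuN_inv
  obtain ⟨BR, BX, MR, MX, rfl, rfl, hd, hR, hX'⟩ := hRX
  have hρB : ∀ m b, b ∈ BR ∪ BX → ρ m ≠ b := by
    rintro m b hb rfl
    rcases hρ m with h | ⟨m', h⟩
    · exact Finset.disjoint_left.1 hB₀ h hb
    · refine not_odd_two_mul m' ?_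
      have := hBf' _ (Finset.mem_union_right _ hb)
      rwa [← h] at this
  cases hX with
  | inter hI =>
    rename_i x S₁ S₂
    obtain ⟨C₁, C₂, L₁, L₂, rfl, rfl, -, f₁, f₂⟩ := hX'
    have t₁ : S₁.IsThread := by cases hI <;> trivial
    have t₂ : S₂.IsThread := by cases hI <;> trivial
    obtain ⟨rfl, S₁', e₁, rfl⟩ := (flat_thread t₁).1 f₁
    obtain ⟨rfl, S₂', e₂, rfl⟩ := (flat_thread t₂).1 f₂
    obtain ⟨T', hI', hT⟩ := hI.rename_teq e₁ e₂
    -- The contractum gets names outside those of the derivation, of the outer restrictions and of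
    -- the passive process.
    have hN := infinite_sdiff_finset infinite_odd (B ∪ (B₀ ∪ (BR ∪ (∅ ∪ ∅))))
    obtain ⟨Bf', MT, B', f', o', s, t⟩ := OT.contracts hI' ho hN (M₀ := MR)
      (by rw [add_comm]; simp) fun n hn => by
        have hn₁ : Odd n := hn.1
        have hn₂ : n ∉ B := fun h => hn.2 (by simp [h])
        have h₁ : ∀ {Δ : Ctx}, Δ.dbl n = none := by
          intro Δ
          by_contra h
          obtain ⟨m, rfl⟩ := Ctx.dbl_ne_none h
          exact not_odd_two_mul m hn₁
        refine ⟨hn₂, h₁, h₁, ?_⟩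
        rintro rfl
        exact not_odd_two_mul z hn₁
    -- From the contractum of the typed threads back to the renamed `T`, with the same multiset.
    obtain ⟨Bf'', f'', s'⟩ := hT.symm.flatLE.1 _ _ _ _ hN f'
    rw [flat_rename, Function.id_comp] at f''
    have s'' : ∀ b ∈ Bf'', Odd b ∧ b ∉ B₀ ∧ b ∉ BR := by
      intro b hb
      have : b ∈ {n : ℕ | Odd n} \ ((B ∪ (B₀ ∪ (BR ∪ (∅ ∪ ∅))) : Finset ℕ) : Set ℕ) :=
        (s' hb).elim (fun h => s h) fun h => h
      refine ⟨this.1, fun h => this.2 (by simp [h]), fun h => this.2 (by simp [h])⟩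
    have fR : Flat (.par R T) ρ (BR ∪ Bf'') (MR + MT) :=
      ⟨BR, Bf'', MR, MT, rfl, rfl, Finset.disjoint_right.2 fun b hb => (s'' b hb).2.2, hR, f''⟩
    have fQ := hre fR (by
      rw [Finset.disjoint_union_right]
      exact ⟨Finset.disjoint_of_subset_right Finset.subset_union_left hB₀,
        Finset.disjoint_right.2 fun b hb => (s'' b hb).2.1⟩)
    rw [add_comm] at o'
    refine o'.typed_of_flat h.distinct (fun b hb => ?_) fQ fun b hb => ?_
    · rcases t b hb with h | h
      · exact hB' b h
      · exact h.1
    · simp only [Finset.mem_union] at hb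
      rcases hb with h | h | h
      · exact hBf' b (by simp [h])
      · exact hBf' b (by simp [h])
      · exact (s'' b h).1
  | fwd y P₀ =>
    obtain ⟨b, BP, hb, rfl, C₁, C₂, L₁, L₂, rfl, rfl, -, f₁, f₂⟩ := hX'
    obtain ⟨rfl, S, e, rfl⟩ := f₁
    rw [Finset.empty_union] at *
    have hbρ : ∀ m, ρ m ≠ b := fun m => hρB m b (by simp)
    have hS : S = .fwd b (ρ y) ∨ S = .fwd (ρ y) b := by
      cases e
      · exact Or.inl rfl
      · exact Or.inr rfl
    -- The names of the flattening and those bound in the derivation need not coincide, but `b`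
    -- occurs in a thread and is odd, so it can only be bound.
    have hbB : b ∈ B := by
      refine (ho.even_or_mem (S := S) (by simp) ?_).resolve_left ?_
      · rcases hS with rfl | rfl <;> simp [Proc.fn]
      · rintro ⟨m, hm⟩
        refine not_odd_two_mul m ?_
        rw [← hm]
        exact hBf' b (by simp)
    obtain ⟨B', hB'', o'⟩ := ho.forward hS (hbρ y).symm (M₀ := MR + L₂)
      (by rw [Multiset.singleton_add, Multiset.add_cons]) hbB
    have hσ : mergeName b (ρ y) ∘ ρ = ρ := by
      funext m
      exact if_neg (hbρ m)
    -- Identifying `b` with the image of `y` after flattening amounts to substituting `y` before it.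
    have hσ' : mergeName b (ρ y) ∘ consName b ρ = ρ ∘ instName y := by
      funext m
      cases m with
      | zero => exact if_pos rfl
      | succ m => exact if_neg (hbρ m)
    have g₁ := hR.postcomp (σ := mergeName b (ρ y)) _ fun b' hb' => by
      refine if_neg ?_
      rintro rfl
      exact Finset.disjoint_left.1 hd hb' (by simp)
    have g₂ := f₂.postcomp (σ := mergeName b (ρ y)) _ fun b' hb' => by
      refine if_neg ?_
      rintro rfl
      exact hb hb'
    rw [hσ] at g₁
    rw [hσ', ← flat_rename] at g₂
    have hd' : BR ∪ C₂ ⊆ BR ∪ insert b C₂ :=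
      Finset.union_subset_union_right (Finset.subset_insert _ _)
    have fQ := hre (X' := .par R (P₀.inst y))
      ⟨BR, C₂, _, _, rfl, rfl,
        Finset.disjoint_of_subset_right (Finset.subset_insert _ _) hd, g₁, g₂⟩
      (Finset.disjoint_of_subset_right hd' hB₀)
    rw [Multiset.map_add] at o'
    refine o'.typed_of_flat h.distinct (fun b hb => hB' b (hB'' hb)) fQ fun b hb => ?_
    exact hBf' b (Finset.union_subset_union_right hd' hb)

end

end DomainSession

theorem mainTheorem1 (𝓡 : Set DomainSession.AccRule) (Ω : DomainSession.AccCtx)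
    (Γ Δ : DomainSession.Ctx) (P Q : DomainSession.Proc) (z : ℕ)
    (A : DomainSession.Ty) (ω : DomainSession.Dom)
    (hP : DomainSession.Typed 𝓡 Ω Γ Δ P z A ω) (hPQ : DomainSession.Red P Q) :
    DomainSession.Typed 𝓡 Ω Γ Δ Q z A ω := by
  exact hP.red hPQ
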